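/- **Notation.** Let $G=\mathrm{PSL}(2,\mathbb R)$, with elements $n[x]=\begin{pmatrix}1&x\\0&1\end{pmatrix}$ $(x\in\mathbb R)$, $a[y]=\begin{pmatrix}\sqrt y&0\\0&1/\sqrt y\end{pmatrix}$ $(y>0)$, $k[\theta]=\begin{pmatrix}\cos\theta&\sin\theta\\-\sin\theta&\cos\theta\end{pmatrix}$ and $w=\begin{pmatrix}0&1\\-1&0\end{pmatrix}$. Every $g\in G$ is $g=n[x]a[y]k[\theta]$ with unique $x\in\mathbb R$, $y>0$ and $\theta\in\mathbb R/\pi\mathbb Z$. Put $e(x)=e^{2\pi i x}$ and $\mathbb R^\times=\mathbb R\setminus\{0\}$, $d^\times\lambda=d\lambda/|\lambda|$. Let $\omega(h)f(g)=f(gh)$ denote right translation. For $p\in\mathbb Z$ and $\nu\in\mathbb C$ put $\phi_p(g,\nu)=y^{\nu+1/2}e^{2pi\theta}$. Let $\nu\in\mathbb C$. A function $\phi$ on $G$ is called smooth (with parameter $\nu$) if $\phi=\sum_{p\in\mathbb Z}c_p\,\phi_p(\cdot,\nu)$ with coefficients $c_p\in\mathbb C$ that decay faster than any negative power of $|p|$.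 For such $\phi$, $\delta=\pm1$ and $g\in G$, let $\mathcal A^\delta\phi(g)$ be the value at $\mu=\nu$ of the analytic continuation to all $\mu\in\mathbb C$ of $$\int_{-\infty}^\infty e(-\delta\xi)\,\Phi_\mu(w\,n[\xi]\,g)\,d\xi\quad(\mathrm{Re}\,\mu>0),\qquad \Phi_\mu=\sum_{p}c_p\,\phi_p(\cdot,\mu),$$ and define the Kirillov operator by $\mathcal K\phi(u)=\mathcal A^{\mathrm{sgn}(u)}\phi(a[|u|])$ for $u\in\mathbb R^\times$. **Lemma 6.1.** Let $\nu\in\mathbb C$ and let $\phi$ be smooth with parameter $\nu$. For $\phi$ and all its right translates, the integrals above converge absolutely for $\mathrm{Re}\,\mu>0$ and continue to entire functions of $\mu$, so that $\mathcal K$ is defined on them, and for all $u\in\mathbb R^\times$, $x\in\mathbb R$ and $y>0$, $$\mathcal K\omega(n[x])\phi(u)=e(ux)\,\mathcal K\phi(u),\qquad \mathcal K\omega(a[y])\phi(u)=\mathcal K\phi(uy).$$ If moreover $|\mathrm{Re}\,\nu|<\tfrac12$, then for all $u\in\mathbb R^\times$ $$\mathcal K\omega(w)\phi(u)=\int_{\mathbb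 R^\times}j_\nu(u\lambda)\,\mathcal K\phi(\lambda)\,d^\times\lambda,$$ where the integral converges absolutely and $$j_\nu(u)=\pi\frac{\sqrt{|u|}}{\sin\pi\nu}\left(J^{\mathrm{sgn}(u)}_{-2\nu}(4\pi\sqrt{|u|})-J^{\mathrm{sgn}(u)}_{2\nu}(4\pi\sqrt{|u|})\right),$$ with $J^+_\alpha=J_\alpha$ and $J^-_\alpha=I_\alpha$ the ordinary Bessel functions; at $\nu=0$ the right side is understood as its limit as $\nu\to0$, which exists. -/

import Mathlib

open Filter Topology MeasureTheory

noncomputable section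

namespace Kirillov

/-- The group `PSL(2, ℝ)`. -/
abbrev G : Type := Matrix.ProjectiveSpecialLinearGroup (Fin 2) ℝ

/-- The class in `PSL(2, ℝ)` of a real `2 × 2` matrix of determinant one. -/
def ofSL (g : Matrix.SpecialLinearGroup (Fin 2) ℝ) : G := QuotientGroup.mk g

/-- The unipotent element `n[x]`. -/
def n (x : ℝ) : G := ofSL ⟨!![1, x; 0, 1], by simp [Matrix.det_fin_two]⟩

/-- The diagonal element `a[y] = diag(√y, 1/√y)` for `y > 0`
(given the irrelevant value `1` for `y ≤ 0`). -/
def a (y : ℝ) : G :=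
  if h : 0 < y then
    ofSL ⟨!![√y, 0; 0, 1 / √y], by
      simp [Matrix.det_fin_two, (Real.sqrt_pos.2 h).ne']⟩
  else 1

/-- The Weyl element `w`. -/
def w : G := ofSL ⟨!![0, 1; -1, 0], by simp [Matrix.det_fin_two]⟩

/-- Two matrices with the same class in `PSL(2, ℝ)` differ by a sign. -/
theorem eq_or_neg_of_rel {g h : Matrix.SpecialLinearGroup (Fin 2) ℝ}
    (hgh : QuotientGroup.leftRel
      (Subgroup.center (Matrix.SpecialLinearGroup (Fin 2) ℝ)) g h) :
    ∃ r : ℝ, (r = 1 ∨ r = -1) ∧ ∀ i j, h i j = r * g i j := by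
  rw [QuotientGroup.leftRel_apply, Matrix.SpecialLinearGroup.mem_center_iff] at hgh
  obtain ⟨r, hr, hs⟩ := hgh
  refine ⟨r, ?_, ?_⟩
  · simpa using hr
  · intro i j
    have h1 : h = g * (g⁻¹ * h) := by group
    have h2 : (h : Matrix (Fin 2) (Fin 2) ℝ) = g.1 * Matrix.scalar (Fin 2) r := by
      rw [hs, ← Matrix.SpecialLinearGroup.coe_mul, ← h1]
    rw [h2]
    simp [mul_comm]

/-- The Iwasawa coordinate `y = (c² + d²)⁻¹` of `g = n[x] a[y] k[θ] = [a b; c d]`. -/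
def height (g : G) : ℝ :=
  Quotient.liftOn' g (fun g => ((g 1 0) ^ 2 + (g 1 1) ^ 2)⁻¹) (by
    intro g h hgh
    obtain ⟨r, hr, hs⟩ := eq_or_neg_of_rel hgh
    rcases hr with rfl | rfl <;> simp [hs])

/-- The Iwasawa coordinate `exp(2iθ)` of `g = n[x] a[y] k[θ] = [a b; c d]`, where
`exp(iθ) = (d - ic) / |d - ic|`. -/
def angle (g : G) : ℂ :=
  Quotient.liftOn' g (fun g =>
    ((((g 1 1 : ℝ) : ℂ) - Complex.I * ((g 1 0 : ℝ) : ℂ)) /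
      ((‖((g 1 1 : ℝ) : ℂ) - Complex.I * ((g 1 0 : ℝ) : ℂ)‖ : ℝ) : ℂ)) ^ 2) (by
    intro g h hgh
    obtain ⟨r, hr, hs⟩ := eq_or_neg_of_rel hgh
    rcases hr with rfl | rfl
    · simp [hs]
    · have key : ∀ z t : ℂ, -z - Complex.I * -t = -(z - Complex.I * t) := by
        intro z t; ring
      simp only [hs, neg_one_mul, Complex.ofReal_neg, key, norm_neg, neg_div, neg_sq])

/-- `e(x) = exp(2πix)`. -/
def e (x : ℝ) : ℂ := Complex.exp (2 * Real.pi * Complex.I * x)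

/-- `φ_p(g, ν) = y^{ν + 1/2} exp(2piθ)` for `g = n[x] a[y] k[θ]`. -/
def phi (p : ℤ) (ν : ℂ) (g : G) : ℂ := (height g : ℂ) ^ (ν + 1 / 2) * angle g ^ p

/-- A function `φ` on `G` is a smooth vector with parameter `ν` if
`φ = ∑_p c_p φ_p(·, ν)`, where `c_p` decays faster than any negative power of `|p|`. -/
def IsSmoothVector (ν : ℂ) (φ : G → ℂ) : Prop :=
  ∃ c : ℤ → ℂ, (∀ k : ℕ, ∃ C : ℝ, ∀ p : ℤ, |(p : ℝ)| ^ k * ‖c p‖ ≤ C) ∧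
    ∀ g : G, HasSum (fun p : ℤ => c p * phi p ν g) (φ g)

/-- Right translation: `(ω(h) f)(g) = f(gh)`. -/
def rightTranslation (h : G) (f : G → ℂ) (g : G) : ℂ := f (g * h)

/-- The Jacquet integral `∫ e(-δξ) f(w n[ξ] g) dξ`, when it converges absolutely. -/
def jacquetIntegral (δ : ℝ) (f : G → ℂ) (g : G) : ℂ :=
  ∫ ξ : ℝ, e (-(δ * ξ)) * f (w * n ξ * g)

/-- Absolute convergence of the Jacquet integral. -/
def JacquetConverges (δ : ℝ) (f : G → ℂ) (g : G) : Prop :=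
  Integrable (fun ξ : ℝ => e (-(δ * ξ)) * f (w * n ξ * g))

/-- The analytic family through `φ`: if `φ = ∑_p c_p φ_p(·, ν₀)`, then
`deform ν₀ φ ν = ∑_p c_p φ_p(·, ν)` with the same coefficients `c_p`. -/
def deform (ν₀ : ℂ) (φ : G → ℂ) (ν : ℂ) (g : G) : ℂ :=
  φ g * (height g : ℂ) ^ (ν - ν₀)

/-- `F` is the analytic continuation to all `ν ∈ ℂ` of the Jacquet integral of the family
`∑_p c_p φ_p(·, ν)` through `φ = ∑_p c_p φ_p(·, ν₀)`; the integral itself converges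
absolutely for `Re ν > 0`. -/
structure IsJacquetContinuation (δ : ℝ) (ν₀ : ℂ) (φ : G → ℂ) (g : G) (F : ℂ → ℂ) :
    Prop where
  entire : Differentiable ℂ F
  converges : ∀ ν : ℂ, 0 < ν.re → JacquetConverges δ (deform ν₀ φ ν) g
  eq_integral : ∀ ν : ℂ, 0 < ν.re → F ν = jacquetIntegral δ (deform ν₀ φ ν) g

/-- The analytic continuation is unique. -/
theorem IsJacquetContinuation.unique {δ : ℝ} {ν₀ : ℂ} {φ : G → ℂ} {g : G} {F F' : ℂ → ℂ}
    (hF : IsJacquetContinuation δ ν₀ φ g F) (hF' : IsJacquetContinuation δ ν₀ φ g F') :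
    F = F' := by
  have h1 : AnalyticOnNhd ℂ F Set.univ := fun z _ => hF.entire.analyticAt z
  have h2 : AnalyticOnNhd ℂ F' Set.univ := fun z _ => hF'.entire.analyticAt z
  refine h1.eq_of_eventuallyEq h2 (z₀ := 1) ?_
  have ho : {ν : ℂ | 0 < ν.re} ∈ 𝓝 (1 : ℂ) :=
    (isOpen_lt continuous_const Complex.continuous_re).mem_nhds (by simp)
  filter_upwards [ho] with ν hν
  rw [hF.eq_integral ν hν, hF'.eq_integral ν hν]

open Classical in
/-- The Jacquet transform `𝒜^δ φ(g)` of a function `φ = ∑_p c_p φ_p(·, ν₀)`: the value at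
`ν = ν₀` of the analytic continuation of the Jacquet integral of `∑_p c_p φ_p(·, ν)`. -/
def jacquet (δ : ℝ) (ν₀ : ℂ) (φ : G → ℂ) (g : G) : ℂ :=
  if h : ∃ F : ℂ → ℂ, IsJacquetContinuation δ ν₀ φ g F then h.choose ν₀ else 0

/-- The Kirillov operator `𝒦φ(u) = 𝒜^{sgn u} φ(a[|u|])`, for `u ≠ 0`. -/
def kirillov (ν : ℂ) (φ : G → ℂ) (u : ℝ) : ℂ := jacquet (Real.sign u) ν φ (a |u|)

/-- The Bessel function `J_α(x)`, for `x > 0`. (The value of `Complex.Gamma` at its poles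
is `0`, so that its inverse there is the correct value `0` of the entire function `1/Γ`.) -/
def besselJ (α : ℂ) (x : ℝ) : ℂ :=
  ∑' k : ℕ, (-1) ^ k / ((k.factorial : ℂ) * Complex.Gamma (α + k + 1)) *
    ((x / 2 : ℝ) : ℂ) ^ (α + 2 * k)

/-- The modified Bessel function `I_α(x)`, for `x > 0`. -/
def besselI (α : ℂ) (x : ℝ) : ℂ :=
  ∑' k : ℕ, 1 / ((k.factorial : ℂ) * Complex.Gamma (α + k + 1)) *
    ((x / 2 : ℝ) : ℂ) ^ (α + 2 * k)

/-- `J^{sgn u}_α(x)`, with `J⁺ = J` and `J⁻ = I`. -/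
def besselSign (u : ℝ) (α : ℂ) (x : ℝ) : ℂ :=
  if 0 < u then besselJ α x else besselI α x

/-- The expression
`π √|u| / sin(πν) * (J^{sgn u}_{-2ν}(4π√|u|) - J^{sgn u}_{2ν}(4π√|u|))`. -/
def besselQuotient (ν : ℂ) (u : ℝ) : ℂ :=
  Real.pi * (√|u| : ℝ) / Complex.sin (Real.pi * ν) *
    (besselSign u (-(2 * ν)) (4 * Real.pi * √|u|) -
      besselSign u (2 * ν) (4 * Real.pi * √|u|))

open Classical in
/-- The kernel `j_ν(u)`; where `sin(πν) = 0` the quotient is understood as its limit. -/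
def besselKernel (ν : ℂ) (u : ℝ) : ℂ :=
  if Complex.sin (Real.pi * ν) = 0 then
    limUnder (𝓝[≠] ν) (fun μ : ℂ => besselQuotient μ u)
  else besselQuotient ν u

end Kirillov

end

/-!
Why the Kirillov operator intertwines as claimed.

**Equivariance.** A smooth vector depends only on the bottom row of a matrix, up to sign, so it is
the restriction of a function `Ψ` on `ℂ ∖ {0}` that is smooth in the real sense and satisfies
`Ψ (r z) = |r| ^ (-(2ν + 1)) Ψ z` for real `r ≠ 0` (`IsSmoothVector.exists_isLift`; rapid decay of
the coefficients gives the smoothness). Lifts, unlike Fourier coefficients, are visibly stable under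
right translation (`IsLift.translate`). Along `w n[x] g` the family through `φ` is, up to an affine
change of variable and a constant factor, a symbol `(1 + x²) ^ (-s) f (arctan x)` with `s = μ + 1/2`
and `f` smooth, whose derivatives of order `N` are `O((1 + x²) ^ (-Re s - N/2))`. Integrating the
Jacquet integral by parts `N` times thus continues it to `Re s + N/2 > 1/2`, and all `N` together
give an entire function (`IsLift.isJacquetContinuation`). Its value at `μ = ν` is a regularized
Fourier transform of `x ↦ Ψ (x - i)` (`IsLift.kirillov_eq`), and the two equivariance formulas
become the rules for Fourier transforms of translates and dilates.

**The Weyl element, for `0 < Re μ < 1/2`.** The translate by `w` has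
`Ψ_w (x - i) = |x| ^ (-2μ - 1) Ψ (-1/x - i)` for `x ≠ 0`. Writing `Ψ (-1/x - i)` by Fourier
inversion and exchanging the integrals leads formally to the kernel
`∫ |x| ^ (-2μ - 1) e(-u x - l / x) dx`. A convergence factor `exp (-ε (|x| + 1/|x|))` makes Fubini
legitimate and turns the kernel into two Macdonald integrals
`∫₀^∞ exp (-p t - q / t) t ^ (-α - 1) dt` with `α = 2μ`. These are expressed through Bessel series
(`macdonald_eq`) by means of two Wronskian identities, `macdonald_wronskian` and
`besselSeries_wronskian`, so that the limit `ε → 0` of the kernel is the quotient defining `j_μ`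
(`tendsto_regKernel`). The limit may be taken under the integral sign because an integration by
parts bounds the Macdonald integrals uniformly up to the imaginary axis (`norm_macdonald_le`). The
result is `kirillov_w_of_re_pos`.

**The strip `|Re ν| < 1/2`.** With `f` fixed, both sides of the formula are holomorphic in `μ` on
the strip, the right side because its integrand has a locally uniform integrable majorant
(`exists_majorant`): the same uniform bounds control `j_μ`, and regularized Fourier transforms decay
rapidly at infinity and are not too singular at `0` (`norm_regFourier_one_le`). The identity theorem
extends the formula from `0 < Re μ < 1/2` to the strip (`kirillov_w`).
-/

noncomputable section

namespace Kirillov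

open scoped ContDiff

/-! ### Holomorphic dependence of integrals, and symbols on the real line -/

/-- An integral of holomorphic functions with a locally uniform integrable majorant is holomorphic.
No bound on the derivative is assumed: it comes from Cauchy's estimate. -/
theorem differentiableAt_integral_of_bound {α : Type*} [MeasurableSpace α] {μ : Measure α}
    {F : ℂ → α → ℂ} {bound : α → ℝ} {z₀ : ℂ} {r : ℝ} (hr : 0 < r)
    (hmeas : ∀ z ∈ Metric.ball z₀ r, AEStronglyMeasurable (F z) μ)
    (hdiff : ∀ᵐ x ∂μ, DifferentiableOn ℂ (fun z => F z x) (Metric.ball z₀ r))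
    (hb : ∀ᵐ x ∂μ, ∀ z ∈ Metric.ball z₀ r, ‖F z x‖ ≤ bound x) (hint : Integrable bound μ) :
    DifferentiableAt ℂ (fun z => ∫ x, F z x ∂μ) z₀ := by
  have hz₀ : z₀ ∈ Metric.ball z₀ r := Metric.mem_ball_self hr
  have hr2 : 0 < r / 2 := by positivity
  have hsub : ∀ z ∈ Metric.ball z₀ (r / 2), Metric.closedBall z (r / 4) ⊆ Metric.ball z₀ r := by
    intro z hz
    refine Metric.closedBall_subset_ball' ?_
    rw [Metric.mem_ball] at hz
    linarith
  refine (hasDerivAt_integral_of_dominated_loc_of_deriv_le (s := Metric.ball z₀ (r / 2))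
    (F' := fun z x => deriv (fun z => F z x) z) (bound := fun x => bound x / (r / 4))
    (Metric.ball_mem_nhds _ hr2) ?_ ?_ ?_ ?_ (hint.div_const _) ?_).2.differentiableAt
  · filter_upwards [Metric.ball_mem_nhds z₀ hr] with z hz using hmeas z hz
  · exact hint.mono' (hmeas z₀ hz₀) (hb.mono fun x hx => hx z₀ hz₀)
  · -- the derivative is a limit of measurable difference quotients
    obtain ⟨N, hN⟩ := exists_nat_gt (1 / r)
    set ε : ℕ → ℂ := fun k => (1 / ((k : ℂ) + (N + 1 : ℕ))) with hε
    have hε0 : ∀ k, ε k ≠ 0 := fun k => by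
      simp only [hε]; exact one_div_ne_zero (by exact_mod_cast (by omega : k + (N + 1) ≠ 0))
    have hεlim : Tendsto ε atTop (𝓝 0) := by
      have h := (tendsto_add_atTop_iff_nat (N + 1)).2 (tendsto_one_div_atTop_nhds_zero_nat (𝕜 := ℂ))
      refine h.congr fun k => ?_
      simp [hε]
    have hεr : ∀ k, z₀ + ε k ∈ Metric.ball z₀ r := fun k => by
      have h1 : ‖ε k‖ = 1 / ((k : ℝ) + (N + 1 : ℕ)) := by
        simp only [hε, norm_div, norm_one]
        rw [← Nat.cast_add, Complex.norm_natCast]; push_cast; ring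
      rw [Metric.mem_ball, dist_eq_norm, add_sub_cancel_left, h1]
      have h2 : 0 < 1 / r := by positivity
      rw [div_lt_iff₀ (by positivity)]
      have h3 : (1 / r) * r = 1 := by field_simp
      push_cast
      nlinarith [(Nat.cast_nonneg k : (0 : ℝ) ≤ k)]
    refine aestronglyMeasurable_of_tendsto_ae (u := atTop)
      (f := fun k x => (ε k)⁻¹ * (F (z₀ + ε k) x - F z₀ x)) ?_ ?_
    · intro k
      exact ((hmeas _ (hεr k)).sub (hmeas _ hz₀)).const_mul _
    · filter_upwards [hdiff] with x hx
      have h1 : HasDerivAt (fun z => F z x) (deriv (fun z => F z x) z₀) z₀ :=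
        (hx.differentiableAt (Metric.ball_mem_nhds z₀ hr)).hasDerivAt
      have h2 := (hasDerivAt_iff_tendsto_slope_zero.1 h1).comp
        (tendsto_nhdsWithin_iff.2 ⟨hεlim, Eventually.of_forall hε0⟩)
      simpa [Function.comp_def] using h2
  · filter_upwards [hdiff, hb] with x hx hbx z hz
    refine Complex.norm_deriv_le_of_forall_mem_sphere_norm_le (by positivity) ?_ ?_
    · refine DifferentiableOn.diffContOnCl ?_
      rw [closure_ball _ (by positivity)]
      exact hx.mono (hsub z hz)
    · intro w hw
      exact hbx w (hsub z hz (Metric.sphere_subset_closedBall hw))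
  · filter_upwards [hdiff] with x hx z hz
    refine (hx.differentiableAt (Metric.isOpen_ball.mem_nhds ?_)).hasDerivAt
    exact Metric.ball_subset_ball (by linarith) hz

theorem ofReal_cpow_eq_exp {x : ℝ} (hx : 0 < x) (s : ℂ) :
    (x : ℂ) ^ s = Complex.exp (s * (Real.log x : ℝ)) := by
  rw [Complex.cpow_def_of_ne_zero (by exact_mod_cast hx.ne'), Complex.ofReal_log hx.le, mul_comm]

theorem one_add_sq_pos (x : ℝ) : 0 < 1 + x ^ 2 := by positivity

/-- The function `(1 + x²) ^ (-s) * f (arctan x)`. For smooth `f`, each derivative gains a factor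
`(1 + x²) ^ (-1/2)`. -/
def symb (s : ℂ) (f : ℝ → ℂ) (x : ℝ) : ℂ := ((1 + x ^ 2 : ℝ) : ℂ) ^ (-s) * f (Real.arctan x)

theorem symb_eq_exp (s : ℂ) (f : ℝ → ℂ) :
    symb s f = fun x => Complex.exp (-s * (Real.log (1 + x ^ 2) : ℝ)) * f (Real.arctan x) := by
  ext x
  rw [symb, ofReal_cpow_eq_exp (one_add_sq_pos x)]

theorem contDiff_symb (s : ℂ) {f : ℝ → ℂ} (hf : ContDiff ℝ ∞ f) : ContDiff ℝ ∞ (symb s f) := by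
  rw [symb_eq_exp]
  have h1 : ContDiff ℝ ∞ fun x : ℝ => Real.log (1 + x ^ 2) :=
    ContDiff.log (by fun_prop) fun x => (one_add_sq_pos x).ne'
  have h2 : ContDiff ℝ ∞ fun x : ℝ => ((Real.log (1 + x ^ 2) : ℝ) : ℂ) :=
    Complex.ofRealCLM.contDiff.comp h1
  exact ((contDiff_const.mul h2).cexp).mul (hf.comp Real.contDiff_arctan)

/-- The derivative of a symbol is a sum of two symbols with parameter `s + 1/2`; all estimates on
higher derivatives follow from this by induction. -/
theorem deriv_symb (s : ℂ) {f : ℝ → ℂ} (hf : ContDiff ℝ ∞ f) :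
    deriv (symb s f) = fun x =>
      -2 * s * symb (s + 1 / 2) (fun t => (Real.sin t : ℂ) * f t) x +
        symb (s + 1 / 2) (fun t => (Real.cos t : ℂ) * deriv f t) x := by
  ext x
  have hpos := one_add_sq_pos x
  have h0 : HasDerivAt (fun x : ℝ => 1 + x ^ 2) (2 * x) x := by
    simpa using (hasDerivAt_pow 2 x).const_add 1
  have h1 := ((h0.log hpos.ne').ofReal_comp.const_mul (-s)).cexp
  have h2 : HasDerivAt (fun x => f (Real.arctan x))
      ((1 / (1 + x ^ 2)) • deriv f (Real.arctan x)) x :=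
    ((hf.differentiable (by simp)) _).hasDerivAt.scomp x (Real.hasDerivAt_arctan x)
  have h3 := h1.mul h2
  rw [symb_eq_exp]
  refine h3.deriv.trans ?_
  have hs0 : (0 : ℝ) < √(1 + x ^ 2) := Real.sqrt_pos.2 hpos
  -- the half step in `s` is the square root in `sin (arctan x)` and `cos (arctan x)`
  have h4 : ((1 + x ^ 2 : ℝ) : ℂ) ^ (-(s + 1 / 2)) =
      Complex.exp (-s * (Real.log (1 + x ^ 2) : ℝ)) * ((√(1 + x ^ 2) : ℝ) : ℂ)⁻¹ := by
    rw [ofReal_cpow_eq_exp hpos, neg_add, add_mul, Complex.exp_add]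
    congr 1
    rw [← Complex.ofReal_inv, ← Real.exp_log (inv_pos.2 hs0), Real.log_inv,
      Real.log_sqrt hpos.le]
    push_cast
    congr 1; ring
  simp only [symb, h4, Real.sin_arctan, Real.cos_arctan]
  have h5 : ((1 + x ^ 2 : ℝ) : ℂ) = ((√(1 + x ^ 2) : ℝ) : ℂ) ^ 2 := by
    rw [← Complex.ofReal_pow, Real.sq_sqrt hpos.le]
  have h6 : ((√(1 + x ^ 2) : ℝ) : ℂ) ≠ 0 := by exact_mod_cast hs0.ne'
  rw [Complex.real_smul]
  simp only [Complex.ofReal_div, Complex.ofReal_one, h5]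
  field_simp
  push_cast
  ring

theorem contDiff_sin_mul {f : ℝ → ℂ} (hf : ContDiff ℝ ∞ f) :
    ContDiff ℝ ∞ fun t => (Real.sin t : ℂ) * f t :=
  (Complex.ofRealCLM.contDiff.comp Real.contDiff_sin).mul hf

theorem contDiff_cos_mul_deriv {f : ℝ → ℂ} (hf : ContDiff ℝ ∞ f) :
    ContDiff ℝ ∞ fun t => (Real.cos t : ℂ) * deriv f t :=
  (Complex.ofRealCLM.contDiff.comp Real.contDiff_cos).mul
    (contDiff_infty_iff_deriv.1 hf).2

theorem iteratedDeriv_succ_symb (N : ℕ) (s : ℂ) {f : ℝ → ℂ} (hf : ContDiff ℝ ∞ f) (x : ℝ) :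
    iteratedDeriv (N + 1) (symb s f) x =
      -2 * s * iteratedDeriv N (symb (s + 1 / 2) (fun t => (Real.sin t : ℂ) * f t)) x +
        iteratedDeriv N (symb (s + 1 / 2) (fun t => (Real.cos t : ℂ) * deriv f t)) x := by
  have h1 := (contDiff_symb (s + 1 / 2) (contDiff_sin_mul hf)).of_le
    (m := (N : WithTop ℕ∞)) (by exact_mod_cast le_top)
  have h2 := (contDiff_symb (s + 1 / 2) (contDiff_cos_mul_deriv hf)).of_le
    (m := (N : WithTop ℕ∞)) (by exact_mod_cast le_top)
  rw [iteratedDeriv_succ', deriv_symb s hf]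
  rw [iteratedDeriv_fun_add (contDiff_const.mul h1).contDiffAt h2.contDiffAt,
    iteratedDeriv_const_mul_field]

theorem differentiable_iteratedDeriv_symb (N : ℕ) {f : ℝ → ℂ} (hf : ContDiff ℝ ∞ f) (x : ℝ) :
    Differentiable ℂ fun s => iteratedDeriv N (symb s f) x := by
  induction N generalizing f with
  | zero =>
    simp only [iteratedDeriv_zero, symb_eq_exp]
    fun_prop
  | succ N ih =>
    simp only [iteratedDeriv_succ_symb N _ hf]
    have h1 : Differentiable ℂ fun s : ℂ => s + 1 / 2 := by fun_prop
    exact ((differentiable_id.const_mul (-2)).mul ((ih (contDiff_sin_mul hf)).comp h1)).add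
      ((ih (contDiff_cos_mul_deriv hf)).comp h1)

/-- Symbol estimates, uniform for `s` in a bounded set. -/
theorem norm_iteratedDeriv_symb_le (N : ℕ) {f : ℝ → ℂ} (hf : ContDiff ℝ ∞ f) (R : ℝ) :
    ∃ C, 0 ≤ C ∧ ∀ s : ℂ, ‖s‖ ≤ R → ∀ x,
      ‖iteratedDeriv N (symb s f) x‖ ≤ C * (1 + x ^ 2) ^ (-s.re - N / 2) := by
  induction N generalizing f R with
  | zero =>
    obtain ⟨C, hC⟩ := (isCompact_Icc (a := -(Real.pi / 2))
      (b := Real.pi / 2)).exists_bound_of_continuousOn hf.continuous.continuousOn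
    have hC0 : 0 ≤ C := (norm_nonneg _).trans
      (hC 0 ⟨by linarith [Real.pi_pos], by linarith [Real.pi_pos]⟩)
    refine ⟨C, hC0, fun s _ x => ?_⟩
    rw [iteratedDeriv_zero, symb, norm_mul,
      Complex.norm_cpow_eq_rpow_re_of_pos (one_add_sq_pos x), mul_comm]
    simp only [Complex.neg_re, Nat.cast_zero, zero_div, sub_zero]
    gcongr
    exact hC _ ⟨(Real.neg_pi_div_two_lt_arctan x).le, (Real.arctan_lt_pi_div_two x).le⟩
  | succ N ih =>
    obtain ⟨C₁, h₁, hC₁⟩ := ih (contDiff_sin_mul hf) (R + 1 / 2)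
    obtain ⟨C₂, h₂, hC₂⟩ := ih (contDiff_cos_mul_deriv hf) (R + 1 / 2)
    refine ⟨2 * |R| * C₁ + C₂, by positivity, fun s hs x => ?_⟩
    have hs' : ‖s + 1 / 2‖ ≤ R + 1 / 2 := by
      refine (norm_add_le _ _).trans (add_le_add hs ?_)
      norm_num
    have e1 : -(s + 1 / 2).re - (N : ℝ) / 2 = -s.re - ((N + 1 : ℕ) : ℝ) / 2 := by
      simp; ring
    have a1 := hC₁ _ hs' x
    have a2 := hC₂ _ hs' x
    rw [e1] at a1 a2
    rw [iteratedDeriv_succ_symb N _ hf]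
    refine (norm_add_le _ _).trans ?_
    rw [norm_mul, norm_mul, add_mul]
    refine add_le_add ?_ a2
    have e2 : ‖(-2 : ℂ)‖ = 2 := by norm_num
    rw [e2, mul_assoc (2 * |R|)]
    have := hs.trans (le_abs_self R)
    gcongr

theorem integrable_one_add_sq_rpow {σ : ℝ} (hσ : 1 / 2 < σ) :
    Integrable fun x : ℝ => (1 + x ^ 2) ^ (-σ) := by
  have h := integrable_rpow_neg_one_add_norm_sq (E := ℝ) (μ := volume) (r := 2 * σ)
    (by simp; linarith)
  refine h.congr (Eventually.of_forall fun x => ?_)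
  simp only [Real.norm_eq_abs, sq_abs]
  congr 1; ring

theorem continuous_iteratedDeriv_symb (N : ℕ) (s : ℂ) {f : ℝ → ℂ} (hf : ContDiff ℝ ∞ f) :
    Continuous (iteratedDeriv N (symb s f)) :=
  (contDiff_symb s hf).continuous_iteratedDeriv N (by exact_mod_cast le_top)

theorem integrable_iteratedDeriv_symb (N : ℕ) {s : ℂ} {f : ℝ → ℂ} (hf : ContDiff ℝ ∞ f)
    (hs : 1 / 2 < s.re + N / 2) : Integrable (iteratedDeriv N (symb s f)) := by
  obtain ⟨C, -, hC⟩ := norm_iteratedDeriv_symb_le N hf ‖s‖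
  refine ((integrable_one_add_sq_rpow hs).const_mul C).mono'
    (continuous_iteratedDeriv_symb N s hf).aestronglyMeasurable (Eventually.of_forall fun x => ?_)
  have := hC s le_rfl x
  rwa [show -s.re - (N : ℝ) / 2 = -(s.re + N / 2) by ring] at this

theorem norm_e (x : ℝ) : ‖e x‖ = 1 := by
  rw [e, show 2 * (Real.pi : ℂ) * Complex.I * x = ((2 * Real.pi * x : ℝ) : ℂ) * Complex.I by
    push_cast; ring]
  exact Complex.norm_exp_ofReal_mul_I _

theorem e_add (x y : ℝ) : e (x + y) = e x * e y := by
  simp only [e, ← Complex.exp_add]; congr 1; push_cast; ring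

theorem e_zero : e 0 = 1 := by simp [e]

theorem continuous_e : Continuous e := by unfold e; fun_prop

theorem hasDerivAt_e_mul (v x : ℝ) :
    HasDerivAt (fun x => e (-(v * x))) (-(2 * Real.pi * Complex.I * v) * e (-(v * x))) x := by
  have h : HasDerivAt (fun x : ℝ => (2 * Real.pi * Complex.I * ((-(v * x) : ℝ) : ℂ)))
      (2 * Real.pi * Complex.I * ((-(v * 1) : ℝ) : ℂ)) x :=
    (((hasDerivAt_id x).const_mul v).neg.ofReal_comp).const_mul _
  unfold e
  convert! h.cexp using 1
  push_cast; ring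

/-- The Fourier transform of `A` at `v`, computed after `N` integrations by parts:
`(2πiv) ^ (-N) ∫ e(-vx) A⁽ᴺ⁾(x) dx`. For a symbol it is independent of `N` once the integral
converges, see `regFourier_eq`. -/
def regFourier (N : ℕ) (v : ℝ) (A : ℝ → ℂ) : ℂ :=
  (2 * Real.pi * Complex.I * v)⁻¹ ^ N * ∫ x, e (-(v * x)) * iteratedDeriv N A x

theorem two_pi_I_mul_ne_zero {v : ℝ} (hv : v ≠ 0) : (2 * Real.pi * Complex.I * v : ℂ) ≠ 0 := by
  simp [Real.pi_ne_zero, hv]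

theorem integrable_e_mul {A : ℝ → ℂ} (hA : Integrable A) (v : ℝ) :
    Integrable fun x => e (-(v * x)) * A x := by
  refine hA.bdd_mul (c := 1) ?_ (Eventually.of_forall fun x => (norm_e _).le)
  exact (continuous_e.comp (by fun_prop)).aestronglyMeasurable

/-- Integration by parts for the Fourier integral of a symbol. -/
theorem regFourier_succ (N : ℕ) {v : ℝ} (hv : v ≠ 0) {s : ℂ} {f : ℝ → ℂ} (hf : ContDiff ℝ ∞ f)
    (hs : 1 / 2 < s.re + N / 2) :
    regFourier (N + 1) v (symb s f) = regFourier N v (symb s f) := by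
  have hI := integrable_iteratedDeriv_symb N hf hs
  have hI' := integrable_iteratedDeriv_symb (N + 1) hf
    (s := s) (by push_cast; linarith)
  have hd : ∀ x, HasDerivAt (iteratedDeriv N (symb s f)) (iteratedDeriv (N + 1) (symb s f) x) x := by
    intro x
    rw [iteratedDeriv_succ]
    exact ((contDiff_symb s hf).differentiable_iteratedDeriv N
      (by exact_mod_cast ENat.natCast_lt_top N) x).hasDerivAt
  have key := integral_mul_deriv_eq_deriv_mul_of_integrable
    (fun x _ => hasDerivAt_e_mul v x) (fun x _ => hd x)
    (integrable_e_mul hI' v) (by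
      refine ((integrable_e_mul hI v).const_mul (-(2 * Real.pi * Complex.I * v))).congr
        (Eventually.of_forall fun x => ?_)
      simp only [Pi.mul_apply]; ring) (integrable_e_mul hI v)
  have h2 : ∫ x, e (-(v * x)) * iteratedDeriv (N + 1) (symb s f) x =
      (2 * Real.pi * Complex.I * v) * ∫ x, e (-(v * x)) * iteratedDeriv N (symb s f) x := by
    rw [key, ← integral_const_mul, ← integral_neg]
    congr 1; ext x; ring
  rw [regFourier, regFourier, h2, pow_succ, mul_assoc, inv_mul_cancel_left₀
    (two_pi_I_mul_ne_zero hv)]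

theorem regFourier_eq {N M : ℕ} {v : ℝ} (hv : v ≠ 0) {s : ℂ} {f : ℝ → ℂ} (hf : ContDiff ℝ ∞ f)
    (hN : 1 / 2 < s.re + N / 2) (hM : 1 / 2 < s.re + M / 2) :
    regFourier N v (symb s f) = regFourier M v (symb s f) := by
  wlog h : N ≤ M generalizing N M
  · exact (this hM hN (by omega)).symm
  induction M, h using Nat.le_induction with
  | base => rfl
  | succ M h ih =>
    have hM' : 1 / 2 < s.re + M / 2 := by
      have : (N : ℝ) ≤ M := by exact_mod_cast h
      linarith
    rw [ih hM', regFourier_succ M hv hf hM']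

theorem differentiableAt_regFourier (N : ℕ) (v : ℝ) {s : ℂ} {f : ℝ → ℂ} (hf : ContDiff ℝ ∞ f)
    (hs : 1 / 2 < s.re + N / 2) :
    DifferentiableAt ℂ (fun s => regFourier N v (symb s f)) s := by
  set r := (s.re + N / 2 - 1 / 2) / 2 with hr
  have hr0 : 0 < r := by rw [hr]; linarith
  obtain ⟨C, hC0, hC⟩ := norm_iteratedDeriv_symb_le N hf (‖s‖ + r)
  refine DifferentiableAt.const_mul (differentiableAt_integral_of_bound
    (bound := fun x => C * (1 + x ^ 2) ^ (-(1 / 2 + r))) hr0 ?_ ?_ ?_ ?_) _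
  · intro z hz
    exact ((continuous_e.comp (by fun_prop : Continuous fun x => -(v * x))).mul
      (continuous_iteratedDeriv_symb N z hf)).aestronglyMeasurable
  · refine Eventually.of_forall fun x => ?_
    exact ((differentiable_iteratedDeriv_symb N hf x).const_mul _).differentiableOn
  · refine Eventually.of_forall fun x z hz => ?_
    rw [norm_mul, norm_e, one_mul]
    rw [Metric.mem_ball, dist_eq_norm] at hz
    have h1 : ‖z‖ ≤ ‖s‖ + r := by
      have := norm_le_norm_add_norm_sub' z s
      linarith
    refine (hC z h1 x).trans ?_
    gcongr 1
    refine Real.rpow_le_rpow_of_exponent_le (by nlinarith [sq_nonneg x]) ?_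
    have h2 := (Complex.abs_re_le_norm (z - s))
    rw [Complex.sub_re] at h2
    have h3 := (abs_lt.1 (h2.trans_lt hz)).1
    linarith
  · exact (integrable_one_add_sq_rpow (by linarith)).const_mul C

/-! ### Bounds for regularized Fourier transforms, and Fourier inversion -/

theorem norm_two_pi_I_mul (v : ℝ) : ‖(2 * Real.pi * Complex.I * v : ℂ)‖ = 2 * Real.pi * |v| := by
  simp [abs_of_pos Real.pi_pos]

theorem norm_inv_two_pi_I_mul_le (v : ℝ) : ‖(2 * Real.pi * Complex.I * v : ℂ)⁻¹‖ ≤ |v|⁻¹ := by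
  rw [norm_inv, norm_two_pi_I_mul, mul_inv]
  refine mul_le_of_le_one_left (by positivity) (inv_le_one_of_one_le₀ ?_)
  linarith [Real.pi_gt_three]

theorem norm_regFourier_le (N : ℕ) {f : ℝ → ℂ} (hf : ContDiff ℝ ∞ f) (R : ℝ) {σ : ℝ}
    (hσ : 1 / 2 < σ + N / 2) :
    ∃ C, 0 ≤ C ∧ ∀ s : ℂ, ‖s‖ ≤ R → σ ≤ s.re → ∀ v : ℝ,
      ‖regFourier N v (symb s f)‖ ≤ C * |v|⁻¹ ^ N := by
  obtain ⟨C, hC0, hC⟩ := norm_iteratedDeriv_symb_le N hf R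
  refine ⟨∫ x : ℝ, C * (1 + x ^ 2) ^ (-(σ + N / 2)), integral_nonneg fun x => by positivity,
    fun s hs hsσ v => ?_⟩
  rw [regFourier, norm_mul, norm_pow, mul_comm]
  refine mul_le_mul ?_ (pow_le_pow_left₀ (norm_nonneg _) (norm_inv_two_pi_I_mul_le v) N)
    (by positivity) (integral_nonneg fun x => by positivity)
  refine norm_integral_le_of_norm_le ((integrable_one_add_sq_rpow hσ).const_mul C)
    (Eventually.of_forall fun x => ?_)
  rw [norm_mul, norm_e, one_mul]
  refine (hC s hs x).trans ?_
  gcongr 1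
  exact Real.rpow_le_rpow_of_exponent_le (by nlinarith [sq_nonneg x]) (by linarith)

/-- An interpolation between the bounds `2π|x|` and `2`. -/
theorem norm_e_sub_one_le {κ : ℝ} (h0 : 0 ≤ κ) (h1 : κ ≤ 1) (x : ℝ) :
    ‖e x - 1‖ ≤ 2 * Real.pi * |x| ^ κ := by
  have hpi := Real.pi_gt_three
  rcases le_total |x| 1 with hx | hx
  · have h : ‖e x - 1‖ ≤ 2 * Real.pi * |x| := by
      have h2 := Real.norm_exp_I_mul_ofReal_sub_one_le (x := 2 * Real.pi * x)
      rw [e, show 2 * (Real.pi : ℂ) * Complex.I * x = Complex.I * ((2 * Real.pi * x : ℝ) : ℂ) by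
        push_cast; ring]
      refine h2.trans (le_of_eq ?_)
      rw [Real.norm_eq_abs, abs_mul, abs_of_pos (by positivity : 0 < 2 * Real.pi)]
    refine h.trans ?_
    gcongr
    calc |x| = |x| ^ (1 : ℝ) := (Real.rpow_one _).symm
      _ ≤ |x| ^ κ := Real.rpow_le_rpow_of_exponent_ge_of_imp (abs_nonneg _) hx h1 (by
          intro _ h; linarith)
  · have h : ‖e x - 1‖ ≤ 2 := by
      refine (norm_sub_le _ _).trans ?_
      rw [norm_e, norm_one]; norm_num
    have := Real.one_le_rpow hx h0
    nlinarith

theorem integral_deriv_symb_eq_zero {s : ℂ} (hs : 0 < s.re) {f : ℝ → ℂ} (hf : ContDiff ℝ ∞ f) :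
    ∫ x, iteratedDeriv 1 (symb s f) x = 0 := by
  obtain ⟨C, hC0, hC⟩ := norm_iteratedDeriv_symb_le 0 hf ‖s‖
  have hlim : ∀ l : Filter ℝ, Tendsto (fun x : ℝ => x ^ 2) l atTop →
      Tendsto (symb s f) l (𝓝 0) := by
    intro l hl
    have h1 : Tendsto (fun x : ℝ => C * (1 + x ^ 2) ^ (-s.re)) l (𝓝 (C * 0)) :=
      ((tendsto_rpow_neg_atTop hs).comp (tendsto_atTop_add_const_left _ 1 hl)).const_mul C
    rw [mul_zero] at h1
    refine squeeze_zero_norm (fun x => ?_) h1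
    simpa using hC s le_rfl x
  have hd : ∀ x, HasDerivAt (symb s f) (iteratedDeriv 1 (symb s f) x) x := fun x => by
    rw [iteratedDeriv_one]
    exact ((contDiff_symb s hf).differentiable (by simp) x).hasDerivAt
  rw [integral_of_hasDerivAt_of_tendsto hd
    (integrable_iteratedDeriv_symb 1 hf (by push_cast; linarith))
    (hlim atBot ?_) (hlim atTop (tendsto_pow_atTop two_ne_zero)), sub_zero]
  have := (tendsto_pow_atTop (α := ℝ) two_ne_zero).comp tendsto_neg_atBot_atTop
  exact this.congr fun x => by simp

/-- Control of the regularized Fourier transform near `0`. Since a derivative integrates to zero,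
`e(-vx)` may be replaced by `e(-vx) - 1`, which saves a factor `|v| ^ κ` over the trivial bound. -/
theorem norm_regFourier_one_le {f : ℝ → ℂ} (hf : ContDiff ℝ ∞ f) (R : ℝ) {σ κ : ℝ} (hσ : 0 < σ)
    (h0 : 0 ≤ κ) (h1 : κ ≤ 1) (hκ : κ < 2 * σ) :
    ∃ C, 0 ≤ C ∧ ∀ s : ℂ, ‖s‖ ≤ R → σ ≤ s.re → ∀ v : ℝ, v ≠ 0 →
      ‖regFourier 1 v (symb s f)‖ ≤ C * |v| ^ (κ - 1) := by
  obtain ⟨C, hC0, hC⟩ := norm_iteratedDeriv_symb_le 1 hf R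
  set I := ∫ x : ℝ, 2 * Real.pi * C * (1 + x ^ 2) ^ (-(σ + 1 / 2 - κ / 2)) with hI
  have hI0 : 0 ≤ I := integral_nonneg fun x => by have := Real.pi_pos; positivity
  refine ⟨I, hI0, fun s hs hsσ v hv => ?_⟩
  have hint := integrable_iteratedDeriv_symb 1 (s := s) hf (by push_cast; linarith)
  have hv' : 0 < |v| := abs_pos.2 hv
  have key : ∫ x, e (-(v * x)) * iteratedDeriv 1 (symb s f) x =
      ∫ x, (e (-(v * x)) - 1) * iteratedDeriv 1 (symb s f) x := by
    simp only [sub_mul, one_mul]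
    rw [integral_sub (integrable_e_mul hint v) hint,
      integral_deriv_symb_eq_zero (by linarith) hf, sub_zero]
  rw [regFourier, pow_one, key, norm_mul, Real.rpow_sub hv', Real.rpow_one, div_eq_inv_mul,
    mul_left_comm]
  refine mul_le_mul (norm_inv_two_pi_I_mul_le v) ?_ (norm_nonneg _) (by positivity)
  rw [hI, ← integral_mul_const]
  refine norm_integral_le_of_norm_le (((integrable_one_add_sq_rpow
    (by linarith)).const_mul _).mul_const _) (Eventually.of_forall fun x => ?_)
  rw [norm_mul]
  have h3 := hC s hs x
  have h4 := norm_e_sub_one_le h0 h1 (-(v * x))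
  rw [abs_neg, abs_mul, Real.mul_rpow (abs_nonneg _) (abs_nonneg _)] at h4
  have hp := one_add_sq_pos x
  have h5 : |x| ^ κ ≤ (1 + x ^ 2) ^ (κ / 2) := by
    have : |x| ^ κ = (x ^ 2) ^ (κ / 2) := by
      rw [← sq_abs, ← Real.rpow_natCast, ← Real.rpow_mul (abs_nonneg _)]
      congr 1; push_cast; ring
    rw [this]
    exact Real.rpow_le_rpow (sq_nonneg _) (by linarith) (by linarith)
  have h6 : (1 + x ^ 2) ^ (-s.re - (1 : ℕ) / 2) ≤ (1 + x ^ 2) ^ (-(σ + 1 / 2)) :=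
    Real.rpow_le_rpow_of_exponent_le (by nlinarith [sq_nonneg x]) (by push_cast; linarith)
  have hpi := Real.pi_pos
  calc ‖e (-(v * x)) - 1‖ * ‖iteratedDeriv 1 (symb s f) x‖
      ≤ (2 * Real.pi * (|v| ^ κ * (1 + x ^ 2) ^ (κ / 2))) * (C * (1 + x ^ 2) ^ (-(σ + 1 / 2))) := by
        refine mul_le_mul (h4.trans ?_) (h3.trans ?_) (norm_nonneg _) (by positivity) <;> gcongr
    _ = _ := by
        rw [show -(σ + 1 / 2 - κ / 2) = κ / 2 + -(σ + 1 / 2) by ring, Real.rpow_add hp]; ring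

theorem continuous_integral_e_mul {B : ℝ → ℂ} (hB : Integrable B) :
    Continuous fun v : ℝ => ∫ x, e (-(v * x)) * B x := by
  refine continuous_of_dominated (bound := fun x => ‖B x‖)
    (fun v => (integrable_e_mul hB v).aestronglyMeasurable)
    (fun v => Eventually.of_forall fun x => by rw [norm_mul, norm_e, one_mul]) hB.norm
    (Eventually.of_forall fun x => ?_)
  exact (continuous_e.comp (by fun_prop)).mul continuous_const

theorem measurable_regFourier (N : ℕ) {s : ℂ} {f : ℝ → ℂ} (hf : ContDiff ℝ ∞ f)
    (hs : 1 / 2 < s.re + N / 2) : Measurable fun v => regFourier N v (symb s f) := by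
  refine Measurable.mul ?_
    (continuous_integral_e_mul (integrable_iteratedDeriv_symb N hf hs)).measurable
  exact ((Complex.continuous_ofReal.measurable.const_mul _).inv).pow_const N

/-- Fourier inversion in the normalization by `e`. -/
theorem fourier_inversion {A : ℝ → ℂ} (hA : Integrable A) (hc : Continuous A)
    (hA' : Integrable fun v : ℝ => ∫ x, e (-(v * x)) * A x) (x : ℝ) :
    ∫ v : ℝ, e (v * x) * (∫ y, e (-(v * y)) * A y) = A x := by
  have hF : FourierTransform.fourier A = fun v : ℝ => ∫ x, e (-(v * x)) * A x := by
    ext v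
    rw [Real.fourier_real_eq_integral_exp_smul]
    congr 1; ext y
    rw [smul_eq_mul, e]
    congr 2; push_cast; ring
  have h := hA.fourierInv_fourier_eq (by rw [hF]; exact hA') hc.continuousAt (v := x)
  rw [hF, Real.fourierInv_eq'] at h
  rw [← h]
  congr 1; ext v
  rw [smul_eq_mul, e]
  congr 2
  simp; ring

/-! ### Smooth vectors as homogeneous functions of the bottom row -/

/-- The bottom row `(c, d)` of a matrix, encoded as the complex number `d - ic`. -/
def bottom (g : Matrix.SpecialLinearGroup (Fin 2) ℝ) : ℂ :=
  ((g 1 1 : ℝ) : ℂ) - Complex.I * ((g 1 0 : ℝ) : ℂ)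

/-- `Ψ` lifts the function `φ` on `PSL(2, ℝ)` to `ℂ ∖ {0}`: it is smooth in the real sense, it
reproduces `φ` on bottom rows, and it is even and homogeneous of degree `-(2ν + 1)` under real
scalars. The value `Ψ 0` is irrelevant. -/
structure IsLift (ν : ℂ) (φ : G → ℂ) (Ψ : ℂ → ℂ) : Prop where
  smooth : ∀ z, z ≠ 0 → ContDiffAt ℝ ∞ Ψ z
  eq_lift : ∀ g, φ (ofSL g) = Ψ (bottom g)
  homogeneous : ∀ r : ℝ, r ≠ 0 → ∀ z, z ≠ 0 →
    Ψ (r * z) = ((|r| : ℝ) : ℂ) ^ (-(2 * ν + 1)) * Ψ z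

theorem sub_I_mul_eq_zero {c d : ℝ} (h : (d : ℂ) - Complex.I * c = 0) : c = 0 ∧ d = 0 := by
  have h1 := congrArg Complex.re h
  have h2 := congrArg Complex.im h
  simp at h1 h2
  exact ⟨h2, h1⟩

theorem normSq_sub_I_mul (c d : ℝ) : ‖(d : ℂ) - Complex.I * c‖ ^ 2 = c ^ 2 + d ^ 2 := by
  rw [← Complex.normSq_eq_norm_sq, Complex.normSq_apply]
  simp; ring

theorem det_eq (g : Matrix.SpecialLinearGroup (Fin 2) ℝ) :
    g 0 0 * g 1 1 - g 0 1 * g 1 0 = 1 := by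
  rw [← Matrix.det_fin_two]; exact g.2

theorem bottom_ne_zero (g : Matrix.SpecialLinearGroup (Fin 2) ℝ) : bottom g ≠ 0 := by
  intro h
  obtain ⟨h1, h2⟩ := sub_I_mul_eq_zero h
  have := det_eq g
  rw [h1, h2] at this
  simp at this

theorem height_ofSL (g : Matrix.SpecialLinearGroup (Fin 2) ℝ) :
    height (ofSL g) = (‖bottom g‖ ^ 2)⁻¹ := by
  rw [bottom, normSq_sub_I_mul]; rfl

theorem angle_ofSL (g : Matrix.SpecialLinearGroup (Fin 2) ℝ) :
    angle (ofSL g) = (bottom g / (‖bottom g‖ : ℝ)) ^ 2 := rfl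

theorem iteratedDeriv_cexp_mul (k : ℕ) (c b : ℂ) :
    iteratedDeriv k (fun t : ℝ => c * Complex.exp (b * t)) =
      fun t : ℝ => c * b ^ k * Complex.exp (b * t) := by
  induction k with
  | zero => simp
  | succ k ih =>
    rw [iteratedDeriv_succ, ih]
    ext t
    have h : HasDerivAt (fun t : ℝ => b * (t : ℂ)) (b * ((1 : ℝ) : ℂ)) t :=
      ((hasDerivAt_id t).ofReal_comp).const_mul b
    rw [(h.cexp.const_mul (c * b ^ k)).deriv]
    push_cast; ring

/-- A Fourier series with rapidly decaying coefficients is smooth. -/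
theorem contDiff_fourier_series {c : ℤ → ℂ}
    (hc : ∀ k : ℕ, ∃ C : ℝ, ∀ p : ℤ, |(p : ℝ)| ^ k * ‖c p‖ ≤ C) :
    ContDiff ℝ ∞ fun t : ℝ => ∑' p : ℤ, c p * Complex.exp (2 * Complex.I * p * t) := by
  refine contDiff_tsum (v := fun k (p : ℤ) => 2 ^ k * (|(p : ℝ)| ^ k * ‖c p‖)) (fun p => ?_)
    (fun k _ => ?_) (fun k p t _ => ?_)
  · exact contDiff_const.mul (contDiff_const.mul Complex.ofRealCLM.contDiff).cexp
  · obtain ⟨C, hC⟩ := hc (k + 2)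
    refine Summable.mul_left _ ?_
    refine Summable.of_norm_bounded_eventually
      ((Real.summable_one_div_int_pow (p := 2)).2 (by norm_num) |>.mul_left C) ?_
    filter_upwards [(Set.finite_singleton (0 : ℤ)).compl_mem_cofinite] with p hp
    have hp0 : (0 : ℝ) < (p : ℝ) ^ 2 := by
      have : (p : ℝ) ≠ 0 := by exact_mod_cast hp
      positivity
    rw [Real.norm_of_nonneg (by positivity), mul_one_div, le_div_iff₀ hp0]
    refine le_trans (le_of_eq ?_) (hC p)
    rw [pow_add, sq_abs]; ring
  · rw [norm_iteratedFDeriv_eq_norm_iteratedDeriv, iteratedDeriv_cexp_mul, norm_mul, norm_mul,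
      norm_pow]
    have h1 : ‖Complex.exp (2 * Complex.I * p * t)‖ = 1 := by
      rw [show 2 * Complex.I * p * t = ((2 * p * t : ℝ) : ℂ) * Complex.I by push_cast; ring]
      exact Complex.norm_exp_ofReal_mul_I _
    have h2 : ‖(2 * Complex.I * p : ℂ)‖ = 2 * |(p : ℝ)| := by simp
    rw [h1, h2, mul_pow]
    exact le_of_eq (by ring)

/-- The lift is `|z| ^ (-(2ν + 1)) ∑ c_p (z / |z|) ^ (2p)`. It is smooth near the positive real axis
by using the principal logarithm, and elsewhere because it is even. -/
theorem IsSmoothVector.exists_isLift {ν : ℂ} {φ : G → ℂ} (h : IsSmoothVector ν φ) :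
    ∃ Ψ, IsLift ν φ Ψ := by
  obtain ⟨c, hc, hs⟩ := h
  set Ψ : ℂ → ℂ := fun z => (((‖z‖ ^ 2)⁻¹ : ℝ) : ℂ) ^ (ν + 1 / 2) *
    ∑' p : ℤ, c p * ((z / (‖z‖ : ℝ)) ^ 2) ^ p with hΨ
  have hhom : ∀ r : ℝ, r ≠ 0 → ∀ z, z ≠ 0 →
      Ψ (r * z) = ((|r| : ℝ) : ℂ) ^ (-(2 * ν + 1)) * Ψ z := by
    intro r hr z hz
    have hr' : 0 < |r| := abs_pos.2 hr
    have hz' : 0 < ‖z‖ := norm_pos_iff.2 hz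
    have h1 : ‖(r : ℂ) * z‖ = |r| * ‖z‖ := by simp
    have h2 : ((r * z) / ((|r| * ‖z‖ : ℝ) : ℂ)) ^ 2 = (z / (‖z‖ : ℝ)) ^ 2 := by
      have h3 : ((|r| : ℝ) : ℂ) ^ 2 = (r : ℂ) ^ 2 := by
        rw [← Complex.ofReal_pow, sq_abs, Complex.ofReal_pow]
      have h4 : (r : ℂ) ≠ 0 := by exact_mod_cast hr
      have h5 : ((‖z‖ : ℝ) : ℂ) ≠ 0 := by exact_mod_cast hz'.ne'
      rw [div_pow, div_pow, mul_pow, Complex.ofReal_mul, mul_pow, h3]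
      field_simp
    simp only [hΨ, h1, h2]
    rw [← mul_assoc]
    congr 1
    rw [mul_pow, mul_inv, Complex.ofReal_mul,
      Complex.mul_cpow_ofReal_nonneg (by positivity) (by positivity)]
    congr 1
    rw [ofReal_cpow_eq_exp (by positivity), ofReal_cpow_eq_exp hr', Real.log_inv, Real.log_pow]
    push_cast
    congr 1; ring
  refine ⟨Ψ, ?_, ?_, hhom⟩
  · have main : ∀ z ∈ Complex.slitPlane, ContDiffAt ℝ ∞ Ψ z := by
      intro z hz
      have hz0 := Complex.slitPlane_ne_zero hz
      have hS := contDiff_fourier_series hc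
      set S : ℝ → ℂ := fun t : ℝ => ∑' p : ℤ, c p * Complex.exp (2 * Complex.I * p * t)
      have hlog : ContDiffAt ℝ ∞ Complex.log z := (Complex.contDiffAt_log hz).restrict_scalars ℝ
      have him : ContDiffAt ℝ ∞ (fun z => (Complex.log z).im) z :=
        Complex.imCLM.contDiff.contDiffAt.comp z hlog
      have hre : ContDiffAt ℝ ∞ (fun z => ((Complex.log z).re : ℂ)) z :=
        (Complex.ofRealCLM.contDiff.comp Complex.reCLM.contDiff).contDiffAt.comp z hlog
      have h1 : ContDiffAt ℝ ∞ (fun z => Complex.exp (-(2 * ν + 1) * ((Complex.log z).re : ℂ)) *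
          S (Complex.log z).im) z :=
        ((contDiffAt_const.mul hre).cexp).mul (hS.contDiffAt.comp z him)
      refine h1.congr_of_eventuallyEq ?_
      filter_upwards [isOpen_compl_singleton.mem_nhds hz0] with w hw
      have hw0 : w ≠ 0 := hw
      have hw' : 0 < ‖w‖ := norm_pos_iff.2 hw0
      have h2 : w / (‖w‖ : ℝ) = Complex.exp (w.arg * Complex.I) := by
        have h5 : ((‖w‖ : ℝ) : ℂ) ≠ 0 := by exact_mod_cast hw'.ne'
        rw [div_eq_iff h5, mul_comm]
        exact (Complex.norm_mul_exp_arg_mul_I w).symm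
      simp only [hΨ, h2]
      congr 1
      · rw [ofReal_cpow_eq_exp (by positivity), Complex.log_re, Real.log_inv, Real.log_pow]
        push_cast
        congr 1; ring
      · refine tsum_congr fun p => ?_
        rw [Complex.log_im, ← Complex.exp_nat_mul, ← Complex.exp_int_mul]
        congr 2; push_cast; ring
    intro z hz
    rcases Complex.mem_slitPlane_or_neg_mem_slitPlane hz with h | h
    · exact main z h
    · have h1 : ContDiffAt ℝ ∞ (fun z => Ψ (-z)) z :=
        (main (-z) h).comp z contDiff_neg.contDiffAt
      refine h1.congr_of_eventuallyEq ?_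
      filter_upwards [isOpen_compl_singleton.mem_nhds hz] with w hw
      have := hhom (-1) (by norm_num) w hw
      simpa using this.symm
  · intro g
    rw [← (hs (ofSL g)).tsum_eq]
    simp only [hΨ, phi, height_ofSL, angle_ofSL]
    rw [← tsum_mul_left]
    refine tsum_congr fun p => ?_
    ring

/-- The right action of `SL(2, ℝ)` on bottom rows, in the encoding `(c, d) ↦ d - ic` of `bottom`. -/
def rowAct (h : Matrix.SpecialLinearGroup (Fin 2) ℝ) (z : ℂ) : ℂ :=
  ((-z.im * h 0 1 + z.re * h 1 1 : ℝ) : ℂ) - Complex.I * ((-z.im * h 0 0 + z.re * h 1 0 : ℝ) : ℂ)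

theorem bottom_mul (g h : Matrix.SpecialLinearGroup (Fin 2) ℝ) :
    bottom (g * h) = rowAct h (bottom g) := by
  simp [bottom, rowAct, Matrix.mul_apply, Fin.sum_univ_two]

theorem rowAct_ne_zero (h : Matrix.SpecialLinearGroup (Fin 2) ℝ) {z : ℂ} (hz : z ≠ 0) :
    rowAct h z ≠ 0 := by
  intro h0
  obtain ⟨h1, h2⟩ := sub_I_mul_eq_zero h0
  have hd := det_eq h
  apply hz
  apply Complex.ext
  · simp only [Complex.zero_re]
    linear_combination (-z.re) * hd + h 0 0 * h2 - h 0 1 * h1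
  · simp only [Complex.zero_im]
    linear_combination (-z.im) * hd - h 1 1 * h1 + h 1 0 * h2

theorem rowAct_real_mul (h : Matrix.SpecialLinearGroup (Fin 2) ℝ) (r : ℝ) (z : ℂ) :
    rowAct h (r * z) = r * rowAct h z := by
  simp [rowAct]; ring

theorem contDiff_rowAct (h : Matrix.SpecialLinearGroup (Fin 2) ℝ) :
    ContDiff ℝ ∞ (rowAct h) := by
  have him : ContDiff ℝ ∞ Complex.im := Complex.imCLM.contDiff
  have hre : ContDiff ℝ ∞ Complex.re := Complex.reCLM.contDiff
  have hof : ContDiff ℝ ∞ ((↑) : ℝ → ℂ) := Complex.ofRealCLM.contDiff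
  unfold rowAct
  exact (hof.comp ((him.neg.mul contDiff_const).add (hre.mul contDiff_const))).sub
    (contDiff_const.mul (hof.comp ((him.neg.mul contDiff_const).add (hre.mul contDiff_const))))

theorem IsLift.translate {ν : ℂ} {φ : G → ℂ} {Ψ : ℂ → ℂ} (hΨ : IsLift ν φ Ψ)
    (h : Matrix.SpecialLinearGroup (Fin 2) ℝ) :
    IsLift ν (rightTranslation (ofSL h) φ) (fun z => Ψ (rowAct h z)) where
  smooth z hz := (hΨ.smooth _ (rowAct_ne_zero h hz)).comp z (contDiff_rowAct h).contDiffAt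
  eq_lift g := by
    rw [← bottom_mul, ← hΨ.eq_lift]; rfl
  homogeneous r hr z hz := by
    rw [rowAct_real_mul, hΨ.homogeneous r hr _ (rowAct_ne_zero h hz)]

/-- The restriction of `Ψ` to the circle through `κ`, parametrized so that `t = arctan x`
corresponds to the ray through `κ (x - i)`. -/
def profile (Ψ : ℂ → ℂ) (κ : ℂ) (t : ℝ) : ℂ :=
  Ψ (κ * Complex.exp (Complex.I * ((t - Real.pi / 2 : ℝ) : ℂ)))

theorem IsLift.contDiff_profile {ν : ℂ} {φ : G → ℂ} {Ψ : ℂ → ℂ} (hΨ : IsLift ν φ Ψ) {κ : ℂ}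
    (hκ : κ ≠ 0) : ContDiff ℝ ∞ (profile Ψ κ) := by
  rw [contDiff_iff_contDiffAt]
  intro t
  refine (hΨ.smooth _ (mul_ne_zero hκ (Complex.exp_ne_zero _))).comp t ?_
  exact (contDiff_const.mul (contDiff_const.mul
    (Complex.ofRealCLM.contDiff.comp (contDiff_id.sub contDiff_const))).cexp).contDiffAt

/-- Polar coordinates on the line `Im z = -1`. -/
theorem sub_I_eq (x : ℝ) : (x : ℂ) - Complex.I = (√(1 + x ^ 2) : ℝ) *
    Complex.exp (Complex.I * ((Real.arctan x - Real.pi / 2 : ℝ) : ℂ)) := by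
  have hs0 : (0 : ℝ) < √(1 + x ^ 2) := Real.sqrt_pos.2 (one_add_sq_pos x)
  have h6 : ((√(1 + x ^ 2) : ℝ) : ℂ) ≠ 0 := by exact_mod_cast hs0.ne'
  rw [mul_comm Complex.I, Complex.exp_mul_I, ← Complex.ofReal_cos, ← Complex.ofReal_sin,
    Real.cos_sub_pi_div_two, Real.sin_sub_pi_div_two, Real.sin_arctan, Real.cos_arctan]
  push_cast
  field_simp
  ring

/-- A lift along a line not through the origin is a symbol. -/
theorem IsLift.eq_symb {ν : ℂ} {φ : G → ℂ} {Ψ : ℂ → ℂ} (hΨ : IsLift ν φ Ψ) {κ : ℂ}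
    (hκ : κ ≠ 0) (x : ℝ) : Ψ (κ * (x - Complex.I)) = symb (ν + 1 / 2) (profile Ψ κ) x := by
  have hs0 : (0 : ℝ) < √(1 + x ^ 2) := Real.sqrt_pos.2 (one_add_sq_pos x)
  rw [sub_I_eq, mul_left_comm, hΨ.homogeneous _ hs0.ne' _ (mul_ne_zero hκ (Complex.exp_ne_zero _)),
    symb, profile]
  congr 1
  rw [abs_of_pos hs0, ofReal_cpow_eq_exp hs0, ofReal_cpow_eq_exp (one_add_sq_pos x),
    Real.log_sqrt (one_add_sq_pos x).le]
  push_cast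
  congr 1; ring

/-- A number of integrations by parts that makes the Fourier integral of a symbol of parameter `s`
converge absolutely. -/
def regOrder (s : ℂ) : ℕ := ⌈1 - 2 * s.re⌉₊ + 1

theorem regOrder_spec (s : ℂ) : 1 / 2 < s.re + regOrder s / 2 := by
  have := Nat.le_ceil (1 - 2 * s.re)
  simp only [regOrder]
  push_cast
  linarith

/-- The regularized Fourier transform of a symbol is entire in `s`: near each point, the order of
regularization may be frozen. -/
theorem differentiable_regFourier {v : ℝ} (hv : v ≠ 0) {f : ℝ → ℂ} (hf : ContDiff ℝ ∞ f) :
    Differentiable ℂ fun s => regFourier (regOrder s) v (symb s f) := by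
  intro s
  refine (differentiableAt_regFourier (regOrder s) v hf (regOrder_spec s)).congr_of_eventuallyEq ?_
  have ho : IsOpen {z : ℂ | 1 / 2 < z.re + regOrder s / 2} :=
    isOpen_lt continuous_const (Complex.continuous_re.add continuous_const)
  filter_upwards [ho.mem_nhds (regOrder_spec s)] with z hz
  exact regFourier_eq hv hf (regOrder_spec z) hz

/-- The matrix representing `n[x]`. -/
def nSL (x : ℝ) : Matrix.SpecialLinearGroup (Fin 2) ℝ :=
  ⟨!![1, x; 0, 1], by simp [Matrix.det_fin_two]⟩

/-- The matrix representing `w`. -/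
def wSL : Matrix.SpecialLinearGroup (Fin 2) ℝ :=
  ⟨!![0, 1; -1, 0], by simp [Matrix.det_fin_two]⟩

/-- The matrix representing `a[y]`. -/
def aSL (y : ℝ) (hy : 0 < y) : Matrix.SpecialLinearGroup (Fin 2) ℝ :=
  ⟨!![√y, 0; 0, 1 / √y], by simp [Matrix.det_fin_two, (Real.sqrt_pos.2 hy).ne']⟩

theorem a_eq {y : ℝ} (hy : 0 < y) : a y = ofSL (aSL y hy) := by
  rw [a, dif_pos hy]; rfl

/-- The Iwasawa coordinate `y` of a matrix. -/
def iwasawaY (g : Matrix.SpecialLinearGroup (Fin 2) ℝ) : ℝ := (‖bottom g‖ ^ 2)⁻¹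

/-- The Iwasawa coordinate `x` of a matrix. -/
def iwasawaX (g : Matrix.SpecialLinearGroup (Fin 2) ℝ) : ℝ :=
  (g 0 0 * g 1 0 + g 0 1 * g 1 1) * iwasawaY g

theorem iwasawaY_pos (g : Matrix.SpecialLinearGroup (Fin 2) ℝ) : 0 < iwasawaY g := by
  have := norm_pos_iff.2 (bottom_ne_zero g)
  unfold iwasawaY; positivity

theorem wSL_mul_nSL (x : ℝ) : (wSL * nSL x) 1 0 = -1 ∧ (wSL * nSL x) 1 1 = -x := by
  rw [Matrix.SpecialLinearGroup.coe_mul]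
  constructor <;> simp [wSL, nSL]

/-- The bottom row of `w n[x] g` runs along a line, with parameter `(x + x₀) / y₀` in terms of the
Iwasawa coordinates `x₀`, `y₀` of `g`. -/
theorem bottom_w_mul_n_mul (g : Matrix.SpecialLinearGroup (Fin 2) ℝ) (x : ℝ) :
    bottom (wSL * nSL x * g) = (-(bottom g) * iwasawaY g) *
      (((x + iwasawaX g) / iwasawaY g : ℝ) - Complex.I) := by
  have hY := (iwasawaY_pos g).ne'
  have h1 : -(bottom g : ℂ) * iwasawaY g * (((x + iwasawaX g) / iwasawaY g : ℝ) - Complex.I) =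
      -(bottom g) * (x + iwasawaX g - Complex.I * iwasawaY g) := by
    have : (iwasawaY g : ℂ) ≠ 0 := by exact_mod_cast hY
    push_cast
    field_simp
  rw [h1]
  have hd := det_eq g
  have hq : (g 1 0 ^ 2 + g 1 1 ^ 2) * iwasawaY g = 1 := by
    rw [iwasawaY, bottom, normSq_sub_I_mul]
    refine mul_inv_cancel₀ fun h => bottom_ne_zero g ?_
    rw [← norm_eq_zero, ← sq_eq_zero_iff, bottom, normSq_sub_I_mul, h]
  rw [iwasawaX]
  set Y := iwasawaY g
  obtain ⟨e1, e2⟩ := wSL_mul_nSL x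
  simp only [bottom, Matrix.SpecialLinearGroup.coe_mul (wSL * nSL x) g, Matrix.mul_apply,
    Fin.sum_univ_two, e1, e2]
  apply Complex.ext
  · simp
    linear_combination (g 0 1) * hq + (g 1 0 * Y) * hd
  · simp
    linear_combination (-(g 0 0)) * hq + (g 1 1 * Y) * hd

/-! ### The Jacquet integral, its continuation, and equivariance under `n[x]` and `a[y]` -/

theorem w_mul_n_mul (g : Matrix.SpecialLinearGroup (Fin 2) ℝ) (x : ℝ) :
    w * n x * ofSL g = ofSL (wSL * nSL x * g) := rfl

/-- The analytic family through `φ`, evaluated at the argument of the Jacquet integral. -/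
theorem IsLift.deform_apply {ν : ℂ} {φ : G → ℂ} {Ψ : ℂ → ℂ} (hΨ : IsLift ν φ Ψ) (μ : ℂ)
    (g : Matrix.SpecialLinearGroup (Fin 2) ℝ) (x : ℝ) :
    deform ν φ μ (w * n x * ofSL g) = (iwasawaY g : ℂ) ^ (ν - μ) *
      symb (μ + 1 / 2) (profile Ψ (-(bottom g) * iwasawaY g)) ((x + iwasawaX g) / iwasawaY g) := by
  have hY := iwasawaY_pos g
  have hκ : -(bottom g) * (iwasawaY g : ℂ) ≠ 0 :=
    mul_ne_zero (neg_ne_zero.2 (bottom_ne_zero g)) (by exact_mod_cast hY.ne')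
  set t : ℝ := (x + iwasawaX g) / iwasawaY g with ht
  have hb : ‖bottom (wSL * nSL x * g)‖ ^ 2 = iwasawaY g * (1 + t ^ 2) := by
    rw [bottom_w_mul_n_mul, ← ht, norm_mul, norm_mul, norm_neg, Complex.norm_real,
      Real.norm_of_nonneg hY.le, mul_pow, mul_pow]
    have h1 : ‖(t : ℂ) - Complex.I‖ ^ 2 = 1 + t ^ 2 := by
      have := normSq_sub_I_mul 1 t
      rw [Complex.ofReal_one, mul_one] at this
      rw [this, one_pow]
    have h2 : ‖bottom g‖ ^ 2 * iwasawaY g = 1 := by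
      rw [iwasawaY]
      exact mul_inv_cancel₀ (pow_ne_zero 2 (norm_ne_zero_iff.2 (bottom_ne_zero g)))
    rw [h1]
    linear_combination (iwasawaY g * (1 + t ^ 2)) * h2
  have hp := one_add_sq_pos t
  rw [w_mul_n_mul, deform, height_ofSL, hΨ.eq_lift, hb, bottom_w_mul_n_mul, ← ht,
    hΨ.eq_symb hκ, symb, symb, ofReal_cpow_eq_exp hp, ofReal_cpow_eq_exp hp,
    ofReal_cpow_eq_exp (inv_pos.2 (mul_pos hY hp)), ofReal_cpow_eq_exp hY, Real.log_inv,
    Real.log_mul hY.ne' hp.ne', mul_right_comm, ← Complex.exp_add, ← mul_assoc, ← Complex.exp_add]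
  congr 2
  push_cast; ring

theorem integrable_and_integral_comp_affine {H : ℝ → ℂ} (hH : Integrable H) (X : ℝ) {Y : ℝ}
    (hY : 0 < Y) : Integrable (fun x => H ((x + X) / Y)) ∧
      ∫ x, H ((x + X) / Y) = Y * ∫ x, H x := by
  refine ⟨(hH.comp_div hY.ne').comp_add_right X, ?_⟩
  rw [integral_add_right_eq_self (fun x => H (x / Y)) X, Measure.integral_comp_div, abs_of_pos hY,
    Complex.real_smul]

theorem IsLift.jacquet_integrand {ν : ℂ} {φ : G → ℂ} {Ψ : ℂ → ℂ} (hΨ : IsLift ν φ Ψ) (μ : ℂ)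
    (g : Matrix.SpecialLinearGroup (Fin 2) ℝ) (δ x : ℝ) :
    e (-(δ * x)) * deform ν φ μ (w * n x * ofSL g) =
      (e (δ * iwasawaX g) * (iwasawaY g : ℂ) ^ (ν - μ)) *
      (e (-(δ * iwasawaY g * ((x + iwasawaX g) / iwasawaY g))) *
      symb (μ + 1 / 2) (profile Ψ (-(bottom g) * iwasawaY g))
        ((x + iwasawaX g) / iwasawaY g)) := by
  rw [hΨ.deform_apply]
  have h1 : e (-(δ * x)) = e (δ * iwasawaX g) *
      e (-(δ * iwasawaY g * ((x + iwasawaX g) / iwasawaY g))) := by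
    rw [← e_add]
    congr 1
    field_simp [(iwasawaY_pos g).ne']
    ring
  rw [h1]; ring

/-- The entire continuation in `μ` of the Jacquet integral at `g` of the family through a function
with parameter `ν` and lift `Ψ`. The order of regularization depends on `μ`; by `regFourier_eq` this
does not affect the value. -/
def jacquetExtension (ν : ℂ) (Ψ : ℂ → ℂ) (g : Matrix.SpecialLinearGroup (Fin 2) ℝ) (δ : ℝ)
    (μ : ℂ) : ℂ :=
  iwasawaY g * (e (δ * iwasawaX g) * (iwasawaY g : ℂ) ^ (ν - μ)) *
    regFourier (regOrder (μ + 1 / 2)) (δ * iwasawaY g)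
      (symb (μ + 1 / 2) (profile Ψ (-(bottom g) * iwasawaY g)))

/-- The Jacquet integral of a function with a lift converges for `Re μ > 0` and continues to an
entire function. -/
theorem IsLift.isJacquetContinuation {ν : ℂ} {φ : G → ℂ} {Ψ : ℂ → ℂ} (hΨ : IsLift ν φ Ψ)
    (g : Matrix.SpecialLinearGroup (Fin 2) ℝ) {δ : ℝ} (hδ : δ ≠ 0) :
    IsJacquetContinuation δ ν φ (ofSL g) (jacquetExtension ν Ψ g δ) := by
  have hY := iwasawaY_pos g
  have hY' : (iwasawaY g : ℂ) ≠ 0 := by exact_mod_cast hY.ne'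
  have hv : δ * iwasawaY g ≠ 0 := mul_ne_zero hδ hY.ne'
  have hf : ContDiff ℝ ∞ (profile Ψ (-(bottom g) * iwasawaY g)) :=
    hΨ.contDiff_profile (mul_ne_zero (neg_ne_zero.2 (bottom_ne_zero g)) hY')
  have hint : ∀ μ : ℂ, 0 < μ.re →
      Integrable (fun x => (e (δ * iwasawaX g) * (iwasawaY g : ℂ) ^ (ν - μ)) *
        (e (-(δ * iwasawaY g * x)) *
          symb (μ + 1 / 2) (profile Ψ (-(bottom g) * iwasawaY g)) x)) := by
    intro μ hμ
    have h0 := integrable_iteratedDeriv_symb 0 (s := μ + 1 / 2) hf (by simp; linarith)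
    rw [iteratedDeriv_zero] at h0
    exact (integrable_e_mul h0 (δ * iwasawaY g)).const_mul _
  refine ⟨?_, fun μ hμ => ?_, fun μ hμ => ?_⟩
  · unfold jacquetExtension
    have h1 : Differentiable ℂ fun μ : ℂ => (iwasawaY g : ℂ) ^ (ν - μ) := by
      intro μ
      exact (differentiableAt_const _ |>.sub differentiableAt_id).const_cpow (Or.inl hY')
    have h2 : Differentiable ℂ fun μ : ℂ => μ + 1 / 2 := by fun_prop
    exact ((h1.const_mul _).const_mul _).mul ((differentiable_regFourier hv hf).comp h2)
  · unfold JacquetConverges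
    simp only [hΨ.jacquet_integrand]
    exact (integrable_and_integral_comp_affine (hint μ hμ) _ hY).1
  · unfold jacquetIntegral
    simp only [hΨ.jacquet_integrand]
    rw [(integrable_and_integral_comp_affine (hint μ hμ) _ hY).2, integral_const_mul,
      jacquetExtension, regFourier_eq (M := 0) hv hf (regOrder_spec _) (by simp; linarith),
      regFourier]
    simp only [pow_zero, one_mul, iteratedDeriv_zero]
    ring

theorem IsLift.jacquet_eq {ν : ℂ} {φ : G → ℂ} {Ψ : ℂ → ℂ} (hΨ : IsLift ν φ Ψ)
    (g : Matrix.SpecialLinearGroup (Fin 2) ℝ) {δ : ℝ} (hδ : δ ≠ 0) :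
    jacquet δ ν φ (ofSL g) = jacquetExtension ν Ψ g δ ν := by
  have h := hΨ.isJacquetContinuation g hδ
  have hex : ∃ F : ℂ → ℂ, IsJacquetContinuation δ ν φ (ofSL g) F := ⟨_, h⟩
  rw [jacquet, dif_pos hex, hex.choose_spec.unique h]

theorem bottom_aSL {y : ℝ} (hy : 0 < y) : bottom (aSL y hy) = ((√y)⁻¹ : ℝ) := by
  simp [bottom, aSL]

theorem iwasawaY_aSL {y : ℝ} (hy : 0 < y) : iwasawaY (aSL y hy) = y := by
  rw [iwasawaY, bottom_aSL, Complex.norm_real, Real.norm_of_nonneg (by positivity), inv_pow,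
    Real.sq_sqrt hy.le, inv_inv]

theorem iwasawaX_aSL {y : ℝ} (hy : 0 < y) : iwasawaX (aSL y hy) = 0 := by
  simp [iwasawaX, aSL]

/-- The Kirillov operator is a regularized Fourier transform along `x ↦ Ψ (x - i)`, with any
admissible order of regularization. -/
theorem IsLift.kirillov_eq {ν : ℂ} {φ : G → ℂ} {Ψ : ℂ → ℂ} (hΨ : IsLift ν φ Ψ) {u : ℝ}
    (hu : u ≠ 0) {N : ℕ} (hN : 0 < ν.re + N / 2) :
    kirillov ν φ u = ((|u| : ℝ) : ℂ) ^ (1 / 2 - ν) *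
      regFourier N u (fun x => Ψ (x - Complex.I)) := by
  have hu' : 0 < |u| := abs_pos.2 hu
  have hsign : Real.sign u ≠ 0 := fun h => hu (Real.sign_eq_zero_iff.1 h)
  have hmul : Real.sign u * |u| = u := by
    rcases lt_or_gt_of_ne hu with h | h
    · rw [Real.sign_of_neg h, abs_of_neg h]; ring
    · rw [Real.sign_of_pos h, abs_of_pos h]; ring
  have hs : 0 < √|u| := Real.sqrt_pos.2 hu'
  have hκ : -bottom (aSL |u| hu') * (|u| : ℝ) = ((-√|u| : ℝ) : ℂ) := by
    rw [bottom_aSL]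
    have : -(√|u|)⁻¹ * |u| = -√|u| := by
      field_simp
      rw [Real.sq_sqrt hu'.le]
    exact_mod_cast this
  rw [kirillov, a_eq hu', hΨ.jacquet_eq _ hsign, jacquetExtension, iwasawaX_aSL, iwasawaY_aSL,
    mul_zero, e_zero, sub_self, Complex.cpow_zero, mul_one, mul_one, hmul]
  have hf := hΨ.contDiff_profile (κ := -bottom (aSL |u| hu') * (|u| : ℝ)) (by
    rw [hκ]; exact_mod_cast (neg_ne_zero.2 hs.ne'))
  rw [regFourier_eq (M := N) hu hf (regOrder_spec _) (by simp; linarith)]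
  have h1 : symb (ν + 1 / 2) (profile Ψ (-bottom (aSL |u| hu') * (|u| : ℝ))) =
      fun x : ℝ => ((√|u| : ℝ) : ℂ) ^ (-(2 * ν + 1)) * Ψ (x - Complex.I) := by
    ext x
    rw [← hΨ.eq_symb (by rw [hκ]; exact_mod_cast (neg_ne_zero.2 hs.ne')), hκ,
      hΨ.homogeneous _ (neg_ne_zero.2 hs.ne'), abs_neg, abs_of_pos hs]
    intro h
    simpa using congrArg Complex.im h
  rw [h1]
  unfold regFourier
  simp only [iteratedDeriv_const_mul_field]
  simp only [mul_left_comm (e _), integral_const_mul]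
  rw [mul_left_comm (_ ^ N), ← mul_assoc]
  congr 1
  rw [ofReal_cpow_eq_exp hs, ofReal_cpow_eq_exp hu', Real.log_sqrt hu'.le]
  conv_lhs => rw [← Complex.cpow_one ((|u| : ℝ) : ℂ), ofReal_cpow_eq_exp hu']
  rw [← Complex.exp_add]
  congr 1; push_cast; ring

theorem IsLift.eq_symb_one {ν : ℂ} {φ : G → ℂ} {Ψ : ℂ → ℂ} (hΨ : IsLift ν φ Ψ) :
    (fun x : ℝ => Ψ (x - Complex.I)) = symb (ν + 1 / 2) (profile Ψ 1) := by
  ext x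
  rw [← hΨ.eq_symb one_ne_zero, one_mul]

theorem regFourier_comp_add (N : ℕ) (v : ℝ) (A : ℝ → ℂ) (x : ℝ) :
    regFourier N v (fun t => A (t + x)) = e (v * x) * regFourier N v A := by
  unfold regFourier
  rw [iteratedDeriv_comp_add_const, mul_left_comm]
  congr 1
  rw [← integral_const_mul, ← integral_add_right_eq_self
    (fun t => e (v * x) * (e (-(v * t)) * iteratedDeriv N A t)) x]
  congr 1; ext t
  rw [← mul_assoc, ← e_add]
  congr 2; ring

theorem regFourier_comp_div (N : ℕ) (v : ℝ) {A : ℝ → ℂ} (hA : ContDiff ℝ ∞ A) {y : ℝ}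
    (hy : 0 < y) :
    regFourier N v (fun t => A (t / y)) = y * regFourier N (v * y) A := by
  unfold regFourier
  simp only [div_eq_inv_mul _ y]
  rw [iteratedDeriv_comp_const_smul (hA.of_le (by exact_mod_cast le_top))]
  have h1 : ∫ x, e (-(v * x)) * (y⁻¹ ^ N • iteratedDeriv N A (y⁻¹ * x)) =
      (y : ℂ)⁻¹ ^ N * (y * ∫ x, e (-(v * y * x)) * iteratedDeriv N A x) := by
    have h2 := Measure.integral_comp_inv_mul_left
      (fun x => e (-(v * y * x)) * iteratedDeriv N A x) y
    rw [abs_of_pos hy, Complex.real_smul] at h2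
    rw [← h2, ← integral_const_mul]
    congr 1; ext x
    rw [Complex.real_smul, show v * y * (y⁻¹ * x) = v * x by field_simp]
    push_cast; ring
  rw [h1, Complex.ofReal_mul, ← mul_assoc (2 * (Real.pi : ℂ) * Complex.I), mul_inv _ (y : ℂ), mul_pow]
  ring

theorem IsLift.kirillov_translate_n {ν : ℂ} {φ : G → ℂ} {Ψ : ℂ → ℂ} (hΨ : IsLift ν φ Ψ)
    (x : ℝ) {u : ℝ} (hu : u ≠ 0) :
    kirillov ν (rightTranslation (n x) φ) u = e (u * x) * kirillov ν φ u := by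
  have hN : 0 < ν.re + regOrder (ν + 1 / 2) / 2 := by
    have := regOrder_spec (ν + 1 / 2)
    simp at this; linarith
  rw [show n x = ofSL (nSL x) from rfl, (hΨ.translate (nSL x)).kirillov_eq hu hN,
    hΨ.kirillov_eq hu hN, mul_left_comm, ← regFourier_comp_add]
  congr 2; ext t
  congr 1
  simp [rowAct, nSL]
  ring

theorem IsLift.kirillov_translate_a {ν : ℂ} {φ : G → ℂ} {Ψ : ℂ → ℂ} (hΨ : IsLift ν φ Ψ)
    {y : ℝ} (hy : 0 < y) {u : ℝ} (hu : u ≠ 0) :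
    kirillov ν (rightTranslation (a y) φ) u = kirillov ν φ (u * y) := by
  have hN : 0 < ν.re + regOrder (ν + 1 / 2) / 2 := by
    have := regOrder_spec (ν + 1 / 2)
    simp at this; linarith
  have hs : 0 < √y := Real.sqrt_pos.2 hy
  rw [a_eq hy, (hΨ.translate _).kirillov_eq hu hN, hΨ.kirillov_eq (mul_ne_zero hu hy.ne') hN]
  have h1 : (fun x : ℝ => Ψ (rowAct (aSL y hy) (x - Complex.I))) =
      fun x : ℝ => ((√y : ℝ) : ℂ) ^ (-(2 * ν + 1)) * (fun x : ℝ => Ψ (x - Complex.I)) (x / y) := by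
    ext x
    simp only
    rw [show (√y : ℝ) = |√y| from (abs_of_pos hs).symm, ← hΨ.homogeneous _ hs.ne']
    · congr 1
      have h2 : x * (√y)⁻¹ = √y * (x / y) := by
        field_simp
        rw [Real.sq_sqrt hy.le, mul_comm]
      simp only [rowAct, aSL]
      have h3 : ((x * (√y)⁻¹ : ℝ) : ℂ) = ((√y * (x / y) : ℝ) : ℂ) := by rw [h2]
      push_cast at h3
      simp
      linear_combination h3
    · intro h
      simpa using congrArg Complex.im h
  have h4 : ContDiff ℝ ∞ fun x : ℝ => Ψ (x - Complex.I) := by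
    rw [hΨ.eq_symb_one]
    exact contDiff_symb _ (hΨ.contDiff_profile one_ne_zero)
  have h5 : regFourier (regOrder (ν + 1 / 2)) u
      (fun x : ℝ => ((√y : ℝ) : ℂ) ^ (-(2 * ν + 1)) * (fun x : ℝ => Ψ (x - Complex.I)) (x / y)) =
      ((√y : ℝ) : ℂ) ^ (-(2 * ν + 1)) * (y * regFourier (regOrder (ν + 1 / 2)) (u * y)
        (fun x : ℝ => Ψ (x - Complex.I))) := by
    rw [← regFourier_comp_div _ _ h4 hy]
    unfold regFourier
    simp only [iteratedDeriv_const_mul_field]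
    simp only [mul_left_comm (e _), integral_const_mul]
    ring
  rw [h1, h5, abs_mul, abs_of_pos hy, Complex.ofReal_mul,
    Complex.mul_cpow_ofReal_nonneg (abs_nonneg _) hy.le]
  have h6 : ((√y : ℝ) : ℂ) ^ (-(2 * ν + 1)) * y = (y : ℂ) ^ (1 / 2 - ν) := by
    conv_lhs => rw [← Complex.cpow_one (y : ℂ)]
    rw [ofReal_cpow_eq_exp hs, ofReal_cpow_eq_exp hy, ofReal_cpow_eq_exp hy, Real.log_sqrt hy.le,
      ← Complex.exp_add]
    congr 1; push_cast; ring
  rw [← h6]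
  ring

section BesselFunctions

open scoped Nat
open Set (Ioi)

/-! ### Bessel series and the kernel `j_ν` -/

/-- The entire function `E_α(z) = ∑ z ^ k / (k! Γ(α + k + 1))`, so that
`J_α(x) = (x/2) ^ α E_α(-x²/4)` and `I_α(x) = (x/2) ^ α E_α(x²/4)`. As `Complex.Gamma` takes the
value `0` at its poles, its inverse is the entire function `1/Γ` everywhere. -/
def besselSeries (α z : ℂ) : ℂ := ∑' k : ℕ, z ^ k * ((k ! : ℂ)⁻¹ * (Complex.Gamma (α + k + 1))⁻¹)

/-- For bounded `α`, the numbers `1 / Γ(α + k + 1)` are bounded uniformly in `k`: past `|α|` they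
decrease in absolute value. -/
theorem exists_norm_inv_Gamma_le (R : ℝ) :
    ∃ C, 0 ≤ C ∧ ∀ α : ℂ, ‖α‖ ≤ R → ∀ k : ℕ, ‖(Complex.Gamma (α + k + 1))⁻¹‖ ≤ C := by
  have hcont : Continuous fun s : ℂ => (Complex.Gamma s)⁻¹ :=
    Complex.differentiable_one_div_Gamma.continuous
  have h1 : ∀ k : ℕ, ∃ C, ∀ α ∈ Metric.closedBall (0 : ℂ) R,
      ‖(Complex.Gamma (α + k + 1))⁻¹‖ ≤ C := fun k =>
    (isCompact_closedBall (0 : ℂ) R).exists_bound_of_continuousOn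
      (hcont.comp (by fun_prop : Continuous fun α : ℂ => α + k + 1)).continuousOn
  choose C hC using h1
  set N := ⌈R⌉₊
  refine ⟨∑ k ∈ Finset.range (N + 1), |C k|, Finset.sum_nonneg fun _ _ => abs_nonneg _,
    fun α hα k => ?_⟩
  have hα' : α ∈ Metric.closedBall (0 : ℂ) R := by simpa using hα
  have hle : ∀ k ≤ N, ‖(Complex.Gamma (α + k + 1))⁻¹‖ ≤ ∑ k ∈ Finset.range (N + 1), |C k| :=
    fun k hk => (hC k α hα').trans ((le_abs_self _).trans
      (Finset.single_le_sum (f := fun k => |C k|) (fun _ _ => abs_nonneg _)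
        (Finset.mem_range.2 (by omega))))
  rcases le_total k N with hk | hk
  · exact hle k hk
  · induction k, hk using Nat.le_induction with
    | base => exact hle N le_rfl
    | succ k hk ih =>
      refine le_trans ?_ ih
      rw [Complex.one_div_Gamma_eq_self_mul_one_div_Gamma_add_one (α + k + 1), norm_mul]
      have h2 : 1 ≤ ‖α + k + 1‖ := by
        have h3 : ((k : ℝ) + 1) - ‖α‖ ≤ ‖α + k + 1‖ := by
          have := norm_sub_norm_le ((k : ℂ) + 1) (-α)
          rw [norm_neg, sub_neg_eq_add] at this
          have h4 : ‖((k : ℂ) + 1)‖ = k + 1 := by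
            have := Complex.norm_natCast (k + 1)
            push_cast at this; exact this
          rw [h4] at this
          rwa [show α + k + 1 = (k : ℂ) + 1 + α by ring]
        have h5 := Nat.le_ceil R
        have h6 : (N : ℝ) ≤ k := by exact_mod_cast hk
        linarith
      push_cast
      rw [← add_assoc]
      exact le_mul_of_one_le_left (norm_nonneg _) h2

theorem summable_besselSeries_bound (C r : ℝ) : Summable fun k : ℕ => r ^ k * ((k ! : ℝ)⁻¹ * C) := by
  have := (Real.summable_pow_div_factorial r).mul_right C
  exact this.congr fun k => by ring

theorem norm_besselSeries_term_le {α z : ℂ} {C r : ℝ} (hz : ‖z‖ ≤ r) {k : ℕ}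
    (h : ‖(Complex.Gamma (α + k + 1))⁻¹‖ ≤ C) :
    ‖z ^ k * ((k ! : ℂ)⁻¹ * (Complex.Gamma (α + k + 1))⁻¹)‖ ≤ r ^ k * ((k ! : ℝ)⁻¹ * C) := by
  rw [norm_mul, norm_mul, norm_pow, norm_inv, Complex.norm_natCast]
  have h0 : 0 ≤ r := (norm_nonneg _).trans hz
  gcongr

theorem hasSum_besselSeries (α z : ℂ) :
    HasSum (fun k : ℕ => z ^ k * ((k ! : ℂ)⁻¹ * (Complex.Gamma (α + k + 1))⁻¹))
      (besselSeries α z) := by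
  obtain ⟨C, -, hC⟩ := exists_norm_inv_Gamma_le ‖α‖
  exact (Summable.of_norm_bounded (summable_besselSeries_bound C ‖z‖) fun k =>
    norm_besselSeries_term_le le_rfl (hC α le_rfl k)).hasSum

theorem differentiable_besselSeries_left (z : ℂ) : Differentiable ℂ fun α => besselSeries α z := by
  intro α
  obtain ⟨C, -, hC⟩ := exists_norm_inv_Gamma_le (‖α‖ + 1)
  have h : DifferentiableOn ℂ (fun α => besselSeries α z) (Metric.ball 0 (‖α‖ + 1)) := by
    refine Complex.differentiableOn_tsum_of_summable_norm (summable_besselSeries_bound C ‖z‖)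
      (fun k => ?_) Metric.isOpen_ball fun k w hw => ?_
    · refine Differentiable.differentiableOn ?_
      have : Differentiable ℂ fun α : ℂ => α + k + 1 := by fun_prop
      exact ((Complex.differentiable_one_div_Gamma.comp this).const_mul _).const_mul _
    · exact norm_besselSeries_term_le le_rfl (hC w (mem_ball_zero_iff.1 hw).le k)
  exact h.differentiableAt (Metric.isOpen_ball.mem_nhds (by simp))

theorem hasDerivAt_besselSeries (α z : ℂ) :
    HasDerivAt (besselSeries α) (besselSeries (α + 1) z) z := by
  obtain ⟨C, -, hC⟩ := exists_norm_inv_Gamma_le ‖α‖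
  have hle : ∀ (k : ℕ) (w : ℂ), w ∈ Metric.ball (0 : ℂ) (‖z‖ + 1) →
      ‖w ^ k * ((k ! : ℂ)⁻¹ * (Complex.Gamma (α + k + 1))⁻¹)‖ ≤
        (‖z‖ + 1) ^ k * ((k ! : ℝ)⁻¹ * C) := fun k w hw =>
    norm_besselSeries_term_le (mem_ball_zero_iff.1 hw).le (hC α le_rfl k)
  have hd : ∀ k : ℕ, DifferentiableOn ℂ
      (fun w : ℂ => w ^ k * ((k ! : ℂ)⁻¹ * (Complex.Gamma (α + k + 1))⁻¹))
      (Metric.ball (0 : ℂ) (‖z‖ + 1)) := fun k => by fun_prop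
  have hz : z ∈ Metric.ball (0 : ℂ) (‖z‖ + 1) := by simp
  have h1 := Complex.hasSum_deriv_of_summable_norm
    (summable_besselSeries_bound C (‖z‖ + 1)) hd Metric.isOpen_ball hle hz
  have h2 := (Complex.differentiableOn_tsum_of_summable_norm
    (summable_besselSeries_bound C (‖z‖ + 1)) hd Metric.isOpen_ball hle).differentiableAt
    (Metric.isOpen_ball.mem_nhds hz) |>.hasDerivAt
  refine h2.congr_deriv ?_
  refine h1.unique ?_
  rw [← hasSum_nat_add_iff' 1]
  simp only [Finset.range_one, Finset.sum_singleton, pow_zero, deriv_const', sub_zero]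
  convert! hasSum_besselSeries (α + 1) z using 1
  ext k
  rw [deriv_mul_const (by fun_prop), deriv_pow_field, Nat.factorial_succ]
  have hk : ((k : ℂ) + 1) ≠ 0 := by exact_mod_cast Nat.succ_ne_zero k
  push_cast
  rw [show α + (k + 1) + 1 = α + 1 + k + 1 by ring]
  field_simp

/-- The three-term recurrence; with `hasDerivAt_besselSeries` it is the Bessel equation. -/
theorem besselSeries_recurrence (β z : ℂ) :
    besselSeries (β - 1) z = β * besselSeries β z + z * besselSeries (β + 1) z := by
  have h1 := hasSum_besselSeries (β - 1) z
  have h2 := (hasSum_besselSeries β z).mul_left β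
  have h3 := (hasSum_besselSeries (β + 1) z).mul_left z
  have h4 : HasSum (fun k : ℕ => z ^ k * (k * ((k ! : ℂ)⁻¹ * (Complex.Gamma (β + k + 1))⁻¹)))
      (z * besselSeries (β + 1) z) := by
    rw [← hasSum_nat_add_iff' 1]
    simp only [Finset.range_one, Finset.sum_singleton, Nat.cast_zero, zero_mul, mul_zero, sub_zero]
    convert! h3 using 1
    ext k
    have hk : ((k : ℂ) + 1) ≠ 0 := by exact_mod_cast Nat.succ_ne_zero k
    rw [Nat.factorial_succ]
    push_cast
    rw [show β + (k + 1) + 1 = β + 1 + k + 1 by ring, pow_succ]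
    field_simp
  refine h1.unique ((h2.add h4).congr_fun ?_)
  intro k
  rw [show β - 1 + k + 1 = β + k by ring,
    Complex.one_div_Gamma_eq_self_mul_one_div_Gamma_add_one (β + k)]
  ring

theorem besselSeries_zero_right (α : ℂ) : besselSeries α 0 = (Complex.Gamma (α + 1))⁻¹ := by
  refine (hasSum_besselSeries α 0).unique ?_
  convert! hasSum_single (f := fun k : ℕ => (0 : ℂ) ^ k *
    ((k ! : ℂ)⁻¹ * (Complex.Gamma (α + k + 1))⁻¹)) 0 (fun k hk => by simp [hk]) using 1
  simp

theorem continuous_besselSeries (α : ℂ) : Continuous (besselSeries α) :=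
  continuous_iff_continuousAt.2 fun z => (hasDerivAt_besselSeries α z).continuousAt

/-- The Bessel functions in the kernel, for both signs of `u`, through the same entire function. -/
theorem besselSign_eq {u : ℝ} (hu : u ≠ 0) (α : ℂ) :
    besselSign u α (4 * Real.pi * √|u|) = ((2 * Real.pi * √|u| : ℝ) : ℂ) ^ α *
      besselSeries α ((-(4 * Real.pi ^ 2 * u) : ℝ) : ℂ) := by
  have hX : 0 < 2 * Real.pi * √|u| := by
    have := Real.sqrt_pos.2 (abs_pos.2 hu)
    have := Real.pi_pos
    positivity
  have hX' : ((2 * Real.pi * √|u| : ℝ) : ℂ) ≠ 0 := by exact_mod_cast hX.ne'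
  have h2 : 4 * Real.pi * √|u| / 2 = 2 * Real.pi * √|u| := by ring
  have h3 : (2 * Real.pi * √|u|) ^ 2 = 4 * Real.pi ^ 2 * |u| := by
    rw [mul_pow, Real.sq_sqrt (abs_nonneg _)]; ring
  have h4 : ∀ k : ℕ, ((2 * Real.pi * √|u| : ℝ) : ℂ) ^ (α + 2 * k) =
      ((2 * Real.pi * √|u| : ℝ) : ℂ) ^ α * ((4 * Real.pi ^ 2 * |u| : ℝ) : ℂ) ^ k := by
    intro k
    rw [Complex.cpow_add _ _ hX', ← h3, Complex.ofReal_pow, ← pow_mul]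
    congr 1
    rw [← Complex.cpow_natCast]
    push_cast; rfl
  rw [besselSeries, ← tsum_mul_left, besselSign]
  split_ifs with h
  · rw [besselJ, h2]
    refine tsum_congr fun k => ?_
    rw [h4, abs_of_pos h, Complex.ofReal_neg, neg_pow]
    ring
  · rw [besselI, h2]
    refine tsum_congr fun k => ?_
    rw [h4, abs_of_neg (lt_of_le_of_ne (not_lt.1 h) hu), mul_neg]
    ring

/-- The difference of Bessel functions in the definition of `j_μ(u)`, in terms of `besselSeries`; an
entire function of `μ`. -/
def besselNumer (u : ℝ) (μ : ℂ) : ℂ :=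
  ((2 * Real.pi * √|u| : ℝ) : ℂ) ^ (-(2 * μ)) *
      besselSeries (-(2 * μ)) ((-(4 * Real.pi ^ 2 * u) : ℝ) : ℂ) -
    ((2 * Real.pi * √|u| : ℝ) : ℂ) ^ (2 * μ) *
      besselSeries (2 * μ) ((-(4 * Real.pi ^ 2 * u) : ℝ) : ℂ)

theorem besselQuotient_eq (μ : ℂ) (u : ℝ) :
    besselQuotient μ u =
      Real.pi * (√|u| : ℝ) / Complex.sin (Real.pi * μ) * besselNumer u μ := by
  rcases eq_or_ne u 0 with rfl | hu
  · simp [besselQuotient]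
  · rw [besselQuotient, besselSign_eq hu, besselSign_eq hu, besselNumer]

theorem besselQuotient_neg (μ : ℂ) (u : ℝ) : besselQuotient (-μ) u = besselQuotient μ u := by
  rw [besselQuotient, besselQuotient, mul_neg, mul_neg, neg_neg, Complex.sin_neg]
  ring

theorem differentiable_besselNumer {u : ℝ} (hu : u ≠ 0) : Differentiable ℂ (besselNumer u) := by
  have hX : ((2 * Real.pi * √|u| : ℝ) : ℂ) ≠ 0 := by
    have := Real.sqrt_pos.2 (abs_pos.2 hu)
    have := Real.pi_pos
    exact_mod_cast (by positivity : 2 * Real.pi * √|u| ≠ 0)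
  have h1 : Differentiable ℂ fun μ : ℂ => -(2 * μ) := by fun_prop
  have h2 : Differentiable ℂ fun μ : ℂ => 2 * μ := by fun_prop
  have h3 := differentiable_besselSeries_left ((-(4 * Real.pi ^ 2 * u) : ℝ) : ℂ)
  unfold besselNumer
  intro μ
  exact (((h1 μ).const_cpow (Or.inl hX)).mul ((h3.comp h1) μ)).sub
    (((h2 μ).const_cpow (Or.inl hX)).mul ((h3.comp h2) μ))

theorem sin_pi_mul_eq_zero_iff {ν : ℂ} (hν : |ν.re| < 1 / 2) :
    Complex.sin (Real.pi * ν) = 0 ↔ ν = 0 := by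
  refine ⟨fun h => ?_, fun h => by simp [h]⟩
  obtain ⟨k, hk⟩ := Complex.sin_eq_zero_iff.1 h
  have h1 : ν = k := by
    have : (Real.pi : ℂ) ≠ 0 := by exact_mod_cast Real.pi_ne_zero
    apply mul_left_cancel₀ this
    rw [hk]; ring
  rw [h1, Complex.intCast_re, ← Int.cast_abs] at hν
  have h2 : |k| < 1 := by
    have : ((|k| : ℤ) : ℝ) < 1 := by linarith
    exact_mod_cast this
  rw [h1, Int.abs_lt_one_iff.1 h2, Int.cast_zero]

theorem differentiableAt_besselQuotient {ν : ℂ} (hν : Complex.sin (Real.pi * ν) ≠ 0) (u : ℝ) :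
    DifferentiableAt ℂ (fun μ => besselQuotient μ u) ν := by
  simp only [besselQuotient_eq]
  rcases eq_or_ne u 0 with rfl | hu
  · simp
  have h : DifferentiableAt ℂ (fun μ : ℂ => Complex.sin (Real.pi * μ)) ν := by fun_prop
  exact ((differentiableAt_const _).div h hν).mul (differentiable_besselNumer hu ν)

/-- Numerator and denominator of the quotient both vanish at `μ = 0`, and the denominator simply. -/
theorem exists_tendsto_besselQuotient_zero (u : ℝ) :
    ∃ l, Tendsto (fun μ : ℂ => besselQuotient μ u) (𝓝[≠] 0) (𝓝 l) := by
  simp only [besselQuotient_eq]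
  rcases eq_or_ne u 0 with rfl | hu
  · exact ⟨0, by simp⟩
  have h1 := hasDerivAt_iff_tendsto_slope_zero.1 (differentiable_besselNumer hu 0).hasDerivAt
  have hs : HasDerivAt (fun μ : ℂ => Complex.sin (Real.pi * μ)) Real.pi 0 := by
    have := ((hasDerivAt_id (0 : ℂ)).const_mul (Real.pi : ℂ)).csin
    simpa using this
  have h2 := hasDerivAt_iff_tendsto_slope_zero.1 hs
  have hpi : (Real.pi : ℂ) ≠ 0 := by exact_mod_cast Real.pi_ne_zero
  refine ⟨_, ((h1.div h2 hpi).const_mul (Real.pi * (√|u| : ℝ) : ℂ)).congr' ?_⟩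
  filter_upwards [self_mem_nhdsWithin] with μ hμ
  have hμ' : μ ≠ 0 := hμ
  have h0 : besselNumer u 0 = 0 := by simp [besselNumer]
  simp only [zero_add, h0, sub_zero, smul_eq_mul, mul_zero, Complex.sin_zero, Pi.div_apply]
  rw [mul_div_mul_left _ _ (inv_ne_zero hμ')]
  ring

/-- In the strip `|Re ν| < 1/2`, the kernel `j_ν` is the limit of the Bessel quotient at every
point. -/
theorem tendsto_besselQuotient {ν : ℂ} (hν : |ν.re| < 1 / 2) (u : ℝ) :
    Tendsto (fun μ : ℂ => besselQuotient μ u) (𝓝[≠] ν) (𝓝 (besselKernel ν u)) := by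
  rw [besselKernel]
  split_ifs with h
  · rw [sin_pi_mul_eq_zero_iff hν] at h
    subst h
    exact tendsto_nhds_limUnder (exists_tendsto_besselQuotient_zero u)
  · exact (differentiableAt_besselQuotient h u).continuousAt.tendsto.mono_left nhdsWithin_le_nhds

theorem besselKernel_eq {ν : ℂ} (hν : |ν.re| < 1 / 2) (h0 : ν ≠ 0) (u : ℝ) :
    besselKernel ν u = besselQuotient ν u := by
  rw [besselKernel, if_neg (mt (sin_pi_mul_eq_zero_iff hν).1 h0)]

theorem isOpen_strip : IsOpen {ν : ℂ | |ν.re| < 1 / 2} :=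
  isOpen_lt (continuous_abs.comp Complex.continuous_re) continuous_const

/-- The singularity of the Bessel quotient at `ν = 0` is removable. -/
theorem differentiableOn_besselKernel (u : ℝ) :
    DifferentiableOn ℂ (fun ν => besselKernel ν u) {ν : ℂ | |ν.re| < 1 / 2} := by
  have h0 : {ν : ℂ | |ν.re| < 1 / 2} ∈ 𝓝 (0 : ℂ) := isOpen_strip.mem_nhds (by simp)
  refine (Complex.differentiableOn_compl_singleton_and_continuousAt_iff h0).1 ⟨?_, ?_⟩
  · intro ν hν
    have hν1 : |ν.re| < 1 / 2 := hν.1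
    have hν0 : ν ≠ 0 := hν.2
    refine DifferentiableAt.differentiableWithinAt ?_
    refine (differentiableAt_besselQuotient
      (mt (sin_pi_mul_eq_zero_iff hν1).1 hν0) u).congr_of_eventuallyEq ?_
    filter_upwards [isOpen_strip.mem_nhds hν1, isOpen_compl_singleton.mem_nhds hν0] with z hz hz0
    exact besselKernel_eq hz hz0 u
  · rw [continuousAt_iff_punctured_nhds]
    refine (tendsto_besselQuotient (by simp) u).congr' ?_
    filter_upwards [nhdsWithin_le_nhds h0, self_mem_nhdsWithin] with z hz hz0
    exact (besselKernel_eq hz hz0 u).symm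

theorem measurable_besselKernel {ν : ℂ} (hν : |ν.re| < 1 / 2) : Measurable (besselKernel ν) := by
  have hq : ∀ μ : ℂ, Measurable (besselQuotient μ) := by
    intro μ
    have h1 : ∀ α : ℂ, Measurable fun u : ℝ => besselSeries α ((-(4 * Real.pi ^ 2 * u) : ℝ) : ℂ) :=
      fun α => ((continuous_besselSeries α).comp (by fun_prop)).measurable
    have h2 : ∀ α : ℂ, Measurable fun u : ℝ => ((2 * Real.pi * √|u| : ℝ) : ℂ) ^ α :=
      fun α => Measurable.pow_const (by fun_prop) α
    have h3 : besselQuotient μ = fun u =>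
        Real.pi * (√|u| : ℝ) / Complex.sin (Real.pi * μ) * besselNumer u μ :=
      funext (besselQuotient_eq μ)
    rw [h3]
    unfold besselNumer
    exact Measurable.mul (by fun_prop) (((h2 _).mul (h1 _)).sub ((h2 _).mul (h1 _)))
  rcases eq_or_ne ν 0 with rfl | h0
  · have hlim : Tendsto (fun k : ℕ => (1 / ((k : ℂ) + 1))) atTop (𝓝[≠] 0) := by
      refine tendsto_nhdsWithin_iff.2 ⟨tendsto_one_div_add_atTop_nhds_zero_nat,
        Eventually.of_forall fun k => ?_⟩
      exact one_div_ne_zero (by exact_mod_cast Nat.succ_ne_zero k)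
    refine measurable_of_tendsto_metrizable (fun k : ℕ => hq (1 / ((k : ℂ) + 1))) ?_
    rw [tendsto_pi_nhds]
    intro u
    exact (tendsto_besselQuotient hν u).comp hlim
  · have : besselKernel ν = besselQuotient ν := funext (besselKernel_eq hν h0)
    rw [this]; exact hq ν

/-! ### Macdonald integrals and Wronskian identities -/

/-- The Macdonald integral `∫₀^∞ exp (-p t - q / t) t ^ (-α - 1) dt`, which is
`2 (p/q) ^ (α/2) K_α(2 √(pq))`. It converges when `p` and `q` have positive real part. -/
def macdonald (p q α : ℂ) : ℂ :=
  ∫ t in Ioi (0 : ℝ), Complex.exp (-(p * t) - q / t) * (t : ℂ) ^ (-α - 1)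

theorem norm_macdonald_integrand {t : ℝ} (ht : 0 < t) (p q α : ℂ) :
    ‖Complex.exp (-(p * t) - q / t) * (t : ℂ) ^ (-α - 1)‖ =
      Real.exp (-(p.re * t) - q.re / t) * t ^ (-α.re - 1) := by
  rw [norm_mul, Complex.norm_exp, Complex.norm_cpow_eq_rpow_re_of_pos ht]
  congr 2
  · simp [Complex.div_ofReal_re]

theorem continuousOn_macdonald_integrand (p q α : ℂ) :
    ContinuousOn (fun t : ℝ => Complex.exp (-(p * t) - q / t) * (t : ℂ) ^ (-α - 1)) (Ioi 0) := by
  have h1 : ContinuousOn (fun t : ℝ => (t : ℂ)) (Ioi 0) := Complex.continuous_ofReal.continuousOn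
  have h0 : ∀ t ∈ Ioi (0 : ℝ), (t : ℂ) ≠ 0 := fun t ht => by
    exact_mod_cast (ne_of_gt ht : t ≠ 0)
  refine ContinuousOn.mul (((continuousOn_const.mul h1).neg.sub
    (continuousOn_const.div h1 h0)).cexp) ?_
  exact h1.cpow_const fun t ht => Complex.ofReal_mem_slitPlane.2 ht

theorem integrableOn_macdonald_majorant {a b : ℝ} (ha : 0 < a) (hb : 0 < b) (σ : ℝ) :
    IntegrableOn (fun t : ℝ => Real.exp (-(a * t) - b / t) * t ^ (-σ - 1)) (Ioi 0) := by
  obtain ⟨m, hm⟩ := exists_nat_gt σ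
  have h1 : IntegrableOn (fun t : ℝ => (m ! / b ^ m) *
      (t ^ ((m : ℝ) - σ - 1) * Real.exp (-a * t ^ (1 : ℝ)))) (Ioi 0) :=
    (integrableOn_rpow_mul_exp_neg_mul_rpow (by linarith) zero_lt_one ha).const_mul _
  refine h1.mono' ?_ ?_
  · refine ContinuousOn.aestronglyMeasurable ?_ measurableSet_Ioi
    have h0 : ∀ t ∈ Ioi (0 : ℝ), t ≠ 0 := fun t ht => ne_of_gt ht
    refine ContinuousOn.mul ((((continuousOn_const.mul continuousOn_id).neg.sub
      (continuousOn_const.div continuousOn_id h0))).rexp) ?_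
    exact continuousOn_id.rpow_const fun t ht => Or.inl (h0 t ht)
  · refine (ae_restrict_iff' measurableSet_Ioi).2 (Eventually.of_forall fun t ht => ?_)
    have ht0 : (0 : ℝ) < t := ht
    rw [Real.norm_of_nonneg (by positivity), sub_eq_add_neg, Real.exp_add, Real.rpow_one, ← neg_mul]
    have h2 : Real.exp (-(b / t)) ≤ m ! / b ^ m * t ^ m := by
      have h3 := Real.pow_div_factorial_le_exp (b / t) (by positivity) m
      rw [Real.exp_neg]
      have h4 : m ! / b ^ m * t ^ m = ((b / t) ^ m / m !)⁻¹ := by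
        rw [div_pow]
        field_simp
      rw [h4]
      exact inv_anti₀ (by positivity) h3
    have h5 : t ^ ((m : ℝ) - σ - 1) = t ^ m * t ^ (-σ - 1) := by
      rw [← Real.rpow_natCast, ← Real.rpow_add ht0]; congr 1; ring
    rw [h5]
    calc Real.exp (-a * t) * Real.exp (-(b / t)) * t ^ (-σ - 1)
        ≤ Real.exp (-a * t) * (m ! / b ^ m * t ^ m) * t ^ (-σ - 1) := by gcongr
      _ = _ := by ring

theorem integrableOn_macdonald {p q : ℂ} (hp : 0 < p.re) (hq : 0 < q.re) (α : ℂ) :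
    IntegrableOn (fun t : ℝ => Complex.exp (-(p * t) - q / t) * (t : ℂ) ^ (-α - 1)) (Ioi 0) := by
  refine (integrableOn_macdonald_majorant hp hq α.re).mono'
    ((continuousOn_macdonald_integrand p q α).aestronglyMeasurable measurableSet_Ioi) ?_
  exact (ae_restrict_iff' measurableSet_Ioi).2 (Eventually.of_forall fun t ht =>
    (norm_macdonald_integrand ht p q α).le)

/-- Differentiation under the integral sign in `q` raises the parameter by one. -/
theorem hasDerivAt_macdonald {p q : ℂ} (hp : 0 < p.re) (hq : 0 < q.re) (α : ℂ) :
    HasDerivAt (fun q => macdonald p q α) (-macdonald p q (α + 1)) q := by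
  have hr : 0 < q.re / 2 := by positivity
  have hre : ∀ z ∈ Metric.ball q (q.re / 2), q.re / 2 ≤ z.re := by
    intro z hz
    rw [Metric.mem_ball, dist_eq_norm] at hz
    have h2 := (Complex.abs_re_le_norm (z - q))
    rw [Complex.sub_re] at h2
    have h3 := (abs_lt.1 (h2.trans_lt hz)).1
    linarith
  have h := (hasDerivAt_integral_of_dominated_loc_of_deriv_le
    (μ := volume.restrict (Ioi (0 : ℝ)))
    (F := fun (q : ℂ) (t : ℝ) => Complex.exp (-(p * t) - q / t) * (t : ℂ) ^ (-α - 1))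
    (F' := fun (q : ℂ) (t : ℝ) =>
      -(Complex.exp (-(p * t) - q / t) * (t : ℂ) ^ (-(α + 1) - 1)))
    (bound := fun t => Real.exp (-(p.re * t) - (q.re / 2) / t) * t ^ (-(α.re + 1) - 1))
    (Metric.ball_mem_nhds q hr) ?_ (integrableOn_macdonald hp hq α)
    (integrableOn_macdonald hp hq (α + 1)).aestronglyMeasurable.neg ?_
    (integrableOn_macdonald_majorant hp hr _) ?_).2
  · rw [integral_neg] at h
    exact h
  · exact Eventually.of_forall fun z =>
      (continuousOn_macdonald_integrand p z α).aestronglyMeasurable measurableSet_Ioi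
  · refine (ae_restrict_iff' measurableSet_Ioi).2 (Eventually.of_forall fun t ht z hz => ?_)
    have ht0 : (0 : ℝ) < t := ht
    rw [norm_neg, norm_macdonald_integrand ht]
    have := hre z hz
    simp only [Complex.add_re, Complex.one_re]
    gcongr
  · refine (ae_restrict_iff' measurableSet_Ioi).2 (Eventually.of_forall fun t ht z _ => ?_)
    have ht0 : (t : ℂ) ≠ 0 := by exact_mod_cast (ne_of_gt ht : t ≠ 0)
    have h1 : HasDerivAt (fun z : ℂ => -(p * t) - z / t) (-(1 / t)) z :=
      ((hasDerivAt_id z).div_const (t : ℂ)).const_sub _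
    refine (h1.cexp.mul_const ((t : ℂ) ^ (-α - 1))).congr_deriv ?_
    rw [show -(α + 1) - 1 = -α - 1 - 1 by ring, Complex.cpow_sub (-α - 1) 1 ht0, Complex.cpow_one]
    ring

/-- The substitution `t ↦ 1/t`. -/
theorem macdonald_swap (p q α : ℂ) : macdonald p q α = macdonald q p (-α) := by
  unfold macdonald
  rw [← integral_comp_rpow_Ioi _ (by norm_num : (-1 : ℝ) ≠ 0)]
  refine setIntegral_congr_fun measurableSet_Ioi fun t ht => ?_
  have ht0 : (0 : ℝ) < t := ht
  have htc : (t : ℂ) ≠ 0 := by exact_mod_cast ht0.ne'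
  simp only [Real.rpow_neg_one, Complex.real_smul]
  rw [show |(-1 : ℝ)| * t ^ ((-1 : ℝ) - 1) = (t⁻¹) ^ 2 by
    rw [abs_neg, abs_one, one_mul, show (-1 : ℝ) - 1 = -((2 : ℕ) : ℝ) by norm_num,
      Real.rpow_neg ht0.le, Real.rpow_natCast, inv_pow]]
  have h1 : ((t⁻¹ : ℝ) : ℂ) ^ (-α - 1) = (t : ℂ) ^ (- -α + 1) := by
    rw [ofReal_cpow_eq_exp (inv_pos.2 ht0), ofReal_cpow_eq_exp ht0, Real.log_inv]
    push_cast; congr 1; ring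
  rw [h1, show - -α + 1 = (- -α - 1) + (2 : ℕ) by push_cast; ring, Complex.cpow_add _ _ htc,
    Complex.cpow_natCast]
  have h2 : -(p * ((t⁻¹ : ℝ) : ℂ)) - q / ((t⁻¹ : ℝ) : ℂ) = -(q * t) - p / t := by
    push_cast; field_simp; ring
  rw [h2]
  push_cast
  field_simp

/-- The substitution `t ↦ c t`. -/
theorem macdonald_scale (p q α : ℂ) {c : ℝ} (hc : 0 < c) :
    macdonald (c * p) (q / c) α = (c : ℂ) ^ α * macdonald p q α := by
  unfold macdonald
  have hcc : (c : ℂ) ≠ 0 := by exact_mod_cast hc.ne'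
  have h := integral_comp_mul_left_Ioi
    (fun t : ℝ => Complex.exp (-(p * t) - q / t) * (t : ℂ) ^ (-α - 1)) 0 hc
  rw [mul_zero, Complex.real_smul] at h
  have h' : (∫ t in Ioi (0 : ℝ), Complex.exp (-(p * t) - q / t) * (t : ℂ) ^ (-α - 1)) =
      c * ∫ t in Ioi (0 : ℝ), Complex.exp (-(p * (c * t : ℝ)) - q / (c * t : ℝ)) *
        ((c * t : ℝ) : ℂ) ^ (-α - 1) := by
    rw [h]; push_cast; field_simp
  rw [h', ← mul_assoc, ← integral_const_mul]
  refine setIntegral_congr_fun measurableSet_Ioi fun t ht => ?_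
  have ht0 : (0 : ℝ) < t := ht
  have htc : (t : ℂ) ≠ 0 := by exact_mod_cast ht0.ne'
  have h1 : (c : ℂ) ^ α * c * ((c * t : ℝ) : ℂ) ^ (-α - 1) = (t : ℂ) ^ (-α - 1) := by
    rw [Complex.ofReal_mul, Complex.mul_cpow_ofReal_nonneg hc.le ht0.le, ← mul_assoc,
      show -α - 1 = -(α + 1) by ring, Complex.cpow_neg (c : ℂ), Complex.cpow_add _ _ hcc,
      Complex.cpow_one, mul_inv_cancel₀, one_mul]
    exact mul_ne_zero (by simp [hcc]) hcc
  rw [mul_left_comm, h1]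
  congr 2
  push_cast; field_simp

theorem macdonald_one_neg {q : ℝ} (hq : 0 < q) (α : ℂ) :
    macdonald 1 q (-α) = (q : ℂ) ^ α * macdonald 1 q α := by
  have hqc : (q : ℂ) ≠ 0 := by exact_mod_cast hq.ne'
  rw [← macdonald_scale _ _ _ hq, mul_one, div_self hqc, macdonald_swap, neg_neg]

theorem hasDerivAt_macdonald_one {q : ℝ} (hq : 0 < q) (α : ℂ) :
    HasDerivAt (fun q : ℝ => macdonald 1 q α) (-macdonald 1 q (α + 1)) q :=
  (hasDerivAt_macdonald (p := 1) (q := q) (by simp) (by simpa using hq) α).comp_ofReal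

/-- The three-term recurrence, from differentiating the symmetry `macdonald_one_neg` in `q`. -/
theorem macdonald_recurrence {q : ℝ} (hq : 0 < q) (α : ℂ) :
    q * macdonald 1 q (α + 1) = macdonald 1 q (α - 1) + α * macdonald 1 q α := by
  have hqc : (q : ℂ) ≠ 0 := by exact_mod_cast hq.ne'
  have h1 := hasDerivAt_macdonald_one hq (-α)
  have hpow : HasDerivAt (fun q : ℝ => (q : ℂ) ^ α) (α * (q : ℂ) ^ (α - 1)) q := by
    have := (hasDerivAt_id (q : ℂ)).cpow_const (c := α) (Complex.ofReal_mem_slitPlane.2 hq)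
    simpa using this.comp_ofReal
  have h2 := hpow.mul (hasDerivAt_macdonald_one hq α)
  have h3 := h1.unique (h2.congr_of_eventuallyEq (by
    filter_upwards [isOpen_Ioi.mem_nhds hq] with t ht
    exact macdonald_one_neg ht α))
  rw [show -α + 1 = -(α - 1) by ring, macdonald_one_neg hq, Complex.cpow_sub _ _ hqc,
    Complex.cpow_one] at h3
  have h4 : (q : ℂ) ^ α ≠ 0 := by simp [hqc]
  field_simp at h3
  linear_combination h3

theorem tendsto_macdonald_neg {β : ℂ} (hβ : 0 < β.re) :
    Tendsto (fun q : ℝ => macdonald 1 q (-β)) (𝓝[>] 0) (𝓝 (Complex.Gamma β)) := by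
  rw [Complex.Gamma_eq_integral hβ, Complex.GammaIntegral]
  have hconv := Complex.GammaIntegral_convergent hβ
  refine tendsto_integral_filter_of_dominated_convergence
    (fun t => ‖((-t).exp : ℂ) * (t : ℂ) ^ (β - 1)‖) ?_ ?_ hconv.norm ?_
  · exact Eventually.of_forall fun q =>
      (continuousOn_macdonald_integrand 1 q _).aestronglyMeasurable measurableSet_Ioi
  · filter_upwards [self_mem_nhdsWithin] with q hq
    refine (ae_restrict_iff' measurableSet_Ioi).2 (Eventually.of_forall fun t ht => ?_)
    have ht0 : (0 : ℝ) < t := ht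
    have hq0 : (0 : ℝ) < q := hq
    rw [norm_macdonald_integrand ht, norm_mul, Complex.norm_cpow_eq_rpow_re_of_pos ht0,
      Complex.norm_real, Real.norm_of_nonneg (Real.exp_pos _).le]
    simp only [Complex.one_re, one_mul, Complex.ofReal_re, Complex.neg_re, neg_neg, Complex.sub_re]
    gcongr
    have : 0 < q / t := by positivity
    linarith
  · refine (ae_restrict_iff' measurableSet_Ioi).2 (Eventually.of_forall fun t ht => ?_)
    refine Tendsto.mono_left ?_ nhdsWithin_le_nhds
    have h : Continuous fun q : ℝ =>
        Complex.exp (-(1 * t) - (q : ℂ) / t) * (t : ℂ) ^ (-(-β) - 1) := by fun_prop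
    have := h.tendsto 0
    simpa using this

theorem tendsto_mul_macdonald_neg {α : ℂ} (hα : -1 < α.re) :
    Tendsto (fun q : ℝ => (q : ℂ) * macdonald 1 q (-α)) (𝓝[>] 0) (𝓝 0) := by
  have h0 : (0 : ℂ) = ∫ t in Ioi (0 : ℝ), (0 : ℂ) := by simp
  rw [h0]
  simp only [macdonald, ← integral_const_mul]
  have hconv := Complex.GammaIntegral_convergent (s := α + 1) (by simp; linarith)
  refine tendsto_integral_filter_of_dominated_convergence
    (fun t => ‖((-t).exp : ℂ) * (t : ℂ) ^ (α + 1 - 1)‖) ?_ ?_ hconv.norm ?_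
  · exact Eventually.of_forall fun q =>
      ((continuousOn_macdonald_integrand 1 q _).aestronglyMeasurable measurableSet_Ioi).const_mul _
  · filter_upwards [self_mem_nhdsWithin] with q hq
    refine (ae_restrict_iff' measurableSet_Ioi).2 (Eventually.of_forall fun t ht => ?_)
    have ht0 : (0 : ℝ) < t := ht
    have hq0 : (0 : ℝ) < q := hq
    rw [norm_mul, norm_macdonald_integrand ht, norm_mul, Complex.norm_cpow_eq_rpow_re_of_pos ht0,
      Complex.norm_real, Complex.norm_real, Real.norm_of_nonneg hq0.le,
      Real.norm_of_nonneg (Real.exp_pos _).le]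
    simp only [Complex.one_re, one_mul, Complex.ofReal_re, Complex.neg_re, neg_neg,
      add_sub_cancel_right]
    rw [sub_eq_add_neg, Real.exp_add, Real.rpow_sub_one ht0.ne']
    have h1 : q * Real.exp (-(q / t)) ≤ t := by
      have h2 : q / t ≤ Real.exp (q / t) := (le_add_of_nonneg_right zero_le_one).trans
        (Real.add_one_le_exp _)
      rw [Real.exp_neg, ← div_eq_mul_inv, div_le_iff₀ (Real.exp_pos _)]
      rwa [div_le_iff₀' ht0] at h2
    have h3 : 0 < t ^ α.re := Real.rpow_pos_of_pos ht0 _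
    calc q * (Real.exp (-t) * Real.exp (-(q / t)) * (t ^ α.re / t))
        = (q * Real.exp (-(q / t))) * (Real.exp (-t) * (t ^ α.re / t)) := by ring
      _ ≤ t * (Real.exp (-t) * (t ^ α.re / t)) := by gcongr
      _ = _ := by field_simp
  · refine (ae_restrict_iff' measurableSet_Ioi).2 (Eventually.of_forall fun t ht => ?_)
    refine Tendsto.mono_left ?_ nhdsWithin_le_nhds
    have h : Continuous fun q : ℝ =>
        (q : ℂ) * (Complex.exp (-(1 * t) - (q : ℂ) / t) * (t : ℂ) ^ (-(-α) - 1)) := by fun_prop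
    have := h.tendsto 0
    simpa using this

theorem hasDerivAt_besselSeries_real (α : ℂ) (q : ℝ) :
    HasDerivAt (fun q : ℝ => besselSeries α q) (besselSeries (α + 1) q) q :=
  (hasDerivAt_besselSeries α q).comp_ofReal

/-- The Wronskian of the Macdonald integral and the Bessel series is constant; its value is found by
letting `q → 0`, where the Macdonald integral tends to a value of `Γ` that cancels the leading
coefficient of the series. -/
theorem macdonald_wronskian {α : ℂ} (hα : -1 < α.re) {q : ℝ} (hq : 0 < q) :
    macdonald 1 q (-(α + 1)) * besselSeries α q +
      q * macdonald 1 q (-α) * besselSeries (α + 1) q = 1 := by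
  set W : ℝ → ℂ := fun q => macdonald 1 q (-(α + 1)) * besselSeries α q +
      q * macdonald 1 q (-α) * besselSeries (α + 1) q with hW
  have hd : ∀ t ∈ Ioi (0 : ℝ), HasDerivAt W 0 t := by
    intro t ht
    have ht0 : (0 : ℝ) < t := ht
    have hid : HasDerivAt (fun t : ℝ => (t : ℂ)) 1 t := by
      simpa using (hasDerivAt_id t).ofReal_comp
    have h1 := ((hasDerivAt_macdonald_one ht0 (-(α + 1))).mul (hasDerivAt_besselSeries_real α t)).add
      ((hid.mul (hasDerivAt_macdonald_one ht0 (-α))).mul (hasDerivAt_besselSeries_real (α + 1) t))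
    refine h1.congr_deriv ?_
    have r1 := macdonald_recurrence ht0 (-α)
    have r2 := besselSeries_recurrence (α + 1) t
    rw [add_sub_cancel_right] at r2
    rw [show -α - 1 = -(α + 1) by ring] at r1
    rw [show -(α + 1) + 1 = -α by ring, r2]
    simp only [Pi.mul_apply]
    linear_combination (-besselSeries (α + 1) t) * r1
  have hconst : ∀ t ∈ Ioi (0 : ℝ), W t = W q := fun t ht =>
    (convex_Ioi (0 : ℝ)).is_const_of_fderivWithin_eq_zero (𝕜 := ℝ)
      (fun x hx => (hd x hx).differentiableAt.differentiableWithinAt)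
      (fun x hx => by
        rw [fderivWithin_of_isOpen isOpen_Ioi hx]
        ext; simp [(hd x hx).deriv]) ht hq
  have hlim : Tendsto W (𝓝[>] 0) (𝓝 (Complex.Gamma (α + 1) * besselSeries α 0 +
      0 * besselSeries (α + 1) 0)) := by
    have hb : ∀ β, Tendsto (fun q : ℝ => besselSeries β q) (𝓝[>] 0) (𝓝 (besselSeries β 0)) := by
      intro β
      have := ((continuous_besselSeries β).comp Complex.continuous_ofReal).tendsto 0
      simp only [Function.comp_apply, Complex.ofReal_zero] at this
      exact this.mono_left nhdsWithin_le_nhds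
    exact ((tendsto_macdonald_neg (by simp; linarith)).mul (hb α)).add
      ((tendsto_mul_macdonald_neg hα).mul (hb (α + 1)))
  have hlim2 : Tendsto W (𝓝[>] 0) (𝓝 (W q)) :=
    tendsto_const_nhds.congr' (by
      filter_upwards [self_mem_nhdsWithin] with t ht using (hconst t ht).symm)
  change W q = 1
  rw [tendsto_nhds_unique hlim2 hlim, besselSeries_zero_right, zero_mul, add_zero,
    mul_inv_cancel₀ (Complex.Gamma_ne_zero_of_re_pos (by simp; linarith))]

/-- The Wronskian of the two Bessel series of parameters `±α`; the value at `z = 0` is given by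
Euler's reflection formula. -/
theorem besselSeries_wronskian (α z : ℂ) :
    besselSeries (-α - 1) z * besselSeries α z - z * besselSeries (α + 1) z * besselSeries (-α) z =
      -(Complex.sin (Real.pi * α) / Real.pi) := by
  set W : ℂ → ℂ := fun z => besselSeries (-α - 1) z * besselSeries α z -
    z * besselSeries (α + 1) z * besselSeries (-α) z with hW
  have hd : ∀ z, HasDerivAt W 0 z := by
    intro z
    have h1 := ((hasDerivAt_besselSeries (-α - 1) z).mul (hasDerivAt_besselSeries α z)).sub
      (((hasDerivAt_id z).mul (hasDerivAt_besselSeries (α + 1) z)).mul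
        (hasDerivAt_besselSeries (-α) z))
    refine h1.congr_deriv ?_
    have r1 := besselSeries_recurrence (α + 1) z
    have r2 := besselSeries_recurrence (-α) z
    rw [add_sub_cancel_right] at r1
    rw [sub_add_cancel, r1, r2]
    simp only [Pi.mul_apply, id_eq]
    ring
  have hc := is_const_of_deriv_eq_zero (fun z => (hd z).differentiableAt) (fun z => (hd z).deriv) z 0
  change W z = _
  rw [hc, hW]
  simp only [zero_mul, sub_zero, besselSeries_zero_right]
  rw [sub_add_cancel, ← mul_inv]
  have := Complex.Gamma_mul_Gamma_one_sub (-α)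
  rw [sub_neg_eq_add, add_comm 1 α] at this
  rw [this, inv_div, mul_neg, Complex.sin_neg, neg_div]

/-- The Macdonald integral through Bessel series, by solving the linear relations that the Wronskian
identities give. -/
theorem macdonald_one_eq {α : ℂ} (h1 : -1 < α.re) (h2 : α.re < 1)
    (hs : Complex.sin (Real.pi * α) ≠ 0) {q : ℝ} (hq : 0 < q) :
    macdonald 1 q α = Real.pi / Complex.sin (Real.pi * α) *
      ((q : ℂ) ^ (-α) * besselSeries (-α) q - besselSeries α q) := by
  have hqc : (q : ℂ) ≠ 0 := by exact_mod_cast hq.ne'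
  have w1 := macdonald_wronskian h1 hq
  have w2 := macdonald_wronskian (α := -α) (by simp; linarith) hq
  have w3 := besselSeries_wronskian α q
  have r1 := macdonald_recurrence hq (-α)
  have r2 := besselSeries_recurrence (-α) q
  have e1 := macdonald_one_neg hq α
  have e2 := macdonald_one_neg hq (α - 1)
  have hpi : (Real.pi : ℂ) ≠ 0 := by exact_mod_cast Real.pi_ne_zero
  have hpow : (q : ℂ) ^ α ≠ 0 := by simp [hqc]
  rw [show -(α - 1) = -α + 1 by ring, Complex.cpow_sub _ _ hqc, Complex.cpow_one] at e2
  rw [neg_neg, show -(-α + 1) = α - 1 by ring] at w2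
  rw [show -(α + 1) = -α - 1 by ring] at w1
  rw [Complex.cpow_neg]
  set P := (q : ℂ) ^ α
  set gm := macdonald 1 q (α - 1)
  set g := macdonald 1 q α
  set h := macdonald 1 q (-α)
  set h' := macdonald 1 q (-α - 1)
  set hm := macdonald 1 q (-α + 1)
  -- eliminate the neighbours of `g` from the two Wronskians of Macdonald integral and series
  have e2' : q * hm = P * gm := by rw [e2]; field_simp
  have key : P * g * -(Complex.sin (Real.pi * α) / Real.pi) =
      P * besselSeries α q - besselSeries (-α) q := by
    rw [← w3]
    linear_combination (-besselSeries (-α - 1) q * besselSeries α q +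
        q * besselSeries (α + 1) q * besselSeries (-α) q) * e1 +
      besselSeries α q * (h * r2 - besselSeries (-α) q * r1 + besselSeries (-α) q * e2' +
        q * besselSeries (-α + 1) q * e1 + P * w2) - besselSeries (-α) q * w1
  field_simp at key ⊢
  linear_combination -key

end BesselFunctions

open Set (Ioi)

/-! ### Macdonald integrals with complex arguments -/

/-- The identity theorem in the right half plane, for functions that agree on the positive reals. -/
theorem eq_of_eq_on_pos_reals {F G : ℂ → ℂ} (hF : DifferentiableOn ℂ F {z | 0 < z.re})
    (hG : DifferentiableOn ℂ G {z | 0 < z.re}) (h : ∀ x : ℝ, 0 < x → F x = G x) {z : ℂ}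
    (hz : 0 < z.re) : F z = G z := by
  have ho : IsOpen {z : ℂ | 0 < z.re} := isOpen_lt continuous_const Complex.continuous_re
  refine (hF.analyticOnNhd ho).eqOn_of_preconnected_of_frequently_eq (hG.analyticOnNhd ho)
    (convex_halfSpace_re_gt 0).isPreconnected (z₀ := 1) (by simp) ?_ hz
  have hlim : Tendsto (fun k : ℕ => (1 + 1 / ((k : ℂ) + 1))) atTop (𝓝[≠] 1) := by
    refine tendsto_nhdsWithin_iff.2 ⟨?_, Eventually.of_forall fun k => ?_⟩
    · simpa using (tendsto_one_div_add_atTop_nhds_zero_nat (𝕜 := ℂ)).const_add 1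
    · simpa using (by exact_mod_cast Nat.succ_ne_zero k : ((k : ℂ) + 1) ≠ 0)
  refine hlim.frequently (Eventually.of_forall fun k => ?_).frequently
  have := h (1 + 1 / ((k : ℝ) + 1)) (by positivity)
  push_cast at this
  exact this

theorem sin_pi_mul_ne_zero {α : ℂ} (h0 : 0 < α.re) (h1 : α.re < 1) :
    Complex.sin (Real.pi * α) ≠ 0 := by
  intro h
  obtain ⟨k, hk⟩ := Complex.sin_eq_zero_iff.1 h
  have h2 : α = k := by
    have : (Real.pi : ℂ) ≠ 0 := by exact_mod_cast Real.pi_ne_zero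
    apply mul_left_cancel₀ this
    rw [hk]; ring
  rw [h2, Complex.intCast_re] at h0 h1
  have a1 : 0 < k := by exact_mod_cast h0
  have a2 : k < 1 := by exact_mod_cast h1
  omega

/-- The Macdonald integral through Bessel series, for complex `p` and `q`, by analytic continuation
in one variable after the other. -/
theorem macdonald_eq {α : ℂ} (h0 : 0 < α.re) (h1 : α.re < 1) {p q : ℂ} (hp : 0 < p.re)
    (hq : 0 < q.re) :
    macdonald p q α = Real.pi / Complex.sin (Real.pi * α) *
      (q ^ (-α) * besselSeries (-α) (p * q) - p ^ α * besselSeries α (p * q)) := by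
  have hs := sin_pi_mul_ne_zero h0 h1
  have hE : ∀ α, Differentiable ℂ (besselSeries α) := fun α z =>
    (hasDerivAt_besselSeries α z).differentiableAt
  have hcp : ∀ α : ℂ, DifferentiableOn ℂ (fun z : ℂ => z ^ α) {z | 0 < z.re} := fun α z hz =>
    (differentiableAt_id.cpow_const (Or.inl hz)).differentiableWithinAt
  -- both variables real
  have real_real : ∀ p q : ℝ, 0 < p → 0 < q → macdonald p q α =
      Real.pi / Complex.sin (Real.pi * α) *
      ((q : ℂ) ^ (-α) * besselSeries (-α) (p * q) - (p : ℂ) ^ α * besselSeries α (p * q)) := by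
    intro p q hp hq
    have hpc : (p : ℂ) ≠ 0 := by exact_mod_cast hp.ne'
    have h := macdonald_scale 1 ((p * q : ℝ) : ℂ) α hp
    rw [mul_one, show ((p * q : ℝ) : ℂ) / p = q by push_cast; field_simp,
      macdonald_one_eq (by linarith) h1 hs (mul_pos hp hq)] at h
    rw [h, Complex.ofReal_mul, Complex.mul_cpow_ofReal_nonneg hp.le hq.le, Complex.cpow_neg (p : ℂ)]
    have : (p : ℂ) ^ α ≠ 0 := by simp [hpc]
    field_simp
  -- first variable complex
  have cplx_real : ∀ (p : ℂ) (q : ℝ), 0 < p.re → 0 < q → macdonald p q α =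
      Real.pi / Complex.sin (Real.pi * α) *
      ((q : ℂ) ^ (-α) * besselSeries (-α) (p * q) - p ^ α * besselSeries α (p * q)) := by
    intro p q hp hq
    refine eq_of_eq_on_pos_reals (F := fun p => macdonald p q α) (G := fun p =>
      Real.pi / Complex.sin (Real.pi * α) *
      ((q : ℂ) ^ (-α) * besselSeries (-α) (p * q) - p ^ α * besselSeries α (p * q))) ?_ ?_
      (fun x hx => real_real x q hx hq) hp
    · intro p hp
      simp only [macdonald_swap _ (q : ℂ)]
      exact (hasDerivAt_macdonald (p := q) (by simpa using hq) hp
        (-α)).differentiableAt.differentiableWithinAt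
    · have hm : Differentiable ℂ fun p : ℂ => p * q := by fun_prop
      exact (((((hE _).comp hm).const_mul _).differentiableOn).sub
        ((hcp α).mul ((hE _).comp hm).differentiableOn)).const_mul _
  refine eq_of_eq_on_pos_reals (F := fun q => macdonald p q α) (G := fun q =>
    Real.pi / Complex.sin (Real.pi * α) *
    (q ^ (-α) * besselSeries (-α) (p * q) - p ^ α * besselSeries α (p * q))) ?_ ?_
    (fun x hx => cplx_real p x hp hx) hq
  · intro q hq
    exact (hasDerivAt_macdonald hp hq α).differentiableAt.differentiableWithinAt
  · have hm : Differentiable ℂ fun q : ℂ => p * q := by fun_prop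
    exact (((hcp (-α)).mul ((hE _).comp hm).differentiableOn).sub
      (((hE _).comp hm).const_mul _).differentiableOn).const_mul _

/-- The part of the Macdonald integral over `t > 1`. -/
def macdonaldTail (p q α : ℂ) : ℂ :=
  ∫ t in Ioi (1 : ℝ), Complex.exp (-(p * t) - q / t) * (t : ℂ) ^ (-α - 1)

/-- Splitting the integral at `t = 1` and inverting the part near `0`. -/
theorem macdonald_eq_tail_add {p q : ℂ} (hp : 0 < p.re) (hq : 0 < q.re) (α : ℂ) :
    macdonald p q α = macdonaldTail p q α + macdonaldTail q p (-α) := by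
  have hint := integrableOn_macdonald hp hq α
  have h1 : macdonald p q α = (∫ t in Set.Ioo (0 : ℝ) 1,
      Complex.exp (-(p * t) - q / t) * (t : ℂ) ^ (-α - 1)) + macdonaldTail p q α := by
    rw [macdonald, macdonaldTail, ← integral_Ioc_eq_integral_Ioo,
      ← setIntegral_union (Set.Ioc_disjoint_Ioi le_rfl) measurableSet_Ioi
      (hint.mono_set Set.Ioc_subset_Ioi_self) (hint.mono_set (Set.Ioi_subset_Ioi zero_le_one)),
      Set.Ioc_union_Ioi_eq_Ioi zero_le_one]
  rw [h1, add_comm]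
  congr 1
  have h2 : (∫ t in Set.Ioo (0 : ℝ) 1, Complex.exp (-(p * t) - q / t) * (t : ℂ) ^ (-α - 1)) =
      ∫ t in Ioi (0 : ℝ), (Set.Iio (1 : ℝ)).indicator
        (fun t : ℝ => Complex.exp (-(p * t) - q / t) * (t : ℂ) ^ (-α - 1)) t := by
    rw [setIntegral_indicator measurableSet_Iio]; rfl
  have h3 : macdonaldTail q p (-α) = ∫ t in Ioi (0 : ℝ), (Set.Ioi (1 : ℝ)).indicator
        (fun t : ℝ => Complex.exp (-(q * t) - p / t) * (t : ℂ) ^ (-(-α) - 1)) t := by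
    rw [setIntegral_indicator measurableSet_Ioi, Set.inter_eq_right.2
      (Set.Ioi_subset_Ioi zero_le_one)]; rfl
  rw [h2, h3, ← integral_comp_rpow_Ioi _ (by norm_num : (-1 : ℝ) ≠ 0)]
  refine setIntegral_congr_fun measurableSet_Ioi fun t ht => ?_
  have ht0 : (0 : ℝ) < t := ht
  have htc : (t : ℂ) ≠ 0 := by exact_mod_cast ht0.ne'
  simp only [Real.rpow_neg_one, Complex.real_smul]
  by_cases ht1 : 1 < t
  · rw [Set.indicator_of_mem (show t⁻¹ ∈ Set.Iio (1 : ℝ) from inv_lt_one_of_one_lt₀ ht1),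
      Set.indicator_of_mem (show t ∈ Set.Ioi (1 : ℝ) from ht1)]
    rw [show |(-1 : ℝ)| * t ^ ((-1 : ℝ) - 1) = (t⁻¹) ^ 2 by
      rw [abs_neg, abs_one, one_mul, show (-1 : ℝ) - 1 = -((2 : ℕ) : ℝ) by norm_num,
        Real.rpow_neg ht0.le, Real.rpow_natCast, inv_pow]]
    have h1 : ((t⁻¹ : ℝ) : ℂ) ^ (-α - 1) = (t : ℂ) ^ (- -α + 1) := by
      rw [ofReal_cpow_eq_exp (inv_pos.2 ht0), ofReal_cpow_eq_exp ht0, Real.log_inv]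
      push_cast; congr 1; ring
    rw [h1, show - -α + 1 = (- -α - 1) + (2 : ℕ) by push_cast; ring, Complex.cpow_add _ _ htc,
      Complex.cpow_natCast]
    have h2 : -(p * ((t⁻¹ : ℝ) : ℂ)) - q / ((t⁻¹ : ℝ) : ℂ) = -(q * t) - p / t := by
      push_cast; field_simp; ring
    rw [h2]
    push_cast
    field_simp
  · rw [Set.indicator_of_notMem, Set.indicator_of_notMem (by simpa using ht1), mul_zero]
    simp only [Set.mem_Iio, not_lt]
    exact (one_le_inv₀ ht0).2 (not_lt.1 ht1)

theorem norm_one_sub_exp_neg_le {z : ℂ} (hz : 0 ≤ z.re) {κ : ℝ} (h0 : 0 ≤ κ) (h1 : κ ≤ 1) :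
    ‖1 - Complex.exp (-z)‖ ≤ 2 * ‖z‖ ^ κ := by
  rcases le_total ‖z‖ 1 with h | h
  · have h2 := Complex.norm_exp_sub_one_le (x := -z) (by rwa [norm_neg])
    rw [norm_neg, norm_sub_rev] at h2
    refine h2.trans ?_
    gcongr
    calc ‖z‖ = ‖z‖ ^ (1 : ℝ) := (Real.rpow_one _).symm
      _ ≤ ‖z‖ ^ κ := Real.rpow_le_rpow_of_exponent_ge_of_imp (norm_nonneg _) h h1 (by
          intro _ h; linarith)
  · have h2 : ‖Complex.exp (-z)‖ ≤ 1 := by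
      rw [Complex.norm_exp, Complex.neg_re, Real.exp_le_one_iff]; linarith
    have h3 := norm_sub_le 1 (Complex.exp (-z))
    rw [norm_one] at h3
    have := Real.one_le_rpow h h0
    linarith

/-- A bound for the tail that depends on `|p|` and `|q|` only, hence stays finite as `p` and `q`
approach the imaginary axis. It comes from one integration by parts in the oscillating factor
`exp (-p t)`. -/
theorem norm_macdonaldTail_le {σ κ : ℝ} (hσκ : σ < κ) (hκ : κ ≤ 1) (hσ0 : 0 ≤ σ) (R : ℝ) :
    ∃ C, 0 ≤ C ∧ ∀ α p q : ℂ, |α.re| ≤ σ → ‖α‖ ≤ R → 0 < p.re → 0 < q.re →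
      ‖macdonaldTail p q α‖ ≤ C * ((1 + ‖q‖) * ‖p‖ ^ (-κ)) := by
  set D := κ - σ with hD
  have hD0 : 0 < D := by rw [hD]; linarith
  refine ⟨2 * (2 + |R|) * (1 + 1 / D), by positivity, fun α p q hα hR hp hq => ?_⟩
  have hp0 : p ≠ 0 := by rintro rfl; simp at hp
  have hpn : 0 < ‖p‖ := norm_pos_iff.2 hp0
  set h : ℝ → ℂ := fun t => Complex.exp (-(q / t)) * (t : ℂ) ^ (-α - 1) with hh
  -- this primitive of `exp (-p t)` vanishes at `0`, so it is small for small `p t`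
  set P : ℝ → ℂ := fun t => (1 - Complex.exp (-(p * t))) / p with hP
  set h' : ℝ → ℂ := fun t => (q / t ^ 2 - (α + 1) / t) * h t with hh'
  have hint := integrableOn_macdonald hp hq α
  have hcontE : ContinuousOn (fun t : ℝ => (t : ℂ)) (Ioi 0) :=
    Complex.continuous_ofReal.continuousOn
  have hne : ∀ t ∈ Ioi (0 : ℝ), (t : ℂ) ≠ 0 := fun t ht => by
    exact_mod_cast (ne_of_gt ht : t ≠ 0)
  have hderiv_h : ∀ t ∈ Ioi (0 : ℝ), HasDerivAt h (h' t) t := by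
    intro t ht
    have htc := hne t ht
    have a1 : HasDerivAt (fun t : ℂ => -(q / t)) (q / (t : ℂ) ^ 2) t := by
      have := ((hasDerivAt_inv htc).const_mul q).neg
      refine this.congr_deriv ?_
      ring
    have a2 : HasDerivAt (fun t : ℂ => t ^ (-α - 1)) ((-α - 1) * (t : ℂ) ^ (-α - 1 - 1)) t := by
      simpa using (hasDerivAt_id (t : ℂ)).cpow_const (c := -α - 1)
        (Complex.ofReal_mem_slitPlane.2 ht)
    have a3 := (a1.cexp.mul a2).comp_ofReal
    refine a3.congr_deriv ?_
    simp only [hh', hh]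
    rw [Complex.cpow_sub (-α - 1) 1 htc, Complex.cpow_one]
    field_simp
    ring
  have hderiv_P : ∀ t : ℝ, HasDerivAt P (Complex.exp (-(p * t))) t := by
    intro t
    have a1 : HasDerivAt (fun t : ℂ => -(p * t)) (-(p * 1)) t :=
      ((hasDerivAt_id (t : ℂ)).const_mul p).neg
    have a3 := ((a1.cexp.const_sub 1).div_const p).comp_ofReal
    refine a3.congr_deriv ?_
    field_simp
  have hnorm_h : ∀ t : ℝ, 1 ≤ t → ‖h t‖ ≤ t ^ (σ - 1) := by
    intro t ht
    have ht0 : 0 < t := by linarith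
    simp only [hh]
    rw [norm_mul, Complex.norm_exp, Complex.norm_cpow_eq_rpow_re_of_pos ht0]
    have b1 : Real.exp (-(q / t)).re ≤ 1 := by
      rw [Real.exp_le_one_iff, Complex.neg_re, Complex.div_ofReal_re]
      have : 0 < q.re / t := by positivity
      linarith
    have b2 : t ^ (-α - 1).re ≤ t ^ (σ - 1) := by
      refine Real.rpow_le_rpow_of_exponent_le ht ?_
      simp only [Complex.sub_re, Complex.neg_re, Complex.one_re]
      linarith [neg_le_abs α.re]
    calc _ ≤ 1 * t ^ (σ - 1) := by gcongr
      _ = _ := one_mul _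
  have hnorm_P : ∀ t : ℝ, 1 ≤ t → ‖P t‖ ≤ 2 * ‖p‖ ^ (-κ) * t ^ (1 - κ) := by
    intro t ht
    have ht0 : 0 < t := by linarith
    simp only [hP]
    rw [norm_div, div_le_iff₀ hpn]
    have b1 := norm_one_sub_exp_neg_le (z := p * t) (by simp; positivity)
      (κ := 1 - κ) (by linarith) (by linarith)
    rw [norm_mul, Complex.norm_real, Real.norm_of_nonneg ht0.le,
      Real.mul_rpow hpn.le ht0.le] at b1
    refine b1.trans (le_of_eq ?_)
    rw [sub_eq_add_neg, Real.rpow_add hpn, Real.rpow_one]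
    ring
  have hB0 : 0 ≤ ‖p‖ ^ (-κ) := by positivity
  have hPh : ∀ t : ℝ, 1 ≤ t → ‖P t * h t‖ ≤ 2 * ‖p‖ ^ (-κ) * t ^ (-D) := by
    intro t ht
    have ht0 : 0 < t := by linarith
    rw [norm_mul]
    calc ‖P t‖ * ‖h t‖ ≤ (2 * ‖p‖ ^ (-κ) * t ^ (1 - κ)) * t ^ (σ - 1) := by
          gcongr
          · exact hnorm_P t ht
          · exact hnorm_h t ht
      _ = _ := by
          rw [mul_assoc, ← Real.rpow_add ht0]
          congr 2; rw [hD]; ring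
  have hnorm_Ph' : ∀ t : ℝ, 1 ≤ t →
      ‖P t * h' t‖ ≤ (‖q‖ + |R| + 1) * (2 * ‖p‖ ^ (-κ)) * t ^ (-D - 1) := by
    intro t ht
    have ht0 : 0 < t := by linarith
    have b1 : ‖(q / (t : ℂ) ^ 2 - (α + 1) / t : ℂ)‖ ≤ (‖q‖ + |R| + 1) * t⁻¹ := by
      refine (norm_sub_le _ _).trans ?_
      rw [norm_div, norm_div, norm_pow, Complex.norm_real, Real.norm_of_nonneg ht0.le]
      have b2 : ‖α + 1‖ ≤ |R| + 1 := (norm_add_le _ _).trans (by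
        rw [norm_one]; linarith [le_abs_self R])
      have b3 : ‖q‖ / t ^ 2 ≤ ‖q‖ / t := by
        gcongr
        nlinarith
      have b4 : ‖α + 1‖ / t ≤ (|R| + 1) / t := by gcongr
      calc _ ≤ ‖q‖ / t + (|R| + 1) / t := add_le_add b3 b4
        _ = _ := by ring
    have e1 : P t * h' t = (q / (t : ℂ) ^ 2 - (α + 1) / t) * (P t * h t) := by
      simp only [hh']; ring
    rw [e1, norm_mul, Real.rpow_sub_one ht0.ne']
    calc _ ≤ ((‖q‖ + |R| + 1) * t⁻¹) * (2 * ‖p‖ ^ (-κ) * t ^ (-D)) := by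
          gcongr
          exact hPh t ht
      _ = _ := by ring
  have hmaj : IntegrableOn (fun t : ℝ => (‖q‖ + |R| + 1) * (2 * ‖p‖ ^ (-κ)) * t ^ (-D - 1))
      (Ioi 1) := (integrableOn_Ioi_rpow_of_lt (by linarith) zero_lt_one).const_mul _
  have hcont_h : ContinuousOn h (Ioi 0) := fun t ht =>
    (hderiv_h t ht).continuousAt.continuousWithinAt
  have hcont_P : Continuous P := continuous_iff_continuousAt.2 fun t => (hderiv_P t).continuousAt
  have hsub : Ioi (1 : ℝ) ⊆ Ioi 0 := Set.Ioi_subset_Ioi zero_le_one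
  have hcont_h' : ContinuousOn h' (Ioi 0) := by
    refine ContinuousOn.mul (ContinuousOn.sub ?_ ?_) hcont_h
    · exact continuousOn_const.div (hcontE.pow 2) fun t ht => pow_ne_zero 2 (hne t ht)
    · exact continuousOn_const.div hcontE hne
  have hbound : ∀ᵐ t ∂(volume.restrict (Ioi (1 : ℝ))), ‖P t * h' t‖ ≤
      (‖q‖ + |R| + 1) * (2 * ‖p‖ ^ (-κ)) * t ^ (-D - 1) :=
    (ae_restrict_iff' measurableSet_Ioi).2 (Eventually.of_forall fun t ht =>
      hnorm_Ph' t (le_of_lt ht))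
  have hint2 : IntegrableOn (fun t => P t * h' t) (Ioi 1) :=
    hmaj.mono' ((hcont_P.continuousOn.mul (hcont_h'.mono hsub)).aestronglyMeasurable
      measurableSet_Ioi) hbound
  have hsplit : ∀ t : ℝ, Complex.exp (-(p * t) - q / t) * (t : ℂ) ^ (-α - 1) =
      Complex.exp (-(p * t)) * h t := by
    intro t
    simp only [hh]
    rw [sub_eq_add_neg, Complex.exp_add, mul_assoc]
  have hint1 : IntegrableOn (fun t : ℝ => Complex.exp (-(p * t)) * h t) (Ioi 1) := by
    have := hint.mono_set hsub
    simpa only [hsplit] using this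
  have hlim : Tendsto (fun t => P t * h t) atTop (𝓝 0) := by
    have a1 : Tendsto (fun t : ℝ => 2 * ‖p‖ ^ (-κ) * t ^ (-D)) atTop
        (𝓝 (2 * ‖p‖ ^ (-κ) * 0)) := (tendsto_rpow_neg_atTop hD0).const_mul _
    rw [mul_zero] at a1
    refine squeeze_zero_norm' ?_ a1
    filter_upwards [eventually_ge_atTop 1] with t ht using hPh t ht
  have key := integral_Ioi_of_hasDerivAt_of_tendsto (a := (1 : ℝ))
    (f := fun t => P t * h t) (f' := fun t => Complex.exp (-(p * t)) * h t + P t * h' t)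
    ((hcont_P.continuousAt.mul (hcont_h.continuousAt
      (isOpen_Ioi.mem_nhds (by simp)))).continuousWithinAt)
    (fun t ht => (hderiv_P t).mul (hderiv_h t (hsub ht))) (hint1.add hint2) hlim
  rw [integral_add hint1 hint2] at key
  have h4 : macdonaldTail p q α = -(P 1 * h 1) - ∫ t in Ioi (1 : ℝ), P t * h' t := by
    have : macdonaldTail p q α = ∫ t in Ioi (1 : ℝ), Complex.exp (-(p * t)) * h t := by
      simp only [macdonaldTail, hsplit]
    rw [this]
    linear_combination key
  have h5 : ‖∫ t in Ioi (1 : ℝ), P t * h' t‖ ≤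
      (‖q‖ + |R| + 1) * (2 * ‖p‖ ^ (-κ)) * (1 / D) := by
    refine (norm_integral_le_of_norm_le hmaj hbound).trans (le_of_eq ?_)
    rw [integral_const_mul, integral_Ioi_rpow_of_lt (by linarith) zero_lt_one]
    simp
  have h6 := hPh 1 le_rfl
  rw [Real.one_rpow, mul_one] at h6
  rw [h4]
  refine (norm_sub_le _ _).trans ?_
  rw [norm_neg]
  refine (add_le_add h6 h5).trans ?_
  have hq0 := norm_nonneg q
  have hR0 := abs_nonneg R
  have hD1 : 0 < 1 / D := by positivity
  have c1 : 1 ≤ (2 + |R|) * (1 + ‖q‖) := by nlinarith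
  have c2 : ‖q‖ + |R| + 1 ≤ (2 + |R|) * (1 + ‖q‖) := by nlinarith
  calc 2 * ‖p‖ ^ (-κ) + (‖q‖ + |R| + 1) * (2 * ‖p‖ ^ (-κ)) * (1 / D)
      = 2 * ‖p‖ ^ (-κ) * (1 + (‖q‖ + |R| + 1) * (1 / D)) := by ring
    _ ≤ 2 * ‖p‖ ^ (-κ) * ((2 + |R|) * (1 + ‖q‖) + ((2 + |R|) * (1 + ‖q‖)) * (1 / D)) := by
        gcongr
    _ = _ := by ring

/-- A bound for the Macdonald integral that is uniform up to the imaginary axis. -/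
theorem norm_macdonald_le {σ κ : ℝ} (hσκ : σ < κ) (hκ : κ ≤ 1) (hσ0 : 0 ≤ σ) (R : ℝ) :
    ∃ C, 0 ≤ C ∧ ∀ α p q : ℂ, |α.re| ≤ σ → ‖α‖ ≤ R → 0 < p.re → 0 < q.re →
      ‖macdonald p q α‖ ≤ C * ((1 + ‖q‖) * ‖p‖ ^ (-κ) + (1 + ‖p‖) * ‖q‖ ^ (-κ)) := by
  obtain ⟨C, hC0, hC⟩ := norm_macdonaldTail_le hσκ hκ hσ0 R
  refine ⟨C, hC0, fun α p q hα hR hp hq => ?_⟩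
  rw [macdonald_eq_tail_add hp hq, mul_add]
  refine (norm_add_le _ _).trans (add_le_add (hC α p q hα hR hp hq) (hC (-α) q p ?_ ?_ hq hp))
  · rwa [Complex.neg_re, abs_neg]
  · rwa [norm_neg]

/-! ### The regularized kernel and bounds for `j_ν` -/

/-- The principal powers of `ir` and `-ir` are `|r| ^ β exp (±iπβ/2)`, in one order or the other,
and add up to a cosine. -/
theorem cpow_add_cpow_neg_imaginary {r : ℝ} (hr : r ≠ 0) (β : ℂ) :
    (Complex.I * r) ^ β + (-(Complex.I * r)) ^ β =
      2 * Complex.cos (Real.pi * β / 2) * ((|r| : ℝ) : ℂ) ^ β := by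
  wlog h : 0 < r generalizing r
  · have h' : 0 < -r := by
      rcases lt_or_gt_of_ne hr with h1 | h1
      · linarith
      · exact absurd h1 h
    have := this (r := -r) (by linarith) h'
    rw [abs_neg] at this
    rw [← this]
    push_cast
    rw [mul_neg, neg_neg, add_comm]
  · have hrc : (r : ℂ) ≠ 0 := by exact_mod_cast hr
    have hI : Complex.I ≠ 0 := Complex.I_ne_zero
    rw [abs_of_pos h, ofReal_cpow_eq_exp h, show -(Complex.I * (r : ℂ)) = r * (-Complex.I) by ring,
      mul_comm Complex.I, Complex.cpow_def_of_ne_zero (mul_ne_zero hrc hI),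
      Complex.cpow_def_of_ne_zero (mul_ne_zero hrc (neg_ne_zero.2 hI)),
      Complex.log_ofReal_mul h hI, Complex.log_ofReal_mul h (neg_ne_zero.2 hI), Complex.log_I,
      Complex.log_neg_I, Complex.two_cos, add_mul, add_mul, Complex.exp_add, Complex.exp_add,
      add_mul]
    have e1 : (Real.pi : ℂ) / 2 * Complex.I * β = Real.pi * β / 2 * Complex.I := by ring
    have e2 : -(Real.pi / 2 : ℂ) * Complex.I * β = -(Real.pi * β / 2) * Complex.I := by ring
    rw [e1, e2, mul_comm β]
    ring

/-- The kernel `∫ |x| ^ (-2μ - 1) e(-u x - l / x) exp (-ε (|x| + 1/|x|)) dx`, split into the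
Macdonald integrals over the two half lines, see `integral_bruhatWeight`. -/
def regKernel (μ : ℂ) (u l ε : ℝ) : ℂ :=
  macdonald (ε + 2 * Real.pi * Complex.I * u) (ε + 2 * Real.pi * Complex.I * l) (2 * μ) +
    macdonald (ε - 2 * Real.pi * Complex.I * u) (ε - 2 * Real.pi * Complex.I * l) (2 * μ)

/-- As the convergence factor is removed, the kernel tends to a power-weighted `j_μ`. The sum over
the two half lines supplies a factor `2 cos πμ`, which reduces the denominator `sin 2πμ` to
`sin πμ`. -/
theorem tendsto_regKernel {μ : ℂ} (h0 : 0 < μ.re) (h1 : μ.re < 1 / 2) {u l : ℝ} (hu : u ≠ 0)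
    (hl : l ≠ 0) :
    Tendsto (regKernel μ u l) (𝓝[>] 0) (𝓝 (besselKernel μ (u * l) *
      ((|u| : ℝ) : ℂ) ^ (μ - 1 / 2) * ((|l| : ℝ) : ℂ) ^ (-μ - 1 / 2))) := by
  set z : ℂ := ((-(4 * Real.pi ^ 2 * (u * l)) : ℝ) : ℂ) with hz
  have hpi := Real.pi_pos
  have hα0 : 0 < (2 * μ).re := by simpa using h0
  have hα1 : (2 * μ).re < 1 := by simp; linarith
  have hslit : ∀ r : ℝ, r ≠ 0 → 2 * Real.pi * Complex.I * r ∈ Complex.slitPlane ∧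
      -(2 * Real.pi * Complex.I * r) ∈ Complex.slitPlane := by
    intro r hr
    constructor <;> refine Complex.mem_slitPlane_iff.2 (Or.inr ?_) <;>
      simp [hr, hpi.ne']
  have hI2 : Complex.I ^ 2 = -1 := Complex.I_sq
  have hlim : ∀ p q : ℂ, p ∈ Complex.slitPlane → q ∈ Complex.slitPlane → 0 ≤ p.re → 0 ≤ q.re →
      p * q = z → Tendsto (fun ε : ℝ => macdonald (ε + p) (ε + q) (2 * μ)) (𝓝[>] 0)
        (𝓝 (Real.pi / Complex.sin (Real.pi * (2 * μ)) *
          (q ^ (-(2 * μ)) * besselSeries (-(2 * μ)) z -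
            p ^ (2 * μ) * besselSeries (2 * μ) z))) := by
    intro p q hp hq hp0 hq0 hpq
    have hadd : ∀ p : ℂ, Tendsto (fun ε : ℝ => (ε : ℂ) + p) (𝓝[>] 0) (𝓝 p) := by
      intro p
      have : Continuous fun ε : ℝ => (ε : ℂ) + p := by fun_prop
      have := this.tendsto 0
      simp only [Complex.ofReal_zero, zero_add] at this
      exact this.mono_left nhdsWithin_le_nhds
    have hE : ∀ α, Tendsto (fun ε : ℝ => besselSeries α ((ε + p) * (ε + q))) (𝓝[>] 0)
        (𝓝 (besselSeries α z)) := by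
      intro α
      have := ((continuous_besselSeries α).tendsto (p * q)).comp ((hadd p).mul (hadd q))
      rwa [hpq] at this
    refine (((((continuousAt_cpow_const hq).tendsto.comp (hadd q)).mul (hE _)).sub
      (((continuousAt_cpow_const hp).tendsto.comp (hadd p)).mul (hE _))).const_mul _).congr' ?_
    filter_upwards [self_mem_nhdsWithin] with ε hε
    have hε0 : (0 : ℝ) < ε := hε
    rw [macdonald_eq hα0 hα1 (by simp; linarith) (by simp; linarith)]
    rfl
  have hpq : (2 * Real.pi * Complex.I * u) * (2 * Real.pi * Complex.I * l) =
      ((-(4 * Real.pi ^ 2 * (u * l)) : ℝ) : ℂ) := by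
    push_cast
    linear_combination (4 * (Real.pi : ℂ) ^ 2 * u * l) * hI2
  have hA := hlim (2 * Real.pi * Complex.I * u) (2 * Real.pi * Complex.I * l) (hslit u hu).1
    (hslit l hl).1 (by simp) (by simp) (by rw [hz, ← hpq])
  have hB := hlim (-(2 * Real.pi * Complex.I * u)) (-(2 * Real.pi * Complex.I * l)) (hslit u hu).2
    (hslit l hl).2 (by simp) (by simp) (by rw [hz, ← hpq]; ring)
  have hsum := hA.add hB
  simp only [← sub_eq_add_neg] at hsum
  refine (hsum.congr fun ε => rfl).trans (le_of_eq ?_)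
  congr 1
  have hu' := abs_pos.2 hu
  have hl' := abs_pos.2 hl
  have hul : u * l ≠ 0 := mul_ne_zero hu hl
  have hre : |μ.re| < 1 / 2 := by rw [abs_of_pos h0]; exact h1
  have hμ0 : μ ≠ 0 := by rintro rfl; simp at h0
  have hs := sin_pi_mul_ne_zero hα0 hα1
  have hs2 : Complex.sin (Real.pi * (2 * μ)) =
      2 * Complex.sin (Real.pi * μ) * Complex.cos (Real.pi * μ) := by
    rw [← Complex.sin_two_mul]; congr 1; ring
  rw [hs2] at hs ⊢
  have hs0 : Complex.sin (Real.pi * μ) ≠ 0 := fun h => hs (by rw [h]; ring)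
  have hc0 : Complex.cos (Real.pi * μ) ≠ 0 := fun h => hs (by rw [h]; ring)
  have hsym : ∀ r : ℝ, r ≠ 0 → ∀ β : ℂ, (2 * Real.pi * Complex.I * r) ^ β +
      (-(2 * Real.pi * Complex.I * r)) ^ β =
      2 * Complex.cos (Real.pi * β / 2) * ((2 * Real.pi * |r| : ℝ) : ℂ) ^ β := by
    intro r hr β
    have := cpow_add_cpow_neg_imaginary (r := 2 * Real.pi * r) (by positivity) β
    rw [abs_mul, abs_of_pos (by positivity : 0 < 2 * Real.pi)] at this
    rw [← this]
    push_cast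
    congr 2 <;> ring
  have s1 := hsym l hl (-(2 * μ))
  have s2 := hsym u hu (2 * μ)
  rw [show (Real.pi : ℂ) * -(2 * μ) / 2 = -(Real.pi * μ) by ring, Complex.cos_neg] at s1
  rw [show (Real.pi : ℂ) * (2 * μ) / 2 = Real.pi * μ by ring] at s2
  have hX : 0 < 2 * Real.pi * √|u * l| := by
    have := Real.sqrt_pos.2 (abs_pos.2 hul)
    positivity
  have hlogX : Real.log (2 * Real.pi * √|u * l|) =
      Real.log (2 * Real.pi) + (Real.log |u| + Real.log |l|) / 2 := by
    rw [Real.log_mul (by positivity) (Real.sqrt_pos.2 (abs_pos.2 hul)).ne',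
      Real.log_sqrt (abs_nonneg _), abs_mul, Real.log_mul hu'.ne' hl'.ne']
  have hsqrt : ((√|u * l| : ℝ) : ℂ) =
      Complex.exp ((Real.log |u| + Real.log |l| : ℝ) / 2) := by
    rw [← Real.exp_log (Real.sqrt_pos.2 (abs_pos.2 hul)), Real.log_sqrt (abs_nonneg _), abs_mul,
      Real.log_mul hu'.ne' hl'.ne']
    push_cast; rfl
  have t1 : ((2 * Real.pi * |l| : ℝ) : ℂ) ^ (-(2 * μ)) = (√|u * l| : ℝ) *
      ((2 * Real.pi * √|u * l| : ℝ) : ℂ) ^ (-(2 * μ)) *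
      ((|u| : ℝ) : ℂ) ^ (μ - 1 / 2) * ((|l| : ℝ) : ℂ) ^ (-μ - 1 / 2) := by
    rw [ofReal_cpow_eq_exp (by positivity), ofReal_cpow_eq_exp hX, ofReal_cpow_eq_exp hu',
      ofReal_cpow_eq_exp hl', hlogX, hsqrt, Real.log_mul (by positivity) hl'.ne',
      ← Complex.exp_add, ← Complex.exp_add, ← Complex.exp_add]
    congr 1; push_cast; ring
  have t2 : ((2 * Real.pi * |u| : ℝ) : ℂ) ^ (2 * μ) = (√|u * l| : ℝ) *
      ((2 * Real.pi * √|u * l| : ℝ) : ℂ) ^ (2 * μ) *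
      ((|u| : ℝ) : ℂ) ^ (μ - 1 / 2) * ((|l| : ℝ) : ℂ) ^ (-μ - 1 / 2) := by
    rw [ofReal_cpow_eq_exp (by positivity), ofReal_cpow_eq_exp hX, ofReal_cpow_eq_exp hu',
      ofReal_cpow_eq_exp hl', hlogX, hsqrt, Real.log_mul (by positivity) hu'.ne',
      ← Complex.exp_add, ← Complex.exp_add, ← Complex.exp_add]
    congr 1; push_cast; ring
  rw [t1] at s1
  rw [t2] at s2
  rw [besselKernel_eq hre hμ0, besselQuotient_eq, besselNumer, ← hz]
  generalize (2 * Real.pi * Complex.I * l : ℂ) ^ (-(2 * μ)) = A₁ at s1 ⊢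
  generalize (-(2 * Real.pi * Complex.I * l) : ℂ) ^ (-(2 * μ)) = A₂ at s1 ⊢
  generalize (2 * Real.pi * Complex.I * u : ℂ) ^ (2 * μ) = B₁ at s2 ⊢
  generalize (-(2 * Real.pi * Complex.I * u) : ℂ) ^ (2 * μ) = B₂ at s2 ⊢
  generalize ((|u| : ℝ) : ℂ) ^ (μ - 1 / 2) = U at s1 s2 ⊢
  generalize ((|l| : ℝ) : ℂ) ^ (-μ - 1 / 2) = V at s1 s2 ⊢
  field_simp
  linear_combination besselSeries (-(2 * μ)) z * s1 - besselSeries (2 * μ) z * s2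

theorem norm_regKernel_le {σ κ : ℝ} (hσκ : 2 * σ < κ) (hκ : κ ≤ 1) (hσ0 : 0 ≤ σ) (R : ℝ) :
    ∃ C, 0 ≤ C ∧ ∀ μ : ℂ, |μ.re| ≤ σ → ‖μ‖ ≤ R → ∀ u l ε : ℝ, u ≠ 0 → l ≠ 0 → 0 < ε →
      ‖regKernel μ u l ε‖ ≤
        C * ((1 + ε + |l|) * |u| ^ (-κ) + (1 + ε + |u|) * |l| ^ (-κ)) := by
  obtain ⟨C, hC0, hC⟩ := norm_macdonald_le hσκ hκ (by linarith) (2 * R)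
  refine ⟨2 * (C * 7), by positivity, fun μ hμ hR u l ε hu hl hε => ?_⟩
  have hpi := Real.pi_gt_three
  have hpi4 := Real.pi_lt_d2
  have hα : |(2 * μ).re| ≤ 2 * σ := by
    simpa [abs_mul] using hμ
  have hαR : ‖2 * μ‖ ≤ 2 * R := by
    rw [norm_mul]; simpa using hR
  have hκ0 : 0 ≤ κ := by linarith
  have up : ∀ r : ℝ, r ≠ 0 → ∀ z : ℂ, ‖z‖ = 2 * Real.pi * |r| → z.re = 0 →
      1 + ‖(ε + z : ℂ)‖ ≤ 7 * (1 + ε + |r|) ∧ ‖(ε + z : ℂ)‖ ^ (-κ) ≤ |r| ^ (-κ) := by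
    intro r hr z hz hz0
    have hr' := abs_pos.2 hr
    have a1 := norm_add_le (ε : ℂ) z
    rw [Complex.norm_real, Real.norm_of_nonneg hε.le, hz] at a1
    refine ⟨by nlinarith, ?_⟩
    have him : |z.im| = 2 * Real.pi * |r| := by
      rw [← hz]
      exact (Complex.abs_im_eq_norm.2 hz0)
    have a2 := Complex.abs_im_le_norm (ε + z : ℂ)
    rw [Complex.add_im, Complex.ofReal_im, zero_add, him] at a2
    exact Real.rpow_le_rpow_of_nonpos hr' (by nlinarith) (by linarith)
  have one : ∀ p q : ℂ, ‖p‖ = 2 * Real.pi * |u| → p.re = 0 → ‖q‖ = 2 * Real.pi * |l| → q.re = 0 →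
      ‖macdonald (ε + p) (ε + q) (2 * μ)‖ ≤
        C * 7 * ((1 + ε + |l|) * |u| ^ (-κ) + (1 + ε + |u|) * |l| ^ (-κ)) := by
    intro p q hp hp0 hq hq0
    refine (hC (2 * μ) (ε + p) (ε + q) hα hαR (by simp [hp0, hε]) (by simp [hq0, hε])).trans ?_
    obtain ⟨b1, b2⟩ := up u hu p hp hp0
    obtain ⟨b3, b4⟩ := up l hl q hq hq0
    rw [mul_assoc, mul_add 7, ← mul_assoc 7, ← mul_assoc 7]
    gcongr
  rw [regKernel, show ∀ X : ℝ, 2 * (C * 7) * X = C * 7 * X + C * 7 * X from fun X => by ring]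
  refine (norm_add_le _ _).trans (add_le_add ?_ ?_)
  · exact one _ _ (norm_two_pi_I_mul u) (by simp) (norm_two_pi_I_mul l) (by simp)
  · rw [sub_eq_add_neg, sub_eq_add_neg]
    exact one _ _ (by rw [norm_neg, norm_two_pi_I_mul]) (by simp)
      (by rw [norm_neg, norm_two_pi_I_mul]) (by simp)

theorem besselKernel_neg {μ : ℂ} (hμ : |μ.re| < 1 / 2) (x : ℝ) :
    besselKernel (-μ) x = besselKernel μ x := by
  rcases eq_or_ne μ 0 with rfl | h
  · rw [neg_zero]
  · rw [besselKernel_eq hμ h, besselKernel_eq (by simpa using hμ) (neg_ne_zero.2 h),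
      besselQuotient_neg]

/-- Uniform bounds for `j_μ`, inherited from the regularized kernel at `|u| = |l| = √|x|`, then from
`Re μ > 0` to `Re μ = 0` by continuity and to `Re μ < 0` by symmetry. -/
theorem norm_besselKernel_le {σ κ : ℝ} (hσκ : 2 * σ < κ) (hκ : κ ≤ 1) (hσ0 : 0 ≤ σ) (R : ℝ) :
    ∃ C, 0 ≤ C ∧ ∀ μ : ℂ, |μ.re| ≤ σ → ‖μ‖ ≤ R → ∀ x : ℝ, x ≠ 0 →
      ‖besselKernel μ x‖ ≤ C * ((1 + |x| ^ (1 / 2 : ℝ)) * |x| ^ (1 / 2 - κ / 2)) := by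
  set τ := (σ + κ / 2) / 2 with hτ
  obtain ⟨C, hC0, hC⟩ := norm_regKernel_le (σ := τ) (κ := κ) (by linarith) hκ (by linarith) (R + 1)
  refine ⟨4 * C, by positivity, ?_⟩
  -- for positive real part, split `x = r l` with `r = |l| = √|x|`
  have pos : ∀ μ : ℂ, 0 < μ.re → μ.re ≤ τ → ‖μ‖ ≤ R + 1 → ∀ x : ℝ, x ≠ 0 →
      ‖besselKernel μ x‖ ≤ 4 * C * ((1 + |x| ^ (1 / 2 : ℝ)) * |x| ^ (1 / 2 - κ / 2)) := by
    intro μ h0 h1 hR x hx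
    have hx' := abs_pos.2 hx
    set r := |x| ^ (1 / 2 : ℝ) with hr
    have hr0 : 0 < r := Real.rpow_pos_of_pos hx' _
    have hrr : r * r = |x| := by
      rw [hr, ← Real.rpow_add hx']; norm_num
    set l := x / r with hl
    have hl0 : l ≠ 0 := div_ne_zero hx hr0.ne'
    have hlabs : |l| = r := by
      rw [hl, abs_div, abs_of_pos hr0, div_eq_iff hr0.ne', hrr]
    have hrl : r * l = x := by rw [hl]; field_simp
    have hlim := (tendsto_regKernel h0 (by linarith) hr0.ne' hl0).norm
    rw [hrl, hlabs, abs_of_pos hr0] at hlim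
    have hle : ‖besselKernel μ x * (r : ℂ) ^ (μ - 1 / 2) * (r : ℂ) ^ (-μ - 1 / 2)‖ ≤
        C * (4 * ((1 + r) * r ^ (-κ))) := by
      refine le_of_tendsto hlim ?_
      have hmem : Set.Ioo (0 : ℝ) r ∈ 𝓝[>] (0 : ℝ) := Ioo_mem_nhdsGT hr0
      filter_upwards [hmem] with ε hε
      have := hC μ (by rwa [abs_of_pos h0]) hR r l ε hr0.ne' hl0 hε.1
      rw [hlabs, abs_of_pos hr0] at this
      refine this.trans ?_
      have hrk : 0 < r ^ (-κ) := Real.rpow_pos_of_pos hr0 _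
      have hε2 := hε.2
      gcongr
      nlinarith
    rw [norm_mul, norm_mul, Complex.norm_cpow_eq_rpow_re_of_pos hr0,
      Complex.norm_cpow_eq_rpow_re_of_pos hr0, mul_assoc, ← Real.rpow_add hr0] at hle
    have e1 : (μ - 1 / 2).re + (-μ - 1 / 2).re = -1 := by simp; ring
    rw [e1, Real.rpow_neg_one] at hle
    have hle2 : ‖besselKernel μ x‖ ≤ C * (4 * ((1 + r) * r ^ (-κ))) * r := by
      rwa [← div_eq_mul_inv, div_le_iff₀ hr0] at hle
    refine hle2.trans (le_of_eq ?_)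
    have e2 : |x| ^ (1 / 2 - κ / 2) = r * r ^ (-κ) := by
      rw [hr, ← Real.rpow_mul hx'.le, ← Real.rpow_add hx']; congr 1; ring
    rw [e2]; ring
  -- vanishing real part, as a limit
  have nonneg : ∀ μ : ℂ, 0 ≤ μ.re → μ.re ≤ σ → ‖μ‖ ≤ R → ∀ x : ℝ, x ≠ 0 →
      ‖besselKernel μ x‖ ≤ 4 * C * ((1 + |x| ^ (1 / 2 : ℝ)) * |x| ^ (1 / 2 - κ / 2)) := by
    intro μ h0 h1 hR x hx
    have hμ : |μ.re| < 1 / 2 := by rw [abs_of_nonneg h0]; linarith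
    have hcont : ContinuousAt (fun ν => besselKernel ν x) μ :=
      ((differentiableOn_besselKernel x).differentiableAt (isOpen_strip.mem_nhds hμ)).continuousAt
    have hadd : Tendsto (fun ε : ℝ => μ + (ε : ℂ)) (𝓝[>] 0) (𝓝 μ) := by
      have : Continuous fun ε : ℝ => μ + (ε : ℂ) := by fun_prop
      have := this.tendsto 0
      simp only [Complex.ofReal_zero, add_zero] at this
      exact this.mono_left nhdsWithin_le_nhds
    refine le_of_tendsto (hcont.tendsto.comp hadd).norm ?_
    have hm : 0 < min 1 (τ - σ) := lt_min one_pos (by linarith)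
    filter_upwards [Ioo_mem_nhdsGT hm] with ε hε
    have hε1 := hε.2.trans_le (min_le_left _ _)
    have hε2 := hε.2.trans_le (min_le_right _ _)
    refine pos (μ + ε) (by simp; linarith [hε.1]) (by simp; linarith) ?_ x hx
    refine (norm_add_le _ _).trans ?_
    rw [Complex.norm_real, Real.norm_of_nonneg hε.1.le]
    linarith
  intro μ hμ hR x hx
  rcases le_total 0 μ.re with h | h
  · exact nonneg μ h (by rwa [abs_of_nonneg h] at hμ) hR x hx
  · rw [← besselKernel_neg (by linarith)]
    refine nonneg (-μ) (by simpa using h) ?_ (by rwa [norm_neg]) x hx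
    rw [abs_of_nonpos h] at hμ
    simpa using hμ

/-! ### Fourier inversion on the big Bruhat cell -/

theorem integrable_and_integral_eq_of_Ioi {g : ℝ → ℂ} (h1 : IntegrableOn g (Ioi 0))
    (h2 : IntegrableOn (fun x => g (-x)) (Ioi 0)) :
    Integrable g ∧ ∫ x, g x = (∫ x in Ioi (0 : ℝ), g x) + ∫ x in Ioi (0 : ℝ), g (-x) := by
  have h3 : IntegrableOn g (Set.Iic 0) := by
    have h4 := ((Measure.measurePreserving_neg (volume : Measure ℝ)).integrableOn_comp_preimage
      (Homeomorph.neg ℝ).measurableEmbedding (f := g) (s := Set.Iio 0)).1 (by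
        simpa [Function.comp_def] using h2)
    exact (integrableOn_Iic_iff_integrableOn_Iio (by simp)).2 h4
  refine ⟨?_, ?_⟩
  · rw [← integrableOn_univ, ← Set.Iic_union_Ioi (a := (0 : ℝ))]
    exact h3.union h1
  · rw [integral_comp_neg_Ioi, neg_zero, add_comm, intervalIntegral.integral_Iic_add_Ioi h3 h1]

/-- The function equal to `|x| ^ a` on `[-1, 1]` and to `|x| ^ b` outside; a convenient majorant. -/
def powMajorant (a b x : ℝ) : ℝ := if |x| ≤ 1 then |x| ^ a else |x| ^ b

theorem integrable_powMajorant {a b : ℝ} (ha : -1 < a) (hb : b < -1) :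
    Integrable (powMajorant a b) := by
  have h : IntegrableOn (powMajorant a b) (Ioi 0) := by
    rw [← Set.Ioc_union_Ioi_eq_Ioi (zero_le_one : (0 : ℝ) ≤ 1)]
    refine IntegrableOn.union ?_ ?_
    · have h1 : IntegrableOn (fun x : ℝ => x ^ a) (Set.Ioc 0 1) :=
        (intervalIntegrable_iff_integrableOn_Ioc_of_le zero_le_one).1
          (intervalIntegral.intervalIntegrable_rpow' ha)
      refine h1.congr_fun (fun x hx => ?_) measurableSet_Ioc
      simp only [powMajorant, abs_of_pos hx.1, if_pos hx.2]
    · refine (integrableOn_Ioi_rpow_of_lt hb zero_lt_one).congr_fun (fun x hx => ?_)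
        measurableSet_Ioi
      have hx1 : (1 : ℝ) < x := hx
      simp only [powMajorant, abs_of_pos (zero_lt_one.trans hx1), if_neg (not_le.2 hx1)]
  have h2 := (integrable_and_integral_eq_of_Ioi (g := fun x => ((powMajorant a b x : ℝ) : ℂ))
    h.ofReal (by
      have : (fun x : ℝ => ((powMajorant a b (-x) : ℝ) : ℂ)) =
          fun x : ℝ => ((powMajorant a b x : ℝ) : ℂ) := by
        ext x; simp [powMajorant]
      rw [this]; exact h.ofReal)).1
  simpa using h2.re

/-- The weight `e(-u x) |x| ^ (-2μ - 1) exp (-ε (|x| + 1/|x|))`: the automorphy factor of `w` on the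
big Bruhat cell, a character, and a convergence factor. -/
def bruhatWeight (μ : ℂ) (u ε x : ℝ) : ℂ :=
  e (-(u * x)) * ((|x| : ℝ) : ℂ) ^ (-(2 * μ) - 1) * (Real.exp (-(ε * (|x| + |x|⁻¹))) : ℝ)

theorem bruhatWeight_mul_e_pos (μ : ℂ) (u l ε : ℝ) {t : ℝ} (ht : 0 < t) :
    bruhatWeight μ u ε t * e (-(l / t)) =
      Complex.exp (-((ε + 2 * Real.pi * Complex.I * u) * t) -
        (ε + 2 * Real.pi * Complex.I * l) / t) * (t : ℂ) ^ (-(2 * μ) - 1) := by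
  have htc : (t : ℂ) ≠ 0 := by exact_mod_cast ht.ne'
  rw [bruhatWeight, abs_of_pos ht, e, e, mul_assoc, mul_assoc, mul_left_comm, mul_comm]
  congr 1
  rw [Complex.ofReal_exp, ← Complex.exp_add, ← Complex.exp_add]
  congr 1; push_cast; field_simp; ring

theorem bruhatWeight_mul_e_neg (μ : ℂ) (u l ε : ℝ) {t : ℝ} (ht : 0 < t) :
    bruhatWeight μ u ε (-t) * e (-(l / -t)) =
      Complex.exp (-((ε - 2 * Real.pi * Complex.I * u) * t) -
        (ε - 2 * Real.pi * Complex.I * l) / t) * (t : ℂ) ^ (-(2 * μ) - 1) := by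
  have htc : (t : ℂ) ≠ 0 := by exact_mod_cast ht.ne'
  rw [bruhatWeight, abs_neg, abs_of_pos ht, e, e, mul_assoc, mul_assoc, mul_left_comm, mul_comm]
  congr 1
  rw [Complex.ofReal_exp, ← Complex.exp_add, ← Complex.exp_add]
  congr 1; push_cast; field_simp; ring

/-- The regularized kernel as an integral over the real line. -/
theorem integral_bruhatWeight (μ : ℂ) (u l : ℝ) {ε : ℝ} (hε : 0 < ε) :
    Integrable (fun x => bruhatWeight μ u ε x * e (-(l / x))) ∧
      ∫ x, bruhatWeight μ u ε x * e (-(l / x)) = regKernel μ u l ε := by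
  have hp : ∀ r : ℝ, 0 < (ε + 2 * Real.pi * Complex.I * r : ℂ).re := fun r => by simpa using hε
  have hm : ∀ r : ℝ, 0 < (ε - 2 * Real.pi * Complex.I * r : ℂ).re := fun r => by simpa using hε
  have h1 : IntegrableOn (fun x => bruhatWeight μ u ε x * e (-(l / x))) (Ioi 0) :=
    (integrableOn_macdonald (hp u) (hp l) (2 * μ)).congr_fun
      (fun t ht => (bruhatWeight_mul_e_pos μ u l ε ht).symm) measurableSet_Ioi
  have h2 : IntegrableOn (fun x => bruhatWeight μ u ε (-x) * e (-(l / -x))) (Ioi 0) :=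
    (integrableOn_macdonald (hm u) (hm l) (2 * μ)).congr_fun
      (fun t ht => (bruhatWeight_mul_e_neg μ u l ε ht).symm) measurableSet_Ioi
  obtain ⟨h3, h4⟩ := integrable_and_integral_eq_of_Ioi h1 h2
  refine ⟨h3, ?_⟩
  rw [h4, regKernel, macdonald, macdonald]
  congr 1
  · exact setIntegral_congr_fun measurableSet_Ioi fun t ht => bruhatWeight_mul_e_pos μ u l ε ht
  · exact setIntegral_congr_fun measurableSet_Ioi fun t ht => bruhatWeight_mul_e_neg μ u l ε ht

theorem integrable_bruhatWeight (μ : ℂ) (u : ℝ) {ε : ℝ} (hε : 0 < ε) :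
    Integrable (bruhatWeight μ u ε) := by
  have := (integral_bruhatWeight μ u 0 hε).1
  simpa [e_zero] using this

theorem continuous_regKernel (μ : ℂ) (u : ℝ) {ε : ℝ} (hε : 0 < ε) :
    Continuous fun l => regKernel μ u l ε := by
  have hp : ∀ r : ℝ, 0 < (ε + 2 * Real.pi * Complex.I * r : ℂ).re := fun r => by simpa using hε
  have hm : ∀ r : ℝ, 0 < (ε - 2 * Real.pi * Complex.I * r : ℂ).re := fun r => by simpa using hε
  refine continuous_iff_continuousAt.2 fun l => ContinuousAt.add ?_ ?_
  · exact (hasDerivAt_macdonald (hp u) (hp l) (2 * μ)).continuousAt.comp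
      (f := fun l : ℝ => (ε + 2 * Real.pi * Complex.I * l : ℂ)) (by fun_prop)
  · exact (hasDerivAt_macdonald (hm u) (hm l) (2 * μ)).continuousAt.comp
      (f := fun l : ℝ => (ε - 2 * Real.pi * Complex.I * l : ℂ)) (by fun_prop)

/-- The Fourier transform of `B(x) = |x| ^ (-2μ - 1) A(-1/x)` in terms of that of `A`. -/
theorem integral_e_mul_inversion {μ : ℂ} (h0 : 0 < μ.re) (h1 : μ.re < 1 / 2) {κ : ℝ}
    (hκ : 2 * μ.re < κ) (hκ1 : κ ≤ 1) {A B : ℝ → ℂ} (hA : Integrable A) (hAc : Continuous A)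
    (hB : Integrable B) (hAB : ∀ x, x ≠ 0 → B x = ((|x| : ℝ) : ℂ) ^ (-(2 * μ) - 1) * A (-x⁻¹))
    (hF : Integrable fun l : ℝ => ∫ x, e (-(l * x)) * A x)
    (hF1 : Integrable fun l : ℝ => |l| * ‖∫ x, e (-(l * x)) * A x‖)
    (hF2 : Integrable fun l : ℝ => |l| ^ (-κ) * ‖∫ x, e (-(l * x)) * A x‖) {u : ℝ} (hu : u ≠ 0) :
    ∫ x, e (-(u * x)) * B x = ∫ l : ℝ, (besselKernel μ (u * l) *
      ((|u| : ℝ) : ℂ) ^ (μ - 1 / 2) * ((|l| : ℝ) : ℂ) ^ (-μ - 1 / 2)) *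
        ∫ x, e (-(l * x)) * A x := by
  set F : ℝ → ℂ := fun l => ∫ x, e (-(l * x)) * A x with hFdef
  have hae : ∀ᵐ x : ℝ, x ≠ 0 := by
    rw [ae_iff]; simp
  -- the regularized integral, computed by Fourier inversion and Fubini
  have hreg : ∀ ε : ℝ, 0 < ε →
      ∫ x, (e (-(u * x)) * B x) * (Real.exp (-(ε * (|x| + |x|⁻¹))) : ℝ) =
        ∫ l : ℝ, regKernel μ u l ε * F l := by
    intro ε hε
    have hprod : Integrable (fun z : ℝ × ℝ =>
        e (-(z.2 / z.1)) * (bruhatWeight μ u ε z.1 * F z.2)) (volume.prod volume) := by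
      refine ((integrable_bruhatWeight μ u hε).mul_prod hF).bdd_mul (c := 1) ?_
        (Eventually.of_forall fun x => (norm_e _).le)
      exact (continuous_e.measurable.comp
        (measurable_snd.div measurable_fst).neg).aestronglyMeasurable
    have hl : ∀ᵐ x : ℝ, (e (-(u * x)) * B x) * (Real.exp (-(ε * (|x| + |x|⁻¹))) : ℝ) =
        ∫ l : ℝ, e (-(l / x)) * (bruhatWeight μ u ε x * F l) := by
      filter_upwards [hae] with x hx
      simp only [mul_left_comm (e _)]
      rw [integral_const_mul]
      have h2 := fourier_inversion hA hAc hF (-x⁻¹)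
      have h3 : ∫ l : ℝ, e (-(l / x)) * F l = A (-x⁻¹) := by
        rw [← h2]
        congr 1; ext l
        rw [mul_neg, div_eq_mul_inv]
      rw [h3, hAB x hx, bruhatWeight]
      ring
    rw [integral_congr_ae hl, integral_integral_swap hprod]
    congr 1; ext l
    rw [← (integral_bruhatWeight μ u l hε).2, ← integral_mul_const]
    congr 1; ext x
    ring
  have hlim1 : Tendsto (fun ε : ℝ =>
      ∫ x, (e (-(u * x)) * B x) * (Real.exp (-(ε * (|x| + |x|⁻¹))) : ℝ)) (𝓝[>] 0)
      (𝓝 (∫ x, e (-(u * x)) * B x)) := by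
    have hBi := integrable_e_mul hB u
    have hmeas : ∀ ε : ℝ, AEStronglyMeasurable
        (fun x : ℝ => ((Real.exp (-(ε * (|x| + |x|⁻¹))) : ℝ) : ℂ)) volume := fun ε => by
      refine Measurable.aestronglyMeasurable ?_
      fun_prop
    refine tendsto_integral_filter_of_dominated_convergence (fun x => ‖e (-(u * x)) * B x‖)
      (Eventually.of_forall fun ε => hBi.aestronglyMeasurable.mul (hmeas ε)) ?_ hBi.norm ?_
    · filter_upwards [self_mem_nhdsWithin] with ε hε
      have hε0 : (0 : ℝ) < ε := hε
      refine Eventually.of_forall fun x => ?_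
      rw [norm_mul, Complex.norm_real, Real.norm_of_nonneg (Real.exp_pos _).le]
      refine mul_le_of_le_one_right (norm_nonneg _) ?_
      rw [Real.exp_le_one_iff, Left.neg_nonpos_iff]
      positivity
    · refine Eventually.of_forall fun x => ?_
      have hc : Continuous fun ε : ℝ =>
          (e (-(u * x)) * B x) * (Real.exp (-(ε * (|x| + |x|⁻¹))) : ℝ) := by fun_prop
      have := (hc.tendsto 0).mono_left (nhdsWithin_le_nhds (s := Ioi 0))
      simpa using this
  have hlim2 : Tendsto (fun ε : ℝ => ∫ l : ℝ, regKernel μ u l ε * F l) (𝓝[>] 0)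
      (𝓝 (∫ l : ℝ, (besselKernel μ (u * l) *
      ((|u| : ℝ) : ℂ) ^ (μ - 1 / 2) * ((|l| : ℝ) : ℂ) ^ (-μ - 1 / 2)) * F l)) := by
    obtain ⟨C, hC0, hC⟩ := norm_regKernel_le hκ hκ1 h0.le ‖μ‖
    refine tendsto_integral_filter_of_dominated_convergence
      (fun l => C * |u| ^ (-κ) * (2 * ‖F l‖ + |l| * ‖F l‖) +
        C * (2 + |u|) * (|l| ^ (-κ) * ‖F l‖)) ?_ ?_ ?_ ?_
    · filter_upwards [self_mem_nhdsWithin] with ε hε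
      exact (continuous_regKernel μ u hε).aestronglyMeasurable.mul hF.aestronglyMeasurable
    · filter_upwards [Ioo_mem_nhdsGT zero_lt_one] with ε hε
      filter_upwards [hae] with l hl
      have := hC μ (by rw [abs_of_pos h0]) le_rfl u l ε hu hl hε.1
      rw [norm_mul]
      have hε1 := hε.2
      calc ‖regKernel μ u l ε‖ * ‖F l‖
          ≤ (C * ((1 + ε + |l|) * |u| ^ (-κ) + (1 + ε + |u|) * |l| ^ (-κ))) * ‖F l‖ := by gcongr
        _ ≤ (C * ((1 + 1 + |l|) * |u| ^ (-κ) + (1 + 1 + |u|) * |l| ^ (-κ))) * ‖F l‖ := by gcongr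
        _ = _ := by ring
    · exact (((hF.norm.const_mul 2).add hF1).const_mul _).add (hF2.const_mul _)
    · filter_upwards [hae] with l hl
      exact (tendsto_regKernel h0 h1 hu hl).mul_const _
  -- the two limits as `ε → 0` coincide
  refine tendsto_nhds_unique hlim1 (hlim2.congr' ?_)
  filter_upwards [self_mem_nhdsWithin] with ε hε using (hreg ε hε).symm

/-! ### The action of the Weyl element -/

/-- The relation between the profiles of a function and of its translate by `w` does not depend on
the parameter: the factors `(1 + x²) ^ (ν - μ)` on the two sides match. -/
theorem symb_inv_of_symb_inv {ν : ℂ} {f g : ℝ → ℂ}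
    (h : ∀ x : ℝ, x ≠ 0 → symb (ν + 1 / 2) g x =
      ((|x| : ℝ) : ℂ) ^ (-(2 * ν) - 1) * symb (ν + 1 / 2) f (-x⁻¹)) (μ : ℂ) {x : ℝ} (hx : x ≠ 0) :
    symb (μ + 1 / 2) g x =
      ((|x| : ℝ) : ℂ) ^ (-(2 * μ) - 1) * symb (μ + 1 / 2) f (-x⁻¹) := by
  have hx' := abs_pos.2 hx
  have h1 := h x hx
  have p1 := one_add_sq_pos x
  have p2 := one_add_sq_pos (-x⁻¹)
  have hmul : 1 + x ^ 2 = |x| ^ 2 * (1 + (-x⁻¹) ^ 2) := by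
    rw [sq_abs]; field_simp; ring
  have hlog : Real.log (1 + x ^ 2) = 2 * Real.log |x| + Real.log (1 + (-x⁻¹) ^ 2) := by
    rw [hmul, Real.log_mul (by positivity) p2.ne', Real.log_pow]; push_cast; ring
  have hs : ∀ (f : ℝ → ℂ) (y : ℝ), symb (μ + 1 / 2) f y =
      Complex.exp ((ν - μ) * (Real.log (1 + y ^ 2) : ℝ)) * symb (ν + 1 / 2) f y := by
    intro f y
    rw [symb, symb, ofReal_cpow_eq_exp (one_add_sq_pos y), ofReal_cpow_eq_exp (one_add_sq_pos y),
      ← mul_assoc, ← Complex.exp_add]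
    congr 2; ring
  rw [hs g, hs f, h1, hlog, ← mul_assoc, ← mul_assoc]
  congr 1
  rw [ofReal_cpow_eq_exp hx', ofReal_cpow_eq_exp hx', ← Complex.exp_add, ← Complex.exp_add]
  congr 1; push_cast; ring

theorem norm_le_mul_powMajorant {c C a b x y : ℝ} (h1 : |x| ≤ 1 → y ≤ c * |x| ^ a)
    (h2 : 1 < |x| → y ≤ C * |x| ^ b) (hc : 0 ≤ c) (hC : 0 ≤ C) :
    y ≤ (c + C) * powMajorant a b x := by
  unfold powMajorant
  split_ifs with h
  · refine (h1 h).trans ?_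
    gcongr
    linarith
  · refine (h2 (not_le.1 h)).trans ?_
    gcongr
    linarith

/-- The function `t ↦ 𝒦φ(t)` attached to the profile `f` of a lift, for every `μ` with
`Re μ > -1/2`, where one integration by parts suffices. -/
def kirillovFunction (f : ℝ → ℂ) (μ : ℂ) (t : ℝ) : ℂ :=
  ((|t| : ℝ) : ℂ) ^ (1 / 2 - μ) * regFourier 1 t (symb (μ + 1 / 2) f)

/-- The formula for the action of `w` where the Jacquet integrals converge absolutely. -/
theorem kirillov_w_of_re_pos {f g : ℝ → ℂ} (hf : ContDiff ℝ ∞ f) (hg : ContDiff ℝ ∞ g) {μ : ℂ}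
    (h0 : 0 < μ.re) (h1 : μ.re < 1 / 2)
    (hfg : ∀ x : ℝ, x ≠ 0 → symb (μ + 1 / 2) g x =
      ((|x| : ℝ) : ℂ) ^ (-(2 * μ) - 1) * symb (μ + 1 / 2) f (-x⁻¹)) {u : ℝ} (hu : u ≠ 0) :
    kirillovFunction g μ u = ∫ t : ℝ in {0}ᶜ, besselKernel μ (u * t) *
      kirillovFunction f μ t * ((|t|⁻¹ : ℝ) : ℂ) := by
  have hre : (μ + 1 / 2).re = μ.re + 1 / 2 := by simp
  have hs : ∀ N : ℕ, 1 / 2 < (μ + 1 / 2).re + N / 2 := fun N => by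
    rw [hre]; have : (0 : ℝ) ≤ N := by positivity
    linarith
  have hF0 : ∀ (f : ℝ → ℂ) (l : ℝ), ∫ x, e (-(l * x)) * symb (μ + 1 / 2) f x =
      regFourier 0 l (symb (μ + 1 / 2) f) := fun f l => by simp [regFourier]
  set κ := μ.re + 1 / 2 with hκ
  obtain ⟨C₀, hC₀0, hC₀⟩ := norm_regFourier_le 0 hf ‖μ + 1 / 2‖ (σ := (μ + 1 / 2).re) (hs 0)
  obtain ⟨C₄, hC₄0, hC₄⟩ := norm_regFourier_le 4 hf ‖μ + 1 / 2‖ (σ := (μ + 1 / 2).re) (hs 4)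
  have b0 : ∀ l, ‖regFourier 0 l (symb (μ + 1 / 2) f)‖ ≤ C₀ := fun l => by
    simpa using hC₀ _ le_rfl le_rfl l
  have b4 : ∀ l, 1 < |l| → ‖regFourier 0 l (symb (μ + 1 / 2) f)‖ ≤ C₄ * |l| ^ (-4 : ℝ) := by
    intro l hl
    have hl0 : l ≠ 0 := abs_pos.1 (by linarith)
    rw [regFourier_eq (M := 4) hl0 hf (hs 0) (hs 4)]
    refine (hC₄ _ le_rfl le_rfl l).trans (le_of_eq ?_)
    rw [Real.rpow_neg (abs_nonneg _), inv_pow]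
    norm_cast
  have hmeas := measurable_regFourier 0 hf (hs 0)
  have hpow : Measurable fun l : ℝ => |l| ^ (-κ) := by fun_prop
  have hae : ∀ᵐ x : ℝ, x ≠ 0 := by
    rw [ae_iff]; simp
  have key := integral_e_mul_inversion h0 h1 (κ := κ) (by linarith) (by linarith)
    (A := symb (μ + 1 / 2) f) (B := symb (μ + 1 / 2) g)
    (by simpa using integrable_iteratedDeriv_symb 0 hf (hs 0))
    (contDiff_symb _ hf).continuous
    (by simpa using integrable_iteratedDeriv_symb 0 hg (hs 0)) hfg
    (by
      simp only [hF0]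
      refine ((integrable_powMajorant (a := 0) (b := -4) (by norm_num) (by norm_num)).const_mul
        (C₀ + C₄)).mono' hmeas.aestronglyMeasurable (Eventually.of_forall fun l => ?_)
      exact norm_le_mul_powMajorant (fun _ => by simpa using b0 l) (b4 l) hC₀0 hC₄0)
    (by
      simp only [hF0]
      refine ((integrable_powMajorant (a := 0) (b := -3) (by norm_num) (by norm_num)).const_mul
        (C₀ + C₄)).mono' (by fun_prop) (Eventually.of_forall fun l => ?_)
      rw [Real.norm_of_nonneg (by positivity)]
      refine norm_le_mul_powMajorant (fun hl => ?_) (fun hl => ?_) hC₀0 hC₄0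
      · rw [Real.rpow_zero, mul_one]
        exact (mul_le_of_le_one_left (norm_nonneg _) hl).trans (b0 l)
      · have hl0 : 0 < |l| := by linarith
        refine (mul_le_mul_of_nonneg_left (b4 l hl) hl0.le).trans (le_of_eq ?_)
        rw [show (-3 : ℝ) = 1 + -4 by norm_num, Real.rpow_add hl0, Real.rpow_one]; ring)
    (by
      simp only [hF0]
      refine ((integrable_powMajorant (a := -κ) (b := -4) (by linarith) (by norm_num)).const_mul
        (C₀ + C₄)).mono' (by fun_prop) (Eventually.of_forall fun l => ?_)
      rw [Real.norm_of_nonneg (by positivity)]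
      refine norm_le_mul_powMajorant (fun hl => ?_) (fun hl => ?_) hC₀0 hC₄0
      · rw [mul_comm]
        exact mul_le_mul_of_nonneg_right (b0 l) (by positivity)
      · have : |l| ^ (-κ) ≤ 1 := Real.rpow_le_one_of_one_le_of_nonpos hl.le (by linarith)
        exact (mul_le_of_le_one_left (norm_nonneg _) this).trans (b4 l hl)) hu
  have hu' := abs_pos.2 hu
  rw [kirillovFunction, regFourier_eq (M := 0) hu hg (hs 1) (hs 0), ← hF0, key,
    restrict_compl_singleton, ← integral_const_mul]
  refine integral_congr_ae ?_
  filter_upwards [hae] with l hl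
  have hl' := abs_pos.2 hl
  rw [kirillovFunction, regFourier_eq (M := 0) hl hf (hs 1) (hs 0), ← hF0]
  have e1 : ((|u| : ℝ) : ℂ) ^ (1 / 2 - μ) * ((|u| : ℝ) : ℂ) ^ (μ - 1 / 2) = 1 := by
    rw [ofReal_cpow_eq_exp hu', ofReal_cpow_eq_exp hu', ← Complex.exp_add, ← Complex.exp_zero]
    congr 1; ring
  have e2 : ((|l| : ℝ) : ℂ) ^ (1 / 2 - μ) * ((|l|⁻¹ : ℝ) : ℂ) =
      ((|l| : ℝ) : ℂ) ^ (-μ - 1 / 2) := by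
    conv_lhs => rw [← Complex.cpow_one ((|l|⁻¹ : ℝ) : ℂ)]
    rw [ofReal_cpow_eq_exp hl', ofReal_cpow_eq_exp hl', ofReal_cpow_eq_exp (inv_pos.2 hl'),
      Real.log_inv, ← Complex.exp_add]
    congr 1; push_cast; ring
  rw [← e2]
  linear_combination (besselKernel μ (u * l) * ((|l| : ℝ) : ℂ) ^ (1 / 2 - μ) *
    ((|l|⁻¹ : ℝ) : ℂ) * ∫ x, e (-(l * x)) * symb (μ + 1 / 2) f x) * e1

/-- A majorant of the integrand of the Bessel transform, locally uniform in the parameter. With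
`ρ = |Re μ₀|`, the exponents at the origin add up to `-2ρ - 7r`, and the radius `r` is chosen so
that this equals `-1 + (1 - 2ρ)/2 > -1`. -/
theorem exists_majorant {f : ℝ → ℂ} (hf : ContDiff ℝ ∞ f) {u : ℝ} (hu : u ≠ 0) {μ₀ : ℂ}
    (hμ₀ : |μ₀.re| < 1 / 2) :
    ∃ r > 0, ∃ a b C : ℝ, -1 < a ∧ b < -1 ∧ Metric.ball μ₀ r ⊆ {μ | |μ.re| < 1 / 2} ∧
      ∀ μ ∈ Metric.ball μ₀ r, ∀ t : ℝ, t ≠ 0 →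
        ‖besselKernel μ (u * t) * kirillovFunction f μ t * ((|t|⁻¹ : ℝ) : ℂ)‖ ≤
          C * powMajorant a b t := by
  set ρ := |μ₀.re| with hρ
  have hρ0 : 0 ≤ ρ := abs_nonneg _
  obtain ⟨m1, m2⟩ := abs_le.1 (le_refl |μ₀.re|)
  rw [← hρ] at m1 m2
  set r := (1 - 2 * ρ) / 14 with hr
  have hr0 : 0 < r := by rw [hr]; linarith
  have hball : ∀ μ ∈ Metric.ball μ₀ r, |μ.re - μ₀.re| < r ∧ ‖μ‖ ≤ ‖μ₀‖ + r := by
    intro μ hμ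
    rw [Metric.mem_ball, dist_eq_norm] at hμ
    refine ⟨?_, ?_⟩
    · rw [← Complex.sub_re]
      exact (Complex.abs_re_le_norm _).trans_lt hμ
    · have := norm_le_norm_add_norm_sub' μ μ₀
      linarith
  have habs : ∀ μ ∈ Metric.ball μ₀ r, |μ.re| ≤ ρ + r := by
    intro μ hμ
    have h1 := abs_lt.1 (hball μ hμ).1
    exact abs_le.2 ⟨by linarith, by linarith⟩
  obtain ⟨C₁, hC₁0, hC₁⟩ := norm_besselKernel_le (σ := ρ + r) (κ := 2 * ρ + 4 * r) (by linarith)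
    (by linarith) (by linarith) (‖μ₀‖ + r)
  obtain ⟨C₂, hC₂0, hC₂⟩ := norm_regFourier_one_le hf (‖μ₀‖ + r + 1 / 2)
    (σ := μ₀.re - r + 1 / 2) (κ := 1 + μ₀.re - ρ - 4 * r) (by linarith) (by linarith)
    (by linarith) (by linarith)
  obtain ⟨C₄, hC₄0, hC₄⟩ := norm_regFourier_le 4 hf (‖μ₀‖ + r + 1 / 2)
    (σ := μ₀.re - r + 1 / 2) (by push_cast; linarith)
  set U₁ := |u| ^ (1 / 2 - (2 * ρ + 4 * r) / 2) with hU₁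
  set U₂ := |u| ^ (1 / 2 : ℝ) with hU₂
  have hu' := abs_pos.2 hu
  have hU₁0 : 0 < U₁ := Real.rpow_pos_of_pos hu' _
  have hU₂0 : 0 < U₂ := Real.rpow_pos_of_pos hu' _
  refine ⟨r, hr0, -1 + (1 - 2 * ρ) / 2, -2,
    C₁ * ((1 + U₂) * U₁) * C₂ + C₁ * ((1 + U₂) * U₁) * C₄, by linarith, by norm_num, ?_, ?_⟩
  · intro μ hμ
    have := habs μ hμ
    show |μ.re| < 1 / 2
    linarith
  intro μ hμ t ht
  have ht' := abs_pos.2 ht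
  obtain ⟨g1, g2⟩ := hball μ hμ
  obtain ⟨g3, g4⟩ := abs_lt.1 g1
  have hsR : ‖μ + 1 / 2‖ ≤ ‖μ₀‖ + r + 1 / 2 := by
    refine (norm_add_le _ _).trans (add_le_add g2 ?_)
    norm_num
  have hsre : μ₀.re - r + 1 / 2 ≤ (μ + 1 / 2).re := by
    simp; linarith
  have hj := hC₁ μ (habs μ hμ) g2 (u * t) (mul_ne_zero hu ht)
  rw [abs_mul, Real.mul_rpow hu'.le ht'.le, Real.mul_rpow hu'.le ht'.le, ← hU₁, ← hU₂] at hj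
  have hK : ‖kirillovFunction f μ t‖ =
      |t| ^ (1 / 2 - μ.re) * ‖regFourier 1 t (symb (μ + 1 / 2) f)‖ := by
    rw [kirillovFunction, norm_mul, Complex.norm_cpow_eq_rpow_re_of_pos ht']
    simp
  have hinv : ‖((|t|⁻¹ : ℝ) : ℂ)‖ = |t| ^ (-1 : ℝ) := by
    rw [Complex.norm_real, Real.norm_of_nonneg (by positivity), Real.rpow_neg_one]
  refine norm_le_mul_powMajorant (fun h => ?_) (fun h => ?_) (by positivity) (by positivity)
  · -- near the origin
    have h2 := hC₂ (μ + 1 / 2) hsR hsre t ht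
    have h3 : |t| ^ (1 / 2 : ℝ) ≤ 1 := Real.rpow_le_one ht'.le h (by norm_num)
    have h4 : |t| ^ (1 / 2 - μ.re) ≤ |t| ^ (1 / 2 - (μ₀.re + r)) :=
      Real.rpow_le_rpow_of_exponent_ge ht' h (by linarith)
    rw [norm_mul, norm_mul, hK, hinv]
    calc _ ≤ (C₁ * ((1 + U₂ * 1) * (U₁ * |t| ^ (1 / 2 - (2 * ρ + 4 * r) / 2)))) *
          (|t| ^ (1 / 2 - (μ₀.re + r)) * (C₂ * |t| ^ (1 + μ₀.re - ρ - 4 * r - 1))) *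
          |t| ^ (-1 : ℝ) := by
          gcongr
          refine hj.trans ?_
          gcongr
      _ = C₁ * ((1 + U₂) * U₁) * C₂ * (|t| ^ (1 / 2 - (2 * ρ + 4 * r) / 2) *
          |t| ^ (1 / 2 - (μ₀.re + r)) * |t| ^ (1 + μ₀.re - ρ - 4 * r - 1) * |t| ^ (-1 : ℝ)) := by
          ring
      _ = _ := by
          rw [← Real.rpow_add ht', ← Real.rpow_add ht', ← Real.rpow_add ht']
          congr 2
          rw [hr]; ring
  · -- near infinity
    have h2 := hC₄ (μ + 1 / 2) hsR hsre t
    rw [regFourier_eq (M := 4) ht hf (N := 1) (by push_cast; linarith) (by push_cast; linarith)]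
      at hK
    rw [show |t|⁻¹ ^ 4 = |t| ^ (-4 : ℝ) by
      rw [Real.rpow_neg (abs_nonneg _), inv_pow]; norm_cast] at h2
    have h3 : 1 + U₂ * |t| ^ (1 / 2 : ℝ) ≤ (1 + U₂) * |t| ^ (1 / 2 : ℝ) := by
      have := Real.one_le_rpow h.le (by norm_num : (0 : ℝ) ≤ 1 / 2)
      nlinarith
    have h4 : |t| ^ (1 / 2 - μ.re) ≤ |t| ^ (1 : ℝ) :=
      Real.rpow_le_rpow_of_exponent_le h.le (by linarith)
    have h5 : |t| ^ (1 / 2 - (2 * ρ + 4 * r) / 2) ≤ |t| ^ (1 / 2 : ℝ) :=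
      Real.rpow_le_rpow_of_exponent_le h.le (by linarith)
    rw [norm_mul, norm_mul, hK, hinv]
    calc _ ≤ (C₁ * (((1 + U₂) * |t| ^ (1 / 2 : ℝ)) * (U₁ * |t| ^ (1 / 2 : ℝ)))) *
          (|t| ^ (1 : ℝ) * (C₄ * |t| ^ (-4 : ℝ))) * |t| ^ (-1 : ℝ) := by
          gcongr
          refine hj.trans ?_
          gcongr
      _ = C₁ * ((1 + U₂) * U₁) * C₄ * (|t| ^ (1 / 2 : ℝ) * |t| ^ (1 / 2 : ℝ) *
          |t| ^ (1 : ℝ) * |t| ^ (-4 : ℝ) * |t| ^ (-1 : ℝ)) := by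
          ring
      _ ≤ _ := by
          rw [← Real.rpow_add ht', ← Real.rpow_add ht', ← Real.rpow_add ht', ← Real.rpow_add ht']
          gcongr
          · exact h.le
          · norm_num

theorem one_half_lt_add_one {μ : ℂ} (hμ : |μ.re| < 1 / 2) :
    1 / 2 < (μ + 1 / 2).re + ((1 : ℕ) : ℝ) / 2 := by
  have := (abs_lt.1 hμ).1
  simp
  linarith

theorem measurable_integrand {f : ℝ → ℂ} (hf : ContDiff ℝ ∞ f) (u : ℝ) {μ : ℂ}
    (hμ : |μ.re| < 1 / 2) :
    Measurable fun t : ℝ => besselKernel μ (u * t) * kirillovFunction f μ t *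
      ((|t|⁻¹ : ℝ) : ℂ) := by
  have h1 : Measurable fun t : ℝ => besselKernel μ (u * t) :=
    (measurable_besselKernel hμ).comp (measurable_const_mul u)
  have h2 : Measurable fun t : ℝ => kirillovFunction f μ t :=
    (Measurable.pow_const (by fun_prop) _).mul (measurable_regFourier 1 hf (one_half_lt_add_one hμ))
  have h3 : Measurable fun t : ℝ => ((|t|⁻¹ : ℝ) : ℂ) := by fun_prop
  exact (h1.mul h2).mul h3

theorem integrableOn_integrand {f : ℝ → ℂ} (hf : ContDiff ℝ ∞ f) {u : ℝ} (hu : u ≠ 0) {μ : ℂ}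
    (hμ : |μ.re| < 1 / 2) :
    IntegrableOn (fun t : ℝ => besselKernel μ (u * t) * kirillovFunction f μ t *
      ((|t|⁻¹ : ℝ) : ℂ)) {0}ᶜ := by
  obtain ⟨r, hr, a, b, C, ha, hb, -, hC⟩ := exists_majorant hf hu hμ
  refine Integrable.mono' ((integrable_powMajorant ha hb).const_mul C).integrableOn
    (measurable_integrand hf u hμ).aestronglyMeasurable ?_
  refine (ae_restrict_iff' (measurableSet_singleton 0).compl).2 (Eventually.of_forall fun t ht => ?_)
  exact hC μ (Metric.mem_ball_self hr) t ht

theorem differentiableAt_kirillovFunction {f : ℝ → ℂ} (hf : ContDiff ℝ ∞ f) {t : ℝ} (ht : t ≠ 0)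
    {μ : ℂ} (hμ : |μ.re| < 1 / 2) :
    DifferentiableAt ℂ (fun μ => kirillovFunction f μ t) μ := by
  have htc : ((|t| : ℝ) : ℂ) ≠ 0 := by exact_mod_cast (abs_pos.2 ht).ne'
  have h1 : DifferentiableAt ℂ (fun μ : ℂ => 1 / 2 - μ) μ := by fun_prop
  have h2 : DifferentiableAt ℂ (fun μ : ℂ => μ + 1 / 2) μ := by fun_prop
  have h3 : DifferentiableAt ℂ
      ((fun s => regFourier 1 t (symb s f)) ∘ fun μ : ℂ => μ + 1 / 2) μ :=
    DifferentiableAt.comp μ (differentiableAt_regFourier 1 t hf (one_half_lt_add_one hμ)) h2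
  exact (h1.const_cpow (Or.inl htc)).mul h3

theorem differentiableOn_integral {f : ℝ → ℂ} (hf : ContDiff ℝ ∞ f) {u : ℝ} (hu : u ≠ 0) :
    DifferentiableOn ℂ (fun μ => ∫ t : ℝ in {0}ᶜ, besselKernel μ (u * t) *
      kirillovFunction f μ t * ((|t|⁻¹ : ℝ) : ℂ)) {μ : ℂ | |μ.re| < 1 / 2} := by
  intro μ₀ hμ₀
  obtain ⟨r, hr, a, b, C, ha, hb, hsub, hC⟩ := exists_majorant hf hu hμ₀
  refine (differentiableAt_integral_of_bound hr
    (fun μ hμ => (measurable_integrand hf u (hsub hμ)).aestronglyMeasurable) ?_ ?_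
    ((integrable_powMajorant ha hb).const_mul C).integrableOn).differentiableWithinAt
  · refine (ae_restrict_iff' (measurableSet_singleton 0).compl).2
      (Eventually.of_forall fun t ht => ?_)
    refine DifferentiableOn.mul_const (DifferentiableOn.mul ?_ ?_) _
    · exact (differentiableOn_besselKernel (u * t)).mono hsub
    · exact fun μ hμ =>
        (differentiableAt_kirillovFunction hf ht (hsub hμ)).differentiableWithinAt
  · refine (ae_restrict_iff' (measurableSet_singleton 0).compl).2
      (Eventually.of_forall fun t ht μ hμ => hC μ hμ t ht)

/-- The formula for the action of `w` in the whole strip, by analytic continuation in the parameter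
with the two profiles fixed. -/
theorem kirillov_w {f g : ℝ → ℂ} (hf : ContDiff ℝ ∞ f) (hg : ContDiff ℝ ∞ g) {ν : ℂ}
    (hν : |ν.re| < 1 / 2)
    (hfg : ∀ x : ℝ, x ≠ 0 → symb (ν + 1 / 2) g x =
      ((|x| : ℝ) : ℂ) ^ (-(2 * ν) - 1) * symb (ν + 1 / 2) f (-x⁻¹)) {u : ℝ} (hu : u ≠ 0) :
    kirillovFunction g ν u = ∫ t : ℝ in {0}ᶜ, besselKernel ν (u * t) *
      kirillovFunction f ν t * ((|t|⁻¹ : ℝ) : ℂ) := by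
  have hF : AnalyticOnNhd ℂ (fun μ => kirillovFunction g μ u) {μ : ℂ | |μ.re| < 1 / 2} :=
    DifferentiableOn.analyticOnNhd (fun μ hμ =>
      (differentiableAt_kirillovFunction hg hu hμ).differentiableWithinAt) isOpen_strip
  have hG := (differentiableOn_integral hf hu).analyticOnNhd isOpen_strip
  have hconv : IsPreconnected {μ : ℂ | |μ.re| < 1 / 2} := by
    have : {μ : ℂ | |μ.re| < 1 / 2} = {μ : ℂ | -(1 / 2) < μ.re} ∩ {μ : ℂ | μ.re < 1 / 2} := by
      ext μ
      exact abs_lt (a := μ.re)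
    rw [this]
    exact ((convex_halfSpace_re_gt _).inter (convex_halfSpace_re_lt _)).isPreconnected
  -- the two sides agree near `1/4`, which lies in the range of absolute convergence
  have hz : (1 / 4 : ℂ) ∈ {μ : ℂ | |μ.re| < 1 / 2} := by
    show |(1 / 4 : ℂ).re| < 1 / 2
    norm_num
  refine hF.eqOn_of_preconnected_of_eventuallyEq hG hconv hz ?_ hν
  have h1 : {μ : ℂ | 0 < μ.re} ∈ 𝓝 (1 / 4 : ℂ) :=
    (isOpen_lt continuous_const Complex.continuous_re).mem_nhds (by simp)
  filter_upwards [h1, isOpen_strip.mem_nhds hz] with μ hμ hμ'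
  exact kirillov_w_of_re_pos hf hg hμ (abs_lt.1 hμ').2
    (fun x hx => symb_inv_of_symb_inv hfg μ hx) hu

theorem IsLift.kirillov_eq_kirillovFunction {ν : ℂ} {φ : G → ℂ} {Ψ : ℂ → ℂ} (hΨ : IsLift ν φ Ψ)
    (hν : |ν.re| < 1 / 2) {u : ℝ} (hu : u ≠ 0) :
    kirillov ν φ u = kirillovFunction (profile Ψ 1) ν u := by
  have := (abs_lt.1 hν).1
  rw [hΨ.kirillov_eq hu (N := 1) (by push_cast; linarith), hΨ.eq_symb_one, kirillovFunction]

theorem IsLift.symb_translate_w {ν : ℂ} {φ : G → ℂ} {Ψ : ℂ → ℂ} (hΨ : IsLift ν φ Ψ) {x : ℝ}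
    (hx : x ≠ 0) :
    symb (ν + 1 / 2) (profile (fun z => Ψ (rowAct wSL z)) 1) x =
      ((|x| : ℝ) : ℂ) ^ (-(2 * ν) - 1) * symb (ν + 1 / 2) (profile Ψ 1) (-x⁻¹) := by
  have h1 := congrFun (hΨ.translate wSL).eq_symb_one x
  have h2 := congrFun hΨ.eq_symb_one (-x⁻¹)
  rw [← h1, ← h2]
  have h3 : rowAct wSL ((x : ℂ) - Complex.I) =
      ((-x : ℝ) : ℂ) * (((-x⁻¹ : ℝ) : ℂ) - Complex.I) := by
    have hxc : (x : ℂ) ≠ 0 := by exact_mod_cast hx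
    simp [rowAct, wSL]
    field_simp
    ring
  rw [h3, hΨ.homogeneous _ (neg_ne_zero.2 hx), abs_neg, show -(2 * ν + 1) = -(2 * ν) - 1 by ring]
  intro h
  simpa using congrArg Complex.im h

end Kirillov

end

theorem lemma6p1 (ν : ℂ) (φ : Kirillov.G → ℂ) (hφ : Kirillov.IsSmoothVector ν φ) :
    -- the Jacquet transform, hence the Kirillov operator, is defined on `φ` and its translates
    (∀ (h g : Kirillov.G) (δ : ℝ), δ = 1 ∨ δ = -1 →
      ∃ F : ℂ → ℂ, Kirillov.IsJacquetContinuation δ ν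
        (Kirillov.rightTranslation h φ) g F) ∧
    (∀ x u : ℝ, u ≠ 0 →
      Kirillov.kirillov ν (Kirillov.rightTranslation (Kirillov.n x) φ) u =
        Kirillov.e (u * x) * Kirillov.kirillov ν φ u) ∧
    (∀ y u : ℝ, 0 < y → u ≠ 0 →
      Kirillov.kirillov ν (Kirillov.rightTranslation (Kirillov.a y) φ) u =
        Kirillov.kirillov ν φ (u * y)) ∧
    (|ν.re| < 1 / 2 →
      -- the kernel is given by the Bessel quotient, by continuity in `ν` at `ν = 0`
      (∀ u : ℝ, u ≠ 0 →
        Tendsto (fun μ : ℂ => Kirillov.besselQuotient μ u) (𝓝[≠] ν)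
          (𝓝 (Kirillov.besselKernel ν u))) ∧
      ∀ u : ℝ, u ≠ 0 →
        IntegrableOn (fun t : ℝ => Kirillov.besselKernel ν (u * t) *
          Kirillov.kirillov ν φ t * ((|t|⁻¹ : ℝ) : ℂ)) {0}ᶜ ∧
        Kirillov.kirillov ν (Kirillov.rightTranslation Kirillov.w φ) u =
          ∫ t : ℝ in {0}ᶜ, Kirillov.besselKernel ν (u * t) *
            Kirillov.kirillov ν φ t * ((|t|⁻¹ : ℝ) : ℂ)) := by
  obtain ⟨Ψ, hΨ⟩ := hφ.exists_isLift
  refine ⟨fun h g δ hδ => ?_, fun x u hu => hΨ.kirillov_translate_n x hu,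
    fun y u hy hu => hΨ.kirillov_translate_a hy hu, fun hν =>
    ⟨fun u _ => Kirillov.tendsto_besselQuotient hν u, fun u hu => ?_⟩⟩
  · obtain ⟨h, rfl⟩ := QuotientGroup.mk_surjective h
    obtain ⟨g, rfl⟩ := QuotientGroup.mk_surjective g
    exact ⟨_, (hΨ.translate h).isJacquetContinuation g (by rcases hδ with rfl | rfl <;> norm_num)⟩
  · have hf := hΨ.contDiff_profile one_ne_zero
    have hΨw := hΨ.translate Kirillov.wSL
    have hcongr : Set.EqOn (fun t : ℝ => Kirillov.besselKernel ν (u * t) *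
          Kirillov.kirillov ν φ t * ((|t|⁻¹ : ℝ) : ℂ))
        (fun t : ℝ => Kirillov.besselKernel ν (u * t) *
          Kirillov.kirillovFunction (Kirillov.profile Ψ 1) ν t * ((|t|⁻¹ : ℝ) : ℂ)) {0}ᶜ := by
      intro t ht
      simp only [hΨ.kirillov_eq_kirillovFunction hν ht]
    have hm : MeasurableSet ({0}ᶜ : Set ℝ) := (measurableSet_singleton 0).compl
    refine ⟨(Kirillov.integrableOn_integrand hf hu hν).congr_fun hcongr.symm hm, ?_⟩
    rw [setIntegral_congr_fun hm hcongr, show Kirillov.w = Kirillov.ofSL Kirillov.wSL from rfl,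
      hΨw.kirillov_eq_kirillovFunction hν hu]
    exact Kirillov.kirillov_w hf (hΨw.contDiff_profile one_ne_zero) hν
      (fun x hx => hΨ.symb_translate_w hx) hu
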